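/- **Setting.** Let $U\subset\mathbb R^2$ be a bounded open neighbourhood of the origin and $r\ge 1$. Let $\Omega$ be the space of pairs $Z=(X,Y)$ of $C^r$ vector fields on $\overline U$, with the $C^r$ norm; $Z$ is read as the piecewise smooth field equal to $X$ where $x_1x_2>0$ and to $Y$ where $x_1x_2<0$, with Filippov's sliding fields on the sliding and escaping parts of $\Sigma_i=\{x_i=0\}$, $\Sigma=\Sigma_1\cup\Sigma_2$. Trajectories through sliding and escaping points follow the sliding field only; trajectories are concatenated at crossing points $(X_iY_i>0)$; a tangency point other than the origin is a trajectory by itself unless the trajectories through the points of $\Sigma$ on its two sides have a common limit there. The origin moves along the orbit of $X$ or $Y$ through it if $\Sigma$ is the closure of its crossing part near the origin, along the sliding field of $\Sigma_i$ if only $\Sigma_i$ has sliding or escaping points arbitrarily near the origin, the other line has crossing points there and the sliding field is defined at the origin, and is a trajectory by itself otherwise. $Z$ and $\tilde Z$ are *locally $\Sigma$-equivalent* if a homeomorphism between neighbourhoods of the origin, fixing the origin, preserving the orientation of the plane and mapping $\Sigma$ to $\Sigma$, maps the trajectories of $Z$ onto those of $\tilde Z$ with their direction of time. An $m$-parameter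 *unfolding* of $Z$ is a map $\delta\mapsto Z_\delta\in\Omega$ of class $C^k$ (for a fixed $k\ge1$) on a cube $(-\delta_0,\delta_0)^m$, with $Z_0=Z$. Two families with the same number of parameters are *locally weak equivalent* if there is a homeomorphism $\mu$ between neighbourhoods of the parameter $0$, $\mu(0)=0$, such that for each $\delta$ near $0$ the fields $Z_\delta$ and $\tilde Z_{\mu(\delta)}$ are locally $\Sigma$-equivalent. An unfolding $Z_\delta$ of $Z$ is *versal* if for every unfolding $W_\beta$ of $Z$ (any number of parameters) there is a continuous map $\mu$ near $0$, $\mu(0)=0$, such that $W_\beta$ and $Z_{\mu(\beta)}$ are locally $\Sigma$-equivalent for all $\beta$ near $0$. The origin is a *regular-fold* of $Z$ if one of the two fields, say $V$, satisfies $V_i(\mathbf 0)=0$ and $V_j(\mathbf 0)\,\partial_{x_j}V_i(\mathbf 0)\ne0$ for some $i\neq j$, and both components of the other field are nonzero at $\mathbf 0$. **Proposition.** Let $Z=(X,Y)\in\Omega$ have a regular-fold at the origin and let $Z_\delta$ be a one-parameter unfolding of $Z$ that is versal, or that is transverse at $Z$ to the set of fields with a regular-fold at the origin (its velocity at $\delta=0$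 is not tangent to this set). 1. If the fold is one of $X$ in $\Sigma_2$ (so $X_2(\mathbf 0)=0$) with $X_1(\mathbf 0)>0$ and $\partial_{x_1}X_2(\mathbf 0)>0$, then $Z_\delta$ is locally weak equivalent to the one-parameter family $$\tilde Z_\alpha=\begin{cases}\tilde X_\alpha(x_1,x_2)=(1,\;x_1-\alpha), & x_1x_2>0,\\ \tilde Y(x_1,x_2)=(a,\;b), & x_1x_2<0,\end{cases}\qquad a=\operatorname{sgn}Y_1(\mathbf 0),\quad b=\operatorname{sgn}Y_2(\mathbf 0).$$ 2. In every other case there are a rotation or reflection $A$ of the plane with $A(\Sigma)=\Sigma$ and a choice of keeping or reversing time such that the field obtained from $Z$ by this symmetry is as in 1, and $Z_\delta$ is locally weak equivalent to the image under the inverse symmetry of the family $\tilde Z_\alpha$ that belongs to the transformed field. (If $A$ interchanges the regions $x_1x_2>0$ and $x_1x_2<0$, the two fields change roles.) -/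

import Mathlib

open Set Filter Topology TopologicalSpace

noncomputable section

/-- The plane, with coordinates `p 0 = x₁` and `p 1 = x₂`. -/
abbrev Plane : Type := EuclideanSpace ℝ (Fin 2)

/-- A pair `Z = (X, Y)`: the field `X` is used on `x₁ x₂ > 0` and `Y` on `x₁ x₂ < 0`. -/
structure PiecewiseField where
  X : Plane → Plane
  Y : Plane → Plane

namespace PiecewiseField

/-- The region `x₁ x₂ > 0`. -/
def regionPos : Set Plane := {p | 0 < p 0 * p 1}

/-- The region `x₁ x₂ < 0`. -/
def regionNeg : Set Plane := {p | p 0 * p 1 < 0}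

/-- The switching set `Σ = {x₁ x₂ = 0}`. -/
def switching : Set Plane := {p | p 0 * p 1 = 0}

/-- The line `Σ_i = {x_i = 0}`, whose coordinate is the other one, `p (i + 1)`. -/
def axis (i : Fin 2) : Set Plane := {p | p i = 0}

/-- The crossing region `Σ_i^c`. -/
def crossing (Z : PiecewiseField) (i : Fin 2) : Set Plane :=
  {p | p ∈ axis i ∧ 0 < Z.X p i * Z.Y p i}

/-- The sliding region `Σ_i^s`. -/
def sliding (Z : PiecewiseField) (i : Fin 2) : Set Plane :=
  {p | p ∈ axis i ∧ ((0 < p (i + 1) ∧ Z.X p i < 0 ∧ 0 < Z.Y p i) ∨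
    (p (i + 1) < 0 ∧ 0 < Z.X p i ∧ Z.Y p i < 0))}

/-- The escaping region `Σ_i^e`. -/
def escaping (Z : PiecewiseField) (i : Fin 2) : Set Plane :=
  {p | p ∈ axis i ∧ ((0 < p (i + 1) ∧ 0 < Z.X p i ∧ Z.Y p i < 0) ∨
    (p (i + 1) < 0 ∧ Z.X p i < 0 ∧ 0 < Z.Y p i))}

/-- The union of the sliding and escaping regions in `Σ_i`. -/
def slidEsc (Z : PiecewiseField) (i : Fin 2) : Set Plane := Z.sliding i ∪ Z.escaping i

/-- The sliding vector field on `Σ_i`, as a vector of the plane: its `i`-th component is `0` and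
its other component is `(Y_i X_j - X_i Y_j) / (Y_i - X_i)`. -/
def slidingField (Z : PiecewiseField) (i : Fin 2) (p : Plane) : Plane :=
  (Z.Y p i - Z.X p i)⁻¹ • (Z.Y p i • Z.X p - Z.X p i • Z.Y p)

/-! ### Trajectories

A trajectory arc is a continuous curve `c` on an interval `I` which obeys at every time `t ∈ I`
the law that belongs to the point `c t`. Arcs may be restricted to subintervals. -/

/-- The law at points of the open regions and of the crossing, sliding and escaping regions.
Motion through a sliding or escaping point is along the sliding field only, so that arcs of `X` and
of `Y` do not contain such points; at a crossing point the arcs of the two sides are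
concatenated. -/
def OrdinaryLaw (Z : PiecewiseField) (I : Set ℝ) (c : ℝ → Plane) (t : ℝ) : Prop :=
  c t ≠ 0 ∧
    ((c t ∈ regionPos ∧ HasDerivWithinAt c (Z.X (c t)) I t) ∨
     (c t ∈ regionNeg ∧ HasDerivWithinAt c (Z.Y (c t)) I t) ∨
     (∃ i, c t ∈ Z.slidEsc i ∧ (∀ᶠ s in 𝓝[I] t, c s ∈ axis i) ∧
        HasDerivWithinAt c (Z.slidingField i (c t)) I t) ∨
     (∃ i, c t ∈ Z.crossing i ∧ ∀ᶠ s in 𝓝[I \ {t}] t, c s ∉ switching))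

/-- `ψ`, on `(-ε, ε)`, is the common limit of the trajectories through points `q` of `Σ` as `q`
tends to `p` from both sides. A tangency point `p ≠ 0` with such a limit is regular. -/
def IsLimitTrajectory (Z : PiecewiseField) (p : Plane) (ε : ℝ) (ψ : ℝ → Plane) : Prop :=
  0 < ε ∧ ∃ φ : Plane → ℝ → Plane,
    (∀ᶠ q in 𝓝[switching \ {p}] p, φ q 0 = q ∧ ContinuousOn (φ q) (Ioo (-ε) ε) ∧
      ∀ t ∈ Ioo (-ε) ε, φ q t ≠ p → Z.OrdinaryLaw (Ioo (-ε) ε) (φ q) t) ∧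
    ∀ t ∈ Ioo (-ε) ε, Tendsto (fun q => φ q t) (𝓝[switching \ {p}] p) (𝓝 (ψ t))

/-- The law at the points of `Σ \ {0}` where `X_i Y_i = 0`: through a regular tangency point passes
the limit trajectory, every other one is a trajectory by itself. -/
def TangencyLaw (Z : PiecewiseField) (I : Set ℝ) (c : ℝ → Plane) (t : ℝ) : Prop :=
  c t ≠ 0 ∧ (∃ i, c t ∈ axis i ∧ Z.X (c t) i * Z.Y (c t) i = 0) ∧
    ((∃ ε ψ, Z.IsLimitTrajectory (c t) ε ψ ∧ ∀ᶠ s in 𝓝[I] t, c s = ψ (s - t)) ∨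
     ((¬ ∃ ε ψ, Z.IsLimitTrajectory (c t) ε ψ) ∧ ∀ s ∈ I, c s = c t))

/-- Near the origin, `Σ` is the closure of its crossing region. -/
def AllCrossing (Z : PiecewiseField) : Prop :=
  ∀ᶠ p in 𝓝 (0 : Plane), p ∈ switching → p ∈ closure (Z.crossing 0 ∪ Z.crossing 1)

/-- The origin is a limit of sliding or escaping points of `Σ_i` and of crossing points of the other
line, is not a limit of sliding or escaping points of the other line, and the sliding field of `Σ_i`
is defined there. -/
def SlidesThroughOrigin (Z : PiecewiseField) (i : Fin 2) : Prop :=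
  0 ∈ closure (Z.slidEsc i) ∧ 0 ∉ closure (Z.slidEsc (i + 1)) ∧
    0 ∈ closure (Z.crossing (i + 1)) ∧ Z.X 0 i ≠ Z.Y 0 i

/-- The law at the origin: it moves along the orbit of `X` or of `Y` through it if
`Σ` is crossing, along the sliding field if exactly one of the lines is sliding or escaping there,
and is a trajectory by itself otherwise (in particular if it is a limit of sliding or escaping points
of both lines). -/
def OriginLaw (Z : PiecewiseField) (I : Set ℝ) (c : ℝ → Plane) (t : ℝ) : Prop :=
  c t = 0 ∧
    ((Z.AllCrossing ∧
        ((∀ᶠ s in 𝓝[I] t, c s ∈ insert 0 regionPos ∧ HasDerivWithinAt c (Z.X (c s)) I s) ∨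
         (∀ᶠ s in 𝓝[I] t, c s ∈ insert 0 regionNeg ∧ HasDerivWithinAt c (Z.Y (c s)) I s))) ∨
     (¬ Z.AllCrossing ∧ ∃ i, Z.SlidesThroughOrigin i ∧
        (∀ᶠ s in 𝓝[I] t, c s ∈ insert 0 (Z.slidEsc i)) ∧
        HasDerivWithinAt c (Z.slidingField i 0) I t) ∨
     (¬ Z.AllCrossing ∧ (∀ i, ¬ Z.SlidesThroughOrigin i) ∧ ∀ s ∈ I, c s = 0))

/-- `c` restricted to the interval `I` is an arc of a trajectory of `Z`. -/
def IsTrajectory (Z : PiecewiseField) (I : Set ℝ) (c : ℝ → Plane) : Prop :=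
  I.OrdConnected ∧ ContinuousOn c I ∧
    ∀ t ∈ I, Z.OrdinaryLaw I c t ∨ Z.TangencyLaw I c t ∨ Z.OriginLaw I c t

/-! ### Equivalence -/

/-- The point with polar coordinates `(r, t)`. -/
def polar (r t : ℝ) : Plane := !₂[r * Real.cos t, r * Real.sin t]

/-- A map fixing the origin preserves the orientation of the plane there: it turns small circles
around the origin into curves of winding number `1` around the origin. -/
def PreservesOrientation (h : Plane → Plane) : Prop :=
  ∀ᶠ r in 𝓝[>] (0 : ℝ), ∃ θ : ℝ → ℝ, Continuous θ ∧
    (∀ t, θ (t + 2 * Real.pi) = θ t + 2 * Real.pi) ∧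
    ∀ t, h (polar r t) = ‖h (polar r t)‖ • polar 1 (θ t)

/-- `h` maps every trajectory of `Z` inside its source to a trajectory of `Z'`, up to an increasing
change of time. -/
def CarriesTrajectories (h : OpenPartialHomeomorph Plane Plane) (Z Z' : PiecewiseField) : Prop :=
  ∀ (I : Set ℝ) (c : ℝ → Plane), Z.IsTrajectory I c → MapsTo c I h.source →
    ∃ (J : Set ℝ) (τ : ℝ → ℝ), StrictMonoOn τ J ∧ τ '' J = I ∧
      Z'.IsTrajectory J (fun t => h (c (τ t)))

/-- Local `Σ`-equivalence at the origin. -/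
def LocallyEquivalent (Z Z' : PiecewiseField) : Prop :=
  ∃ h : OpenPartialHomeomorph Plane Plane, 0 ∈ h.source ∧ h 0 = 0 ∧ PreservesOrientation h ∧
    (∀ p ∈ h.source, h p ∈ switching ↔ p ∈ switching) ∧
    CarriesTrajectories h Z Z' ∧ CarriesTrajectories h.symm Z' Z

/-- Local weak equivalence of two families with the same number of parameters: a homeomorphic
change of parameters `μ` near `0` such that corresponding members are locally `Σ`-equivalent. -/
def WeaklyEquivalent {m : ℕ} (F G : (Fin m → ℝ) → PiecewiseField) : Prop :=
  ∃ μ : OpenPartialHomeomorph (Fin m → ℝ) (Fin m → ℝ), 0 ∈ μ.source ∧ μ 0 = 0 ∧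
    ∀ δ ∈ μ.source, LocallyEquivalent (F δ) (G (μ δ))

/-! ### Regular folds -/

/-- The partial derivative `∂V_i/∂x_j` at the origin. -/
def partialAtZero (V : Plane → Plane) (i j : Fin 2) : ℝ :=
  fderiv ℝ V 0 (EuclideanSpace.single j 1) i

/-- The origin is a fold point of `V` in `Σ_i`. -/
def IsFold (V : Plane → Plane) (i : Fin 2) : Prop :=
  V 0 i = 0 ∧ V 0 (i + 1) * partialAtZero V i (i + 1) ≠ 0

/-- The origin is a regular-fold of `Z`: a fold of one of the two fields, in one of the two lines,
while the other field is transverse to both lines. -/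
def HasRegularFold (Z : PiecewiseField) : Prop :=
  (∃ i, IsFold Z.X i ∧ ∀ l, Z.Y 0 l ≠ 0) ∨ (∃ i, IsFold Z.Y i ∧ ∀ l, Z.X 0 l ≠ 0)

/-- A regular-fold of `X` in `Σ_2` with `X_1(0) > 0` and `∂X_2/∂x_1(0) > 0`. -/
def HasStandardFold (Z : PiecewiseField) : Prop :=
  IsFold Z.X 1 ∧ (∀ l, Z.Y 0 l ≠ 0) ∧ 0 < Z.X 0 0 ∧ 0 < partialAtZero Z.X 1 0

/-- The family `X̃_α = (1, x₁ - α)`, `Ỹ = (a, b)`. -/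
def normalForm (a b α : ℝ) : PiecewiseField where
  X p := !₂[1, p 0 - α]
  Y _ := !₂[a, b]

open scoped Classical in
/-- The image of `Z` under a linear isometry `A` which preserves `Σ` (a rotation by a multiple of
`π / 2`, or a reflection in an axis or a diagonal), with reversed time if `τ = -1`. The two fields
change roles if `A` interchanges the regions `x₁ x₂ > 0` and `x₁ x₂ < 0`. -/
def transform (A : Plane ≃ₗᵢ[ℝ] Plane) (τ : ℤˣ) (Z : PiecewiseField) : PiecewiseField where
  X p := τ • A ((if A '' regionPos = regionPos then Z.X else Z.Y) (A.symm p))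
  Y p := τ • A ((if A '' regionPos = regionPos then Z.Y else Z.X) (A.symm p))

end PiecewiseField

/-! ### The Banach space of fields of class `C^r` on the closure of a bounded open set -/

/-- Fields of class `C^r` on `U` whose derivatives up to order `r` are bounded and uniformly
continuous on `U`; for bounded `U` this says that they extend continuously to the compact closure.
Values outside `U` carry no information and are set to `0`. -/
def crFieldSubmodule (r : ℕ) (U : Opens Plane) : Submodule ℝ (Plane → Plane) where
  carrier := {V | ContDiffOn ℝ r V U ∧ (∀ p ∉ U, V p = 0) ∧ ∀ k ≤ r,
    UniformContinuous (fun p : U => iteratedFDerivWithin ℝ k V U p) ∧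
      ∃ C : ℝ, ∀ p ∈ U, ‖iteratedFDerivWithin ℝ k V U p‖ ≤ C}
  zero_mem' := by
    refine ⟨contDiffOn_const, fun _ _ => rfl, fun k _ => ?_⟩
    have h0 : iteratedFDerivWithin ℝ k (0 : Plane → Plane) U = 0 := by
      exact iteratedFDerivWithin_fun_zero (𝕜 := ℝ) (E := Plane) (F := Plane)
    rw [h0]
    exact ⟨uniformContinuous_const, 0, fun p _ => by simp⟩
  add_mem' := by
    rintro V W ⟨hV, hV0, hVk⟩ ⟨hW, hW0, hWk⟩
    refine ⟨hV.add hW, fun p hp => by simp [hV0 p hp, hW0 p hp], fun k hk => ?_⟩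
    have h1 : ∀ p ∈ U, iteratedFDerivWithin ℝ k (V + W) U p =
        iteratedFDerivWithin ℝ k V U p + iteratedFDerivWithin ℝ k W U p := fun p hp =>
      iteratedFDerivWithin_add_apply ((hV p hp).of_le (by exact_mod_cast hk))
        ((hW p hp).of_le (by exact_mod_cast hk)) U.isOpen.uniqueDiffOn hp
    obtain ⟨hVu, C, hC⟩ := hVk k hk
    obtain ⟨hWu, D, hD⟩ := hWk k hk
    refine ⟨by simpa only [funext fun p : U => h1 p p.2] using hVu.add hWu, C + D, fun p hp => ?_⟩
    rw [h1 p hp]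
    exact (norm_add_le _ _).trans (add_le_add (hC p hp) (hD p hp))
  smul_mem' := by
    rintro a V ⟨hV, hV0, hVk⟩
    refine ⟨contDiffOn_const.smul hV, fun p hp => by simp [hV0 p hp], fun k hk => ?_⟩
    have h1 : ∀ p ∈ U, iteratedFDerivWithin ℝ k (a • V) U p =
        a • iteratedFDerivWithin ℝ k V U p := fun p hp =>
      iteratedFDerivWithin_const_smul_apply ((hV p hp).of_le (by exact_mod_cast hk))
        U.isOpen.uniqueDiffOn hp
    obtain ⟨hVu, C, hC⟩ := hVk k hk
    refine ⟨by
      simp only [funext fun p : U => h1 p p.2]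
      exact hVu.const_smul a, ‖a‖ * C, fun p hp => ?_⟩
    rw [h1 p hp, norm_smul]
    exact mul_le_mul_of_nonneg_left (hC p hp) (norm_nonneg a)

/-- The space of `C^r` fields on (the closure of) `U`. -/
def CrField (r : ℕ) (U : Opens Plane) : Type := crFieldSubmodule r U

namespace CrField

variable {r : ℕ} {U : Opens Plane}

instance : AddCommGroup (CrField r U) := inferInstanceAs (AddCommGroup (crFieldSubmodule r U))

instance : Module ℝ (CrField r U) := inferInstanceAs (Module ℝ (crFieldSubmodule r U))

/-- The underlying field. -/
def toFun (V : CrField r U) : Plane → Plane := V.1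

set_option synthInstance.maxHeartbeats 400000 in
/-- All derivatives of order at most `r`, as bounded continuous functions on `U`. -/
def jet : CrField r U →ₗ[ℝ]
    ((k : Fin (r + 1)) → BoundedContinuousFunction U (Plane [×(k : ℕ)]→L[ℝ] Plane)) where
  toFun V k := BoundedContinuousFunction.ofNormedAddCommGroup
    (fun p : U => iteratedFDerivWithin ℝ k V.toFun U p)
    (V.2.2.2 k (Nat.lt_succ_iff.1 k.2)).1.continuous
    (V.2.2.2 k (Nat.lt_succ_iff.1 k.2)).2.choose
    (fun p => (V.2.2.2 k (Nat.lt_succ_iff.1 k.2)).2.choose_spec p p.2)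
  map_add' V W := by
    funext k
    ext1 p
    have hk : (k : ℕ) ≤ r := Nat.lt_succ_iff.1 k.2
    exact iteratedFDerivWithin_add_apply ((V.2.1 p p.2).of_le (by exact_mod_cast hk))
      ((W.2.1 p p.2).of_le (by exact_mod_cast hk)) U.isOpen.uniqueDiffOn p.2
  map_smul' a V := by
    funext k
    ext1 p
    have hk : (k : ℕ) ≤ r := Nat.lt_succ_iff.1 k.2
    exact iteratedFDerivWithin_const_smul_apply ((V.2.1 p p.2).of_le (by exact_mod_cast hk))
      U.isOpen.uniqueDiffOn p.2

set_option synthInstance.maxHeartbeats 400000 in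
theorem jet_injective : Function.Injective (jet (r := r) (U := U)) := by
  intro V W h
  apply Subtype.ext
  funext p
  by_cases hp : p ∈ U
  · have h1 := congrArg (fun J => J 0 ⟨p, hp⟩ 0) h
    change iteratedFDerivWithin ℝ 0 V.toFun U p 0 = iteratedFDerivWithin ℝ 0 W.toFun U p 0 at h1
    simp only [iteratedFDerivWithin_zero_apply] at h1
    exact h1
  · rw [V.2.2.1 p hp, W.2.2.1 p hp]

set_option synthInstance.maxHeartbeats 400000 in
/-- The `C^r` norm: the largest supremum over `U` of the norm of a derivative of order at most
`r`. -/
instance : NormedAddCommGroup (CrField r U) :=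
  NormedAddCommGroup.induced _ _ jet jet_injective

set_option synthInstance.maxHeartbeats 400000 in
instance : NormedSpace ℝ (CrField r U) := NormedSpace.induced ℝ _ _ jet

end CrField

/-- The space `Ω` of piecewise smooth fields on `U`, with the `C^r` topology. -/
abbrev Omega (r : ℕ) (U : Opens Plane) : Type := CrField r U × CrField r U

namespace Omega

variable {r : ℕ} {U : Opens Plane}

/-- The pair of fields given by an element of `Ω`. -/
def toField (Z : Omega r U) : PiecewiseField := ⟨Z.1.toFun, Z.2.toFun⟩

/-- `γ` is an `m`-parameter unfolding of `Z`, of class `C^k` as a map into the space `Ω`. -/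
def IsUnfolding {m : ℕ} (k : WithTop ℕ∞) (Z : Omega r U) (γ : (Fin m → ℝ) → Omega r U) : Prop :=
  γ 0 = Z ∧ ∃ δ₀ > 0, ContDiffOn ℝ k γ {δ | ∀ i, |δ i| < δ₀}

/-- `γ` is a versal unfolding of `Z`: every unfolding of `Z`, with any number of parameters, is
near the parameter `0` locally `Σ`-equivalent, member by member, to the one induced from `γ` by a
continuous change of parameters. -/
def IsVersal {m : ℕ} (k : WithTop ℕ∞) (Z : Omega r U) (γ : (Fin m → ℝ) → Omega r U) : Prop :=
  IsUnfolding k Z γ ∧ ∀ (n : ℕ) (β : (Fin n → ℝ) → Omega r U), 1 ≤ n → IsUnfolding k Z β →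
    ∃ (N : Set (Fin n → ℝ)) (μ : (Fin n → ℝ) → (Fin m → ℝ)), N ∈ 𝓝 0 ∧ ContinuousOn μ N ∧
      μ 0 = 0 ∧ ∀ α ∈ N, (β α).toField.LocallyEquivalent (γ (μ α)).toField

/-- `γ` is transverse, at the parameter `0`, to the set of fields with a regular-fold at the origin
(a submanifold of codimension one): some velocity of `γ` is not tangent to that set. -/
def IsTransverseToFolds {m : ℕ} (γ : (Fin m → ℝ) → Omega r U) : Prop :=
  ∃ v, fderiv ℝ γ 0 v ∉ tangentConeAt ℝ {Z' : Omega r U | Z'.toField.HasRegularFold} (γ 0)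

end Omega

end

/-!
Near a standard fold, `X` points to the right and is less steep than `Y`, and both components of `Y`
have constant signs. What can still vary under a small perturbation is the sign of `X₂` on the two
halves of `Σ₂`: since `X₂` increases along `Σ₂`, these two signs depend on the sign of `X₂(0)` only.
The proof shows that they and the signs of `Y` determine the local `Σ`-equivalence class and that,
for given signs of `Y`, they are determined by it. An unfolding is then governed by the scalar function `δ ↦ X₂(0)`.

*Fields of the same type are equivalent.* By truncation, a field agrees near the origin with a field
on the whole plane with uniform bounds (`Tame`, `PiecewiseField.tameAt_of_signs`). As `X` and `Y`
are never vertical, their orbits are graphs over the first coordinate, and the height at which an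
orbit meets the vertical axis is a first integral of each field. A homeomorphism of the form
`(x, y) ↦ (σ x, ·)` that maps orbits to orbits in each quadrant amounts to monotone changes of `x₁` and of
the four heights that are compatible along the axes. These conditions can be solved one after the
other, except when they close up to a cycle around the origin; then the return map is expanding,
because `Y` is steeper than `X`, and any two expanding homeomorphisms of a half-line are conjugate
(`SlopeField.exists_halfLine_matching`, `HalfLine.exists_conjugacy`).

To compare trajectories, the laws of motion are stated without reference to speed (`AdmissibleAt`).
Trajectories are admissible, the homeomorphism maps admissible curves to admissible curves, and an
admissible curve becomes a trajectory after a change of time (`Tame.exists_isTrajectory`): the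
linear function `k x₁ + b x₂` increases along all of them and serves as a first time, from which the
true time is obtained by integration. As every quadrant is mapped to itself, the orientation is
preserved.

*Fields of different types are not equivalent.* The types are told apart by the existence, near the
origin, of trajectories that stay on `Σ`, that cross `Σ`, or that move through the origin
(`TameAt.signs_eq`).

*Unfoldings.* Every regular-fold becomes standard under a symmetry of `Σ`, and symmetries map
trajectories to trajectories (`HasRegularFold.exists_transform`, `IsSignedPerm.isTrajectory`). The
value `X₂(0)` of the transformed field is a continuous linear functional on `Ω`, the `foldValue`.
Along a transverse unfolding it has a nonzero derivative, for otherwise a segment that starts at `Z`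
in the direction of the velocity would consist of regular-folds. A versal unfolding must induce, up
to equivalence, the unfolding of `Z` by a constant field, in which `foldValue` is the parameter; by
the intermediate value theorem `foldValue` changes its sign along it (`ChangesSign.of_comp`). In
both cases the parameters of the unfolding and of the normal form correspond by `α = δ` or `α = -δ`.
-/

open scoped NNReal

/-! ### Scalar equations and the height of an orbit over the vertical axis -/

/-- A bounded continuous slope `F x y`, Lipschitz in `y`: the equation `y' = F x y` then has unique
global solutions. -/
structure SlopeField (F : ℝ → ℝ → ℝ) : Prop where
  cont : Continuous fun p : ℝ × ℝ => F p.1 p.2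
  lip : ∃ K : NNReal, ∀ x, LipschitzWith K (F x)
  bdd : ∃ M : NNReal, ∀ x y, ‖F x y‖ ≤ M

namespace SlopeField

/-- `y` is a global solution of `y' = F x y`. -/
def IsSol (F : ℝ → ℝ → ℝ) (y : ℝ → ℝ) : Prop := ∀ x, HasDerivAt y (F x (y x)) x

variable {F : ℝ → ℝ → ℝ}

theorem IsSol.eq (hF : SlopeField F) {y z : ℝ → ℝ} (hy : IsSol F y) (hz : IsSol F z) {x₀ : ℝ}
    (h : y x₀ = z x₀) : y = z := by
  obtain ⟨K, hK⟩ := hF.lip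
  exact ODE_solution_unique_univ (v := F) (s := fun _ => univ) (K := K)
    (fun t => (hK t).lipschitzOnWith) (fun t => ⟨hy t, trivial⟩) (fun t => ⟨hz t, trivial⟩) h

theorem exists_isSol (hF : SlopeField F) (x₀ y₀ : ℝ) : ∃ y, IsSol F y ∧ y x₀ = y₀ := by
  obtain ⟨K, hK⟩ := hF.lip
  obtain ⟨M, hM⟩ := hF.bdd
  have hloc : ∀ n : ℕ, ∃ α : ℝ → ℝ, α x₀ = y₀ ∧
      ∀ t ∈ Ioo (x₀ - (n + 1)) (x₀ + (n + 1)), HasDerivAt α (F t (α t)) t := by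
    intro n
    have hn : (0 : ℝ) ≤ n := n.cast_nonneg
    have hmem : x₀ ∈ Icc (x₀ - (n + 1)) (x₀ + (n + 1)) := ⟨by linarith, by linarith⟩
    have hpl : IsPicardLindelof F (tmin := x₀ - (n + 1)) (tmax := x₀ + (n + 1)) ⟨x₀, hmem⟩ y₀
        (M * (n + 1)) 0 M K :=
      { lipschitzOnWith := fun t _ => (hK t).lipschitzOnWith
        continuousOn := fun y _ => (hF.cont.comp (by fun_prop : Continuous fun t : ℝ => (t, y))).continuousOn
        norm_le := fun t _ y _ => hM t y
        mul_max_le := by simp }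
    obtain ⟨α, h1, h2⟩ := hpl.exists_eq_forall_mem_Icc_hasDerivWithinAt₀
    exact ⟨α, h1, fun t ht => (h2 t (Ioo_subset_Icc_self ht)).hasDerivAt (Icc_mem_nhds ht.1 ht.2)⟩
  choose α hα0 hα using hloc
  have huniq : ∀ n m : ℕ, n ≤ m → EqOn (α n) (α m) (Ioo (x₀ - (n + 1)) (x₀ + (n + 1))) := by
    intro n m hnm
    have hn : (0 : ℝ) ≤ n := n.cast_nonneg
    have hnm' : (n : ℝ) ≤ m := by exact_mod_cast hnm
    refine ODE_solution_unique_of_mem_Ioo (v := F) (s := fun _ => univ) (K := K) (t₀ := x₀)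
      (fun t _ => (hK t).lipschitzOnWith) ⟨by linarith, by linarith⟩
      (fun t ht => ⟨hα n t ht, trivial⟩) (fun t ht => ⟨hα m t ⟨?_, ?_⟩, trivial⟩) ?_
    · linarith [ht.1]
    · linarith [ht.2]
    · rw [hα0, hα0]
  have hmem : ∀ x : ℝ, ∀ n : ℕ, |x - x₀| < n + 1 → x ∈ Ioo (x₀ - (n + 1)) (x₀ + (n + 1)) := by
    intro x n h
    rw [abs_lt] at h
    exact ⟨by linarith [h.1], by linarith [h.2]⟩
  refine ⟨fun x => α ⌈|x - x₀|⌉₊ x, fun x => ?_, by simp [hα0]⟩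
  -- near `x`, all the local solutions agree with the one on a slightly larger interval
  set N := ⌈|x - x₀|⌉₊ + 1
  have hxN : |x - x₀| < (N : ℝ) := by
    have := Nat.le_ceil |x - x₀|
    push_cast [N]; linarith
  have hev : ∀ᶠ z in 𝓝 x, α ⌈|z - x₀|⌉₊ z = α N z := by
    have : ∀ᶠ z in 𝓝 x, |z - x₀| < (N : ℝ) :=
      (by fun_prop : Continuous fun z : ℝ => |z - x₀|).continuousAt.eventually_lt
        continuousAt_const hxN
    filter_upwards [this] with z hz
    refine huniq _ _ (Nat.ceil_le.2 hz.le) (hmem z _ ?_)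
    linarith [Nat.le_ceil |z - x₀|]
  have hd := hα N x (hmem x N (by linarith))
  have := hd.congr_of_eventuallyEq hev
  rwa [← hev.self_of_nhds] at this

variable (F) in
/-- The solution of `y' = F x y` through `(x₀, y₀)`. -/
noncomputable def sol (x₀ y₀ : ℝ) : ℝ → ℝ := Classical.epsilon fun y => IsSol F y ∧ y x₀ = y₀

variable (F) in
/-- The height over `x = 0` of the solution through `(x, y)`. -/
noncomputable def height (x y : ℝ) : ℝ := sol F x y 0

variable (F) in
/-- The value at `x` of the solution of height `c`. -/
noncomputable def flow (x c : ℝ) : ℝ := sol F 0 c x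

theorem isSol_sol (hF : SlopeField F) (x₀ y₀ : ℝ) : IsSol F (sol F x₀ y₀) :=
  (Classical.epsilon_spec (hF.exists_isSol x₀ y₀)).1

theorem sol_self (hF : SlopeField F) (x₀ y₀ : ℝ) : sol F x₀ y₀ x₀ = y₀ :=
  (Classical.epsilon_spec (hF.exists_isSol x₀ y₀)).2

theorem IsSol.height_eq (hF : SlopeField F) {y : ℝ → ℝ} (hy : IsSol F y) (x : ℝ) :
    height F x (y x) = y 0 := by
  rw [height, (hF.isSol_sol x (y x)).eq hF hy (hF.sol_self x (y x))]

theorem IsSol.flow_eq (hF : SlopeField F) {y : ℝ → ℝ} (hy : IsSol F y) (x : ℝ) :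
    flow F x (y 0) = y x := by
  rw [flow, (hF.isSol_sol 0 (y 0)).eq hF hy (hF.sol_self 0 (y 0))]

theorem isSol_flow (hF : SlopeField F) (c : ℝ) : IsSol F (fun x => flow F x c) :=
  hF.isSol_sol 0 c

@[simp] theorem flow_zero (hF : SlopeField F) (c : ℝ) : flow F 0 c = c := hF.sol_self 0 c

@[simp] theorem height_zero (hF : SlopeField F) (y : ℝ) : height F 0 y = y := hF.sol_self 0 y

@[simp] theorem height_flow (hF : SlopeField F) (x c : ℝ) : height F x (flow F x c) = c := by
  have := (hF.isSol_flow c).height_eq hF x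
  rwa [hF.flow_zero] at this

@[simp] theorem flow_height (hF : SlopeField F) (x y : ℝ) : flow F x (height F x y) = y := by
  have := (hF.isSol_sol x y).flow_eq hF x
  rwa [hF.sol_self] at this

theorem hasDerivAt_flow (hF : SlopeField F) (x c : ℝ) :
    HasDerivAt (fun x => flow F x c) (F x (flow F x c)) x := hF.isSol_flow c x

theorem continuous_flow_left (hF : SlopeField F) (c : ℝ) : Continuous fun x => flow F x c :=
  continuous_iff_continuousAt.2 fun x => (hF.hasDerivAt_flow x c).continuousAt

theorem strictMono_flow (hF : SlopeField F) (x : ℝ) : StrictMono (flow F x) := by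
  intro c d hcd
  by_contra! h
  have hcont : Continuous fun x => flow F x d - flow F x c :=
    (hF.continuous_flow_left d).sub (hF.continuous_flow_left c)
  -- by the intermediate value theorem the two solutions meet
  have h0 : (0 : ℝ) ∈ uIcc (flow F x d - flow F x c) (flow F 0 d - flow F 0 c) := by
    rw [hF.flow_zero, hF.flow_zero, mem_uIcc]
    left; constructor <;> linarith
  obtain ⟨z, -, hz⟩ := intermediate_value_uIcc hcont.continuousOn h0
  have := congrFun ((hF.isSol_flow d).eq hF (hF.isSol_flow c) (x₀ := z) (by simpa [sub_eq_zero] using hz)) 0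
  simp only [hF.flow_zero] at this
  exact hcd.ne' this

theorem flow_lt_iff (hF : SlopeField F) {x y c : ℝ} : y < flow F x c ↔ height F x y < c := by
  conv_lhs => rw [← hF.flow_height x y]
  exact (hF.strictMono_flow x).lt_iff_lt

theorem lt_flow_iff (hF : SlopeField F) {x y c : ℝ} : flow F x c < y ↔ c < height F x y := by
  conv_lhs => rw [← hF.flow_height x y]
  exact (hF.strictMono_flow x).lt_iff_lt

theorem strictMono_height (hF : SlopeField F) (x : ℝ) : StrictMono (height F x) := by
  intro y z h
  rwa [← hF.flow_lt_iff, hF.flow_height]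

/-- Continuity comes from monotonicity in the fibres: the sets `height < c` and `height > c` are
bounded by the graph of a solution. -/
theorem continuous_height (hF : SlopeField F) :
    Continuous fun p : ℝ × ℝ => height F p.1 p.2 := by
  rw [continuous_iff_continuousAt]
  intro p
  rw [ContinuousAt, tendsto_order]
  constructor
  · intro c hc
    have ho : IsOpen {q : ℝ × ℝ | flow F q.1 c < q.2} :=
      isOpen_lt ((hF.continuous_flow_left c).comp continuous_fst) continuous_snd
    filter_upwards [ho.mem_nhds (hF.lt_flow_iff.2 hc : p ∈ _)] with q hq using hF.lt_flow_iff.1 hq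
  · intro c hc
    have ho : IsOpen {q : ℝ × ℝ | q.2 < flow F q.1 c} :=
      isOpen_lt continuous_snd ((hF.continuous_flow_left c).comp continuous_fst)
    filter_upwards [ho.mem_nhds (hF.flow_lt_iff.2 hc : p ∈ _)] with q hq using hF.flow_lt_iff.1 hq

theorem continuous_flow (hF : SlopeField F) :
    Continuous fun p : ℝ × ℝ => flow F p.1 p.2 := by
  have hc : ∀ y, Continuous fun x => height F x y := fun y =>
    hF.continuous_height.comp (by fun_prop : Continuous fun x : ℝ => (x, y))
  rw [continuous_iff_continuousAt]
  intro p
  rw [ContinuousAt, tendsto_order]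
  constructor
  · intro y hy
    have ho : IsOpen {q : ℝ × ℝ | height F q.1 y < q.2} :=
      isOpen_lt ((hc y).comp continuous_fst) continuous_snd
    filter_upwards [ho.mem_nhds (hF.flow_lt_iff.1 hy : p ∈ _)] with q hq using hF.flow_lt_iff.2 hq
  · intro y hy
    have ho : IsOpen {q : ℝ × ℝ | q.2 < height F q.1 y} :=
      isOpen_lt continuous_snd ((hc y).comp continuous_fst)
    filter_upwards [ho.mem_nhds (hF.lt_flow_iff.1 hy : p ∈ _)] with q hq using hF.lt_flow_iff.2 hq

/-- The slope field seen in the mirror `x ↦ -x`. -/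
theorem reflect (hF : SlopeField F) : SlopeField fun x y => -F (-x) y := by
  refine ⟨(hF.cont.comp (by fun_prop : Continuous fun p : ℝ × ℝ => (-p.1, p.2))).neg, ?_, ?_⟩
  · obtain ⟨K, hK⟩ := hF.lip
    exact ⟨K, fun x => (hK (-x)).neg⟩
  · obtain ⟨M, hM⟩ := hF.bdd
    exact ⟨M, fun x y => by rw [norm_neg]; exact hM _ _⟩

theorem height_reflect (hF : SlopeField F) (x y : ℝ) :
    height (fun x y => -F (-x) y) x y = height F (-x) y := by
  have h : IsSol (fun x y => -F (-x) y) (fun t => sol F (-x) y (-t)) := by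
    intro t
    simpa [Function.comp_def] using (hF.isSol_sol (-x) y (-t)).scomp t (hasDerivAt_neg t)
  have := h.height_eq hF.reflect x
  simp only [hF.sol_self, neg_zero] at this
  exact this

end SlopeField

/-! ### The height function on the horizontal half-axes -/

/-- On the right half-plane the slope field has the sign `s` along the horizontal axis and
far away from the vertical axis. -/
structure RightSigned (F : ℝ → ℝ → ℝ) (s : ℝ) : Prop extends SlopeField F where
  sq : s * s = 1
  pos : ∀ x, 0 < x → 0 < s * F x 0
  far : ∃ ε > 0, ∃ m > 0, ∀ x y, ε ≤ x → m ≤ s * F x y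

namespace RightSigned

open SlopeField

variable {F : ℝ → ℝ → ℝ} {s : ℝ}

/-- A solution which vanishes at `x₂ > 0` lies before `x₂` on the side `s y < 0`, because it can
cross the axis in one direction only. -/
theorem mul_sol_neg (h : RightSigned F s) {x₁ x₂ : ℝ} (h1 : 0 < x₁) (h2 : x₁ < x₂) :
    s * sol F x₂ 0 x₁ < 0 := by
  by_contra! hneg
  have hF := h.toSlopeField
  set y := sol F x₂ 0 with hy
  have hyd : ∀ x, HasDerivAt (fun x => s * y x) (s * F x (y x)) x := fun x =>
    (hF.isSol_sol x₂ 0 x).const_mul s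
  have hs0 : s ≠ 0 := by rintro rfl; simpa using h.sq
  have hnn : ∀ x ∈ Icc x₁ x₂, 0 ≤ s * y x := by
    have := image_le_of_deriv_right_lt_deriv_boundary (f := fun x => -(s * y x))
      (f' := fun x => -(s * F x (y x))) (a := x₁) (b := x₂) (B := fun _ => 0) (B' := fun _ => 0)
      (fun x _ => (hyd x).neg.continuousAt.continuousWithinAt)
      (fun x _ => (hyd x).neg.hasDerivWithinAt) (by simpa using hneg)
      (fun x => hasDerivAt_const x _) (fun x hx h0 => by
        have : y x = 0 := by simpa [hs0] using h0
        rw [this]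
        linarith [h.pos x (by linarith [hx.1])])
    intro x hx
    simpa using this hx
  have hy2 : y x₂ = 0 := hF.sol_self _ _
  have hd : HasDerivAt (fun x => s * y x) (s * F x₂ 0) x₂ := by simpa [hy2] using hyd x₂
  have hlt : ∀ᶠ x in 𝓝[<] x₂, s * y x < 0 := by
    have hsl := (hasDerivAt_iff_tendsto_slope_left_right.1 hd).1
    filter_upwards [hsl.eventually (lt_mem_nhds (h.pos x₂ (by linarith))), self_mem_nhdsWithin]
      with x hx hx2
    rw [slope_def_field, hy2, mul_zero, sub_zero] at hx
    by_contra! hc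
    exact absurd hx (not_lt.2 (div_nonpos_of_nonneg_of_nonpos hc (by linarith [mem_Iio.1 hx2])))
  have hmem : ∀ᶠ x in 𝓝[<] x₂, x ∈ Icc x₁ x₂ := by
    filter_upwards [Ioo_mem_nhdsLT h2] with x hx using ⟨hx.1.le, hx.2.le⟩
  obtain ⟨x, hx, hx'⟩ := (hlt.and hmem).exists
  exact absurd (hnn x hx') (not_le.2 hx)

theorem strictMonoOn_height (h : RightSigned F s) :
    StrictMonoOn (fun x => -s * height F x 0) (Ici 0) := by
  have hF := h.toSlopeField
  have hs : s = 1 ∨ s = -1 := by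
    have := h.sq
    rcases mul_self_eq_one_iff.1 this with h | h <;> simp [h]
  have hpos : StrictMonoOn (fun x => -s * height F x 0) (Ioi 0) := by
    intro x₁ h1 x₂ _ h12
    have hk := h.mul_sol_neg h1 h12
    have e : height F x₁ (sol F x₂ 0 x₁) = height F x₂ 0 :=
      ((hF.isSol_sol x₂ 0).height_eq hF x₁)
    simp only
    rw [← e]
    rcases hs with rfl | rfl
    · have := hF.strictMono_height x₁ (show sol F x₂ 0 x₁ < 0 by linarith)
      linarith
    · have := hF.strictMono_height x₁ (show 0 < sol F x₂ 0 x₁ by linarith)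
      linarith
  have hc : Continuous fun x => -s * height F x 0 :=
    continuous_const.mul (hF.continuous_height.comp (by fun_prop : Continuous fun x : ℝ => (x, (0:ℝ))))
  intro x hx y hy hxy
  rcases (mem_Ici.1 hx).eq_or_lt with rfl | hx0
  · refine lt_of_le_of_lt ?_ (hpos (show y / 2 ∈ Ioi 0 by simpa using hxy)
      (show y ∈ Ioi 0 from hxy) (by linarith))
    refine le_of_tendsto (hc.continuousWithinAt (s := Ioi 0) (x := 0)) ?_
    filter_upwards [Ioo_mem_nhdsGT (show (0 : ℝ) < y / 2 by linarith)] with t ht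
    exact (hpos ht.1 (show y / 2 ∈ Ioi 0 by simpa using hxy) ht.2).le
  · exact hpos hx0 (hx0.trans hxy) hxy

theorem exists_flow_eq_zero (h : RightSigned F s) {c : ℝ} (hc : 0 ≤ c) :
    ∃ x, 0 ≤ x ∧ flow F x (-s * c) = 0 := by
  have hF := h.toSlopeField
  obtain ⟨ε, hε, m, hm, hfar⟩ := h.far
  set y := fun x => s * flow F x (-s * c)
  have hyd : ∀ x, HasDerivAt y (s * F x (flow F x (-s * c))) x := fun x =>
    (hF.hasDerivAt_flow x _).const_mul s
  have hyc : Continuous y := continuous_iff_continuousAt.2 fun x => (hyd x).continuousAt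
  have hy0 : y 0 ≤ 0 := by
    simp only [y, hF.flow_zero]
    have := h.sq
    nlinarith
  -- beyond `ε` the solution grows at least at the rate `m`
  have hgrow : ∀ x, ε ≤ x → y ε + m * (x - ε) ≤ y x := by
    intro x hx
    have := (convex_Ici ε).mul_sub_le_image_sub_of_le_deriv (f := y) (C := m) hyc.continuousOn
      (fun z _ => (hyd z).differentiableAt.differentiableWithinAt)
      (fun z hz => by
        rw [(hyd z).deriv]
        exact hfar z _ (interior_subset hz)) ε (mem_Ici.2 le_rfl) x hx hx
    linarith
  have hR : 0 ≤ y (ε + |y ε| / m) := by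
    have := hgrow (ε + |y ε| / m) (by have := abs_nonneg (y ε); have : 0 ≤ |y ε| / m := by positivity
                                      linarith)
    have e : m * (ε + |y ε| / m - ε) = |y ε| := by field_simp; ring
    rw [e] at this
    linarith [neg_abs_le (y ε)]
  have hle : (0 : ℝ) ≤ ε + |y ε| / m := by positivity
  obtain ⟨x, hx, hx0⟩ := intermediate_value_Icc hle hyc.continuousOn ⟨hy0, hR⟩
  refine ⟨x, hx.1, ?_⟩
  have hs0 : s ≠ 0 := by rintro rfl; simpa using h.sq
  simpa [y, hs0] using hx0

theorem height_nonneg (h : RightSigned F s) {x : ℝ} (hx : 0 ≤ x) : 0 ≤ -s * height F x 0 := by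
  have := h.strictMonoOn_height.monotoneOn (show (0:ℝ) ∈ Ici 0 from mem_Ici.2 le_rfl) hx hx
  simpa [h.height_zero] using this

/-- The map `x ↦ |height x 0|` of the right half-axis onto a half of the vertical axis. -/
noncomputable def reach (h : RightSigned F s) : ℝ≥0 ≃o ℝ≥0 :=
  StrictMono.orderIsoOfSurjective (fun x => ⟨-s * height F x 0, h.height_nonneg x.2⟩)
    (fun x y hxy => Subtype.mk_lt_mk.2 (h.strictMonoOn_height x.2 y.2 hxy)) (by
      intro c
      obtain ⟨x, hx, hx0⟩ := h.exists_flow_eq_zero (c := (c : ℝ)) c.2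
      refine ⟨⟨x, hx⟩, Subtype.ext ?_⟩
      have := h.height_flow x (-s * (c : ℝ))
      rw [hx0] at this
      change -s * height F x 0 = c
      rw [this, ← mul_assoc, neg_mul_neg, h.sq, one_mul])

theorem coe_reach (h : RightSigned F s) (x : ℝ≥0) : (h.reach x : ℝ) = -s * height F x 0 := rfl

theorem height_eq (h : RightSigned F s) (x : ℝ≥0) : height F x 0 = -s * h.reach x := by
  rw [coe_reach, ← mul_assoc, neg_mul_neg, h.sq, one_mul]

/-- Slopes below `k` reach heights below `k x`. -/
theorem reach_lt (h : RightSigned F s) {k : ℝ} (hk : ∀ x y, |F x y| < k) {x : ℝ≥0} (hx : 0 < x) :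
    (h.reach x : ℝ) < k * x := by
  have hF := h.toSlopeField
  have hd : ∀ t, HasDerivAt (fun t => s * sol F x 0 t) (s * F t (sol F x 0 t)) t := fun t =>
    (hF.isSol_sol x 0 t).const_mul s
  have hs : |s| = 1 := by
    rcases mul_self_eq_one_iff.1 h.sq with h | h <;> simp [h]
  have := convex_univ.image_sub_lt_mul_sub_of_deriv_lt (f := fun t => s * sol F x 0 t) (C := k)
    (fun t _ => (hd t).continuousAt.continuousWithinAt)
    (fun t _ => (hd t).differentiableAt.differentiableWithinAt)
    (fun t _ => by
      rw [(hd t).deriv]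
      refine (le_abs_self _).trans_lt ?_
      rw [abs_mul, hs, one_mul]
      exact hk _ _) 0 trivial x trivial (NNReal.coe_pos.2 hx)
  simp only [hF.sol_self, sub_zero, mul_zero, zero_sub] at this
  rw [coe_reach, neg_mul]
  exact this

theorem lt_reach (h : RightSigned F s) {k : ℝ} (hk : ∀ x y, k < s * F x y) {x : ℝ≥0} (hx : 0 < x) :
    k * x < h.reach x := by
  have hF := h.toSlopeField
  have hd : ∀ t, HasDerivAt (fun t => s * sol F x 0 t) (s * F t (sol F x 0 t)) t := fun t =>
    (hF.isSol_sol x 0 t).const_mul s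
  have := convex_univ.mul_sub_lt_image_sub_of_lt_deriv (f := fun t => s * sol F x 0 t) (C := k)
    (fun t _ => (hd t).continuousAt.continuousWithinAt)
    (fun t _ => (hd t).differentiableAt.differentiableWithinAt)
    (fun t _ => by
      rw [(hd t).deriv]
      exact hk _ _) 0 trivial x trivial (NNReal.coe_pos.2 hx)
  simp only [hF.sol_self, sub_zero, mul_zero, zero_sub] at this
  rw [coe_reach, neg_mul]
  exact this

end RightSigned

/-! ### Conjugacy of expanding homeomorphisms of the half-line -/

namespace HalfLine

/-- The interpolation of the orbit of `1` under `T`: it carries the translation by `1` to `T`. -/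
noncomputable def fundamental (T : ℝ≥0 ≃o ℝ≥0) (t : ℝ) : ℝ≥0 :=
  (T ^ ⌊t⌋) (1 + (Int.fract t).toNNReal * (T 1 - 1))

variable {T : ℝ≥0 ≃o ℝ≥0}

theorem fundamental_add_one (t : ℝ) : fundamental T (t + 1) = T (fundamental T t) := by
  rw [fundamental, Int.floor_add_one, Int.fract_add_one, add_comm ⌊t⌋, zpow_add, zpow_one]
  rfl

theorem expanding_zpow_lt (hT : ∀ x, 0 < x → x < T x) {m n : ℤ} (h : m < n) :
    (T ^ m) (T 1) ≤ (T ^ n) 1 := by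
  have h1 : ∀ j : ℕ, (1 : ℝ≥0) ≤ (T ^ j) 1 := by
    intro j
    induction j with
    | zero => simp
    | succ j ih =>
      rw [pow_succ']
      exact ih.trans (hT _ (lt_of_lt_of_le one_pos ih)).le
  obtain ⟨j, hj⟩ := Int.eq_ofNat_of_zero_le (show 0 ≤ n - m - 1 by omega)
  have e : n = m + 1 + (j : ℤ) := by omega
  rw [e, zpow_add, zpow_add, zpow_one, zpow_natCast]
  exact (T ^ m).monotone (T.monotone (h1 j))

theorem strictMono_fundamental (hT : ∀ x, 0 < x → x < T x) : StrictMono (fundamental T) := by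
  have hT1 : 0 < T 1 - 1 := tsub_pos_of_lt (hT 1 one_pos)
  intro s t hst
  rcases (Int.floor_le_floor hst.le).eq_or_lt with h | h
  · rw [fundamental, fundamental, h]
    refine (T ^ ⌊t⌋).strictMono ?_
    have : (Int.fract s).toNNReal < (Int.fract t).toNNReal := by
      have hs := Int.floor_add_fract s
      have ht := Int.floor_add_fract t
      rw [h] at hs
      have hlt : Int.fract s < Int.fract t := by linarith
      exact (Real.toNNReal_lt_toNNReal_iff ((Int.fract_nonneg s).trans_lt hlt)).2 hlt
    gcongr
  · calc fundamental T s < (T ^ ⌊s⌋) (T 1) := by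
          refine (T ^ ⌊s⌋).strictMono ?_
          have : (Int.fract s).toNNReal < 1 := by
            rw [Real.toNNReal_lt_one]; exact Int.fract_lt_one s
          calc 1 + (Int.fract s).toNNReal * (T 1 - 1) < 1 + 1 * (T 1 - 1) := by gcongr
            _ = T 1 := by rw [one_mul, add_tsub_cancel_of_le (hT 1 one_pos).le]
      _ ≤ (T ^ ⌊t⌋) 1 := expanding_zpow_lt hT h
      _ ≤ fundamental T t := (T ^ ⌊t⌋).monotone le_self_add

theorem exists_zpow_le_lt (hT : ∀ x, 0 < x → x < T x) {x : ℝ≥0} (hx : 0 < x) :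
    ∃ n : ℤ, (T ^ n) 1 ≤ x ∧ x < (T ^ (n + 1)) 1 := by
  have hstep : ∀ n : ℤ, (T ^ (n + 1)) 1 = T ((T ^ n) 1) := by
    intro n
    rw [add_comm, zpow_add, zpow_one]
    rfl
  -- a bound of the orbit of `1` other than `0` would give a fixed point
  have hlow : ∃ n : ℤ, (T ^ n) 1 ≤ x := by
    by_contra! h
    have hbdd : BddBelow (range fun n : ℤ => (T ^ n) 1) := OrderBot.bddBelow _
    set L := ⨅ n : ℤ, (T ^ n) 1
    have hL : 0 < L := hx.trans_le (le_ciInf fun n => (h n).le)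
    have : T L ≤ L := le_ciInf fun n => by
      have := T.monotone (ciInf_le hbdd (n - 1))
      rwa [← hstep, sub_add_cancel] at this
    exact absurd (hT L hL) (not_lt.2 this)
  have hup : ∃ n : ℤ, x < (T ^ n) 1 := by
    by_contra! h
    have hbdd : BddAbove (range fun n : ℤ => (T ^ n) 1) := ⟨x, by rintro _ ⟨n, rfl⟩; exact h n⟩
    set L := ⨆ n : ℤ, (T ^ n) 1
    have hL : 0 < L := lt_of_lt_of_le (by simp) (le_ciSup hbdd 0)
    have : L ≤ T.symm L := ciSup_le fun n => by
      rw [T.le_symm_apply, ← hstep]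
      exact le_ciSup hbdd (n + 1)
    rw [T.le_symm_apply] at this
    exact absurd (hT L hL) (not_lt.2 this)
  obtain ⟨b, hb⟩ := hup
  obtain ⟨n, hn, hmax⟩ := Int.exists_greatest_of_bdd (P := fun n => (T ^ n) 1 ≤ x)
    ⟨b, fun z hz => by
      by_contra! hlt
      have : (T ^ b) 1 ≤ (T ^ z) 1 := by
        have h2 := (T ^ b).monotone (hT 1 one_pos).le
        exact h2.trans (expanding_zpow_lt hT hlt)
      exact absurd (hb.trans_le this) (not_lt.2 hz)⟩ hlow
  refine ⟨n, hn, ?_⟩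
  by_contra! h
  have := hmax (n + 1) h
  omega

theorem range_fundamental (hT : ∀ x, 0 < x → x < T x) : range (fundamental T) = Ioi 0 := by
  have hT1 : 0 < T 1 - 1 := tsub_pos_of_lt (hT 1 one_pos)
  have hbot : ∀ n : ℤ, (T ^ n) 0 = 0 := fun n => (T ^ n).map_bot
  apply Subset.antisymm
  · rintro _ ⟨t, rfl⟩
    rw [mem_Ioi, ← hbot ⌊t⌋]
    exact (T ^ ⌊t⌋).strictMono (by positivity)
  · intro x hx
    obtain ⟨n, h1, h2⟩ := exists_zpow_le_lt hT hx
    set y := (T ^ n).symm x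
    have hy : (T ^ n) y = x := (T ^ n).apply_symm_apply x
    have hy1 : 1 ≤ y := by rwa [← (T ^ n).le_iff_le, hy]
    have hy2 : y < T 1 := by
      rw [← (T ^ n).lt_iff_lt, hy]
      rwa [zpow_add, zpow_one] at h2
    set u : ℝ≥0 := (y - 1) / (T 1 - 1)
    have hu1 : u < 1 := by
      rw [div_lt_one hT1]
      exact tsub_lt_tsub_right_of_le hy1 hy2
    have hu : (u : ℝ) < 1 := by exact_mod_cast hu1
    refine ⟨n + u, ?_⟩
    have hfl : ⌊(n : ℝ) + u⌋ = n := by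
      rw [Int.floor_intCast_add, (Int.floor_eq_zero_iff (a := (u : ℝ))).2 ⟨u.2, hu⟩, add_zero]
    have hfr : Int.fract ((n : ℝ) + u) = u := by
      rw [Int.fract_intCast_add]; exact Int.fract_eq_self.2 ⟨u.2, hu⟩
    rw [fundamental, hfl, hfr, Real.toNNReal_coe, div_mul_cancel₀ _ hT1.ne',
      add_tsub_cancel_of_le hy1, hy]

/-- The fundamental domains `[Tⁿ 1, Tⁿ⁺¹ 1)` of two expanding homeomorphisms of the half-line are
matched one by one. -/
theorem exists_conjugacy {T T' : ℝ≥0 ≃o ℝ≥0} (hT : ∀ x, 0 < x → x < T x)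
    (hT' : ∀ x, 0 < x → x < T' x) : ∃ σ : ℝ≥0 ≃o ℝ≥0, σ * T = T' * σ := by
  classical
  have hE := strictMono_fundamental hT
  have hE' := strictMono_fundamental hT'
  have hpos : ∀ t, 0 < fundamental T t := fun t => by
    rw [← mem_Ioi, ← range_fundamental hT]; exact mem_range_self t
  have hpos' : ∀ t, 0 < fundamental T' t := fun t => by
    rw [← mem_Ioi, ← range_fundamental hT']; exact mem_range_self t
  have hex : ∀ x : ℝ≥0, 0 < x → ∃ t, fundamental T t = x := fun x hx => by
    rw [← mem_Ioi, ← range_fundamental hT] at hx; exact hx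
  have hex' : ∀ x : ℝ≥0, 0 < x → ∃ t, fundamental T' t = x := fun x hx => by
    rw [← mem_Ioi, ← range_fundamental hT'] at hx; exact hx
  choose! e he using hex
  set f : ℝ≥0 → ℝ≥0 := fun x => if x = 0 then 0 else fundamental T' (e x)
  have hf0 : f 0 = 0 := by simp [f]
  have hfE : ∀ t, f (fundamental T t) = fundamental T' t := by
    intro t
    simp only [f, (hpos t).ne', if_false]
    rw [hE.injective (he _ (hpos t))]
  have hmono : StrictMono f := by
    intro x y hxy
    have hy : 0 < y := hxy.bot_lt
    rcases eq_or_ne x 0 with rfl | hx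
    · rw [hf0, ← he y hy, hfE]; exact hpos' _
    · have hx := pos_iff_ne_zero.2 hx
      rw [← he x hx, ← he y hy, hfE, hfE]
      rw [← he x hx, ← he y hy] at hxy
      exact hE' (hE.lt_iff_lt.1 hxy)
  have hsurj : Function.Surjective f := by
    intro y
    rcases eq_or_ne y 0 with rfl | hy
    · exact ⟨0, hf0⟩
    · obtain ⟨t, rfl⟩ := hex' y (pos_iff_ne_zero.2 hy)
      exact ⟨_, hfE t⟩
  refine ⟨hmono.orderIsoOfSurjective f hsurj, ?_⟩
  refine RelIso.ext fun x => ?_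
  change f (T x) = T' (f x)
  rcases eq_or_ne x 0 with rfl | hx
  · have h0 : T 0 = 0 := T.map_bot
    have h0' : T' 0 = 0 := T'.map_bot
    rw [h0, hf0, h0']
  · rw [← he x (pos_iff_ne_zero.2 hx), hfE, ← fundamental_add_one, hfE, fundamental_add_one]

end HalfLine

/-! ### Matching the first integrals of two pairs of slope fields -/

/-- The order automorphism of the line which is `u` on the right and the mirror image of `d` on the
left. -/
noncomputable def glueHalfLines (u d : ℝ≥0 ≃o ℝ≥0) : ℝ ≃o ℝ :=
  StrictMono.orderIsoOfSurjective
    (fun y => if 0 ≤ y then (u y.toNNReal : ℝ) else -(d (-y).toNNReal : ℝ))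
    (by
      intro x y hxy
      dsimp only
      split_ifs with h1 h2 h2
      · exact_mod_cast u.strictMono
          ((Real.toNNReal_lt_toNNReal_iff (h1.trans_lt hxy)).2 hxy)
      · linarith
      · have h3 : (0 : ℝ≥0) < d (-x).toNNReal := by
          have h0 : d 0 = 0 := d.map_bot
          rw [← h0]
          exact d.strictMono (Real.toNNReal_pos.2 (by linarith))
        have h4 : (0 : ℝ) < d (-x).toNNReal := by exact_mod_cast h3
        exact lt_of_lt_of_le (by linarith) (NNReal.coe_nonneg _)
      · have := d.strictMono
          ((Real.toNNReal_lt_toNNReal_iff (show 0 < -x by linarith)).2 (neg_lt_neg hxy))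
        exact neg_lt_neg (by exact_mod_cast this))
    (by
      intro y
      rcases le_or_gt 0 y with h | h
      · refine ⟨u.symm y.toNNReal, ?_⟩
        simp [h]
      · have h0 : (0 : ℝ) < d.symm (-y).toNNReal := by
          have : (0 : ℝ≥0) < d.symm (-y).toNNReal := by
            have h0 : d.symm 0 = 0 := d.symm.map_bot
            rw [← h0]
            exact d.symm.strictMono (Real.toNNReal_pos.2 (by linarith))
          exact_mod_cast this
        refine ⟨-(d.symm (-y).toNNReal : ℝ), ?_⟩
        dsimp only
        rw [if_neg (by linarith), neg_neg, Real.toNNReal_coe, OrderIso.apply_symm_apply,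
          Real.coe_toNNReal _ (by linarith), neg_neg])

theorem glueHalfLines_apply (u d : ℝ≥0 ≃o ℝ≥0) (y : ℝ) : glueHalfLines u d y =
    if 0 ≤ y then (u y.toNNReal : ℝ) else -(d (-y).toNNReal : ℝ) := rfl

theorem glueHalfLines_coe (u d : ℝ≥0 ≃o ℝ≥0) (y : ℝ≥0) : glueHalfLines u d y = u y := by
  simp [glueHalfLines_apply]

theorem glueHalfLines_neg_coe (u d : ℝ≥0 ≃o ℝ≥0) (y : ℝ≥0) :
    glueHalfLines u d (-(y : ℝ)) = -(d y : ℝ) := by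
  rw [glueHalfLines_apply]
  split_ifs with h
  · have : y = 0 := by
      have h0 : (y : ℝ) = 0 := le_antisymm (by linarith) y.2
      exact_mod_cast h0
    subst this
    have hu : u 0 = 0 := u.map_bot
    have hd : d 0 = 0 := d.map_bot
    simp [hu, hd]
  · simp

theorem glueHalfLines_zero (u d : ℝ≥0 ≃o ℝ≥0) : glueHalfLines u d 0 = 0 := by
  have := glueHalfLines_coe u d 0
  rw [NNReal.coe_zero] at this
  rw [this, NNReal.coe_eq_zero]
  exact u.map_bot

namespace SlopeField

/-- The slopes `f` of `X` and `g` of `Y`: `f` has the sign `sL` to the left and `sR` to the right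
of the vertical axis, `g` has the sign `m`, and `k` separates the absolute values. -/
structure IsPair (f g : ℝ → ℝ → ℝ) (sL sR m k : ℝ) : Prop where
  fR : RightSigned f sR
  fL : RightSigned (fun x y => -f (-x) y) (-sL)
  gR : RightSigned g m
  gL : RightSigned (fun x y => -g (-x) y) (-m)
  abs_lt : ∀ x y, |f x y| < k
  lt_mul : ∀ x y, k < m * g x y

/-- Monotone changes `σ` of the horizontal coordinate and `κ₁, …, κ₄` of the heights in the four
closed quadrants under which the heights of `(f, g)` and of `(f', g')` correspond along the axes.
The field `f` belongs to the first and the third quadrant. -/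
structure Matching (f g f' g' : ℝ → ℝ → ℝ) where
  (σ κ₁ κ₂ κ₃ κ₄ : ℝ ≃o ℝ)
  σ_zero : σ 0 = 0
  κ_zero : κ₁ 0 = 0 ∧ κ₂ 0 = 0 ∧ κ₃ 0 = 0 ∧ κ₄ 0 = 0
  up : ∀ y, 0 ≤ y → κ₂ y = κ₁ y
  down : ∀ y, y ≤ 0 → κ₃ y = κ₄ y
  right_up : ∀ x, 0 ≤ x → height f' (σ x) 0 = κ₁ (height f x 0)
  right_down : ∀ x, 0 ≤ x → height g' (σ x) 0 = κ₄ (height g x 0)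
  left_up : ∀ x, x ≤ 0 → height g' (σ x) 0 = κ₂ (height g x 0)
  left_down : ∀ x, x ≤ 0 → height f' (σ x) 0 = κ₃ (height f x 0)

variable {f g f' g' : ℝ → ℝ → ℝ} {sL sR m k k' : ℝ}

theorem height_neg_eq {s : ℝ} (hf : SlopeField f) (h : RightSigned (fun x y => -f (-x) y) (-s))
    (x : ℝ≥0) : height f (-(x : ℝ)) 0 = s * h.reach x := by
  have := h.height_eq x
  rwa [hf.height_reflect, neg_neg] at this

section HalfLines

variable {G : Type*} [Group G]

theorem solve_cycle {σ lX rX lY rY lX' rX' lY' rY' : G}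
    (h : σ * (lX⁻¹ * rY * rX⁻¹ * lY) = (lX'⁻¹ * rY' * rX'⁻¹ * lY') * σ) :
    lX' * σ * lX⁻¹ * rY = rY' * (rX'⁻¹ * (lY' * σ * lY⁻¹) * rX) := by
  have h2 : lX' * (σ * (lX⁻¹ * rY * rX⁻¹ * lY)) * lY⁻¹ * rX =
    lX' * ((lX'⁻¹ * rY' * rX'⁻¹ * lY') * σ) * lY⁻¹ * rX := by rw [h]
  simpa [mul_assoc] using h2

end HalfLines

/-- The conditions on the half-axes. Only if orbits cross all four quadrants do they form a cycle;
the cycle is closed by a conjugacy of the return maps, which are expanding because the slopes of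
`f` are smaller than those of `g`. -/
theorem exists_halfLine_matching (h : IsPair f g sL sR m k) (h' : IsPair f' g' sL sR m k') :
    ∃ σR σL κu κd : ℝ≥0 ≃o ℝ≥0,
      (sR = -1 → κu * h.fR.reach = h'.fR.reach * σR) ∧
      (m = 1 → κd * h.gR.reach = h'.gR.reach * σR) ∧
      (m = 1 → κu * h.gL.reach = h'.gL.reach * σL) ∧
      (sL = -1 → κd * h.fL.reach = h'.fL.reach * σL) := by
  have hm := mul_self_eq_one_iff.1 h.gR.sq
  have hR := mul_self_eq_one_iff.1 h.fR.sq
  have hL : sL = 1 ∨ sL = -1 := by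
    have := mul_self_eq_one_iff.1 h.fL.sq
    rcases this with h | h
    · right; linarith
    · left; linarith
  rcases hm with rfl | rfl
  · rcases hL with rfl | rfl
    · rcases hR with rfl | rfl
      · exact ⟨1, 1, h'.gL.reach * h.gL.reach⁻¹, h'.gR.reach * h.gR.reach⁻¹,
          by norm_num, by simp, by simp, by norm_num⟩
      · exact ⟨1, h'.gL.reach⁻¹ * (h'.fR.reach * h.fR.reach⁻¹) * h.gL.reach,
          h'.fR.reach * h.fR.reach⁻¹, h'.gR.reach * h.gR.reach⁻¹,
          by simp, by simp, by simp [mul_assoc], by norm_num⟩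
    · rcases hR with rfl | rfl
      · exact ⟨h'.gR.reach⁻¹ * (h'.fL.reach * h.fL.reach⁻¹) * h.gR.reach, 1,
          h'.gL.reach * h.gL.reach⁻¹, h'.fL.reach * h.fL.reach⁻¹,
          by norm_num, by simp [mul_assoc], by simp, by simp⟩
      · have hexp : ∀ {f g : ℝ → ℝ → ℝ} {k : ℝ} (h : IsPair f g (-1) (-1) 1 k), ∀ x, 0 < x →
            x < (h.fL.reach⁻¹ * h.gR.reach * h.fR.reach⁻¹ * h.gL.reach) x := by
          intro f g k h x hx
          have h1 : x < h.fR.reach.symm (h.gL.reach x) := by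
            rw [OrderIso.lt_symm_apply]
            have a := h.fR.reach_lt h.abs_lt hx
            have b := h.gL.lt_reach (k := k)
              (fun x y => by simpa using h.lt_mul (-x) y) hx
            exact_mod_cast a.trans b
          have h2 : ∀ u, 0 < u → u < h.fL.reach.symm (h.gR.reach u) := by
            intro u hu
            rw [OrderIso.lt_symm_apply]
            have a := h.fL.reach_lt (fun x y => by simpa using h.abs_lt (-x) y) hu
            have b := h.gR.lt_reach h.lt_mul hu
            exact_mod_cast a.trans b
          exact h1.trans (h2 _ (hx.trans h1))
        obtain ⟨σ, hσ⟩ := HalfLine.exists_conjugacy (hexp h) (hexp h')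
        exact ⟨h'.fR.reach⁻¹ * (h'.gL.reach * σ * h.gL.reach⁻¹) * h.fR.reach, σ,
          h'.gL.reach * σ * h.gL.reach⁻¹, h'.fL.reach * σ * h.fL.reach⁻¹,
          fun _ => by simp [mul_assoc], fun _ => solve_cycle hσ, by simp, by simp⟩
  · exact ⟨1, 1, h'.fR.reach * h.fR.reach⁻¹, h'.fL.reach * h.fL.reach⁻¹,
      by simp, by norm_num, by norm_num, by simp⟩

theorem exists_matching (h : IsPair f g sL sR m k) (h' : IsPair f' g' sL sR m k') :
    Nonempty (Matching f g f' g') := by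
  obtain ⟨σR, σL, κu, κd, e1, e2, e3, e4⟩ := exists_halfLine_matching h h'
  have hm := mul_self_eq_one_iff.1 h.gR.sq
  have hR := mul_self_eq_one_iff.1 h.fR.sq
  have hL : sL = 1 ∨ sL = -1 := by
    have := mul_self_eq_one_iff.1 h.fL.sq
    rcases this with h | h
    · right; linarith
    · left; linarith
  have toR : ∀ x : ℝ, 0 ≤ x → ∃ z : ℝ≥0, x = z := fun x hx => ⟨⟨x, hx⟩, rfl⟩
  have toL : ∀ x : ℝ, x ≤ 0 → ∃ z : ℝ≥0, x = -(z : ℝ) := fun x hx =>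
    ⟨(-x).toNNReal, by rw [Real.coe_toNNReal _ (by linarith), neg_neg]⟩
  -- in a quadrant that is not crossed, the condition defines the change of height on the other side
  refine ⟨{ σ := glueHalfLines σR σL
            κ₁ := glueHalfLines κu (h'.fR.reach * σR * h.fR.reach⁻¹)
            κ₂ := glueHalfLines κu (h'.gL.reach * σL * h.gL.reach⁻¹)
            κ₃ := glueHalfLines (h'.fL.reach * σL * h.fL.reach⁻¹) κd
            κ₄ := glueHalfLines (h'.gR.reach * σR * h.gR.reach⁻¹) κd
            σ_zero := glueHalfLines_zero _ _
            κ_zero := ⟨glueHalfLines_zero _ _, glueHalfLines_zero _ _, glueHalfLines_zero _ _,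
              glueHalfLines_zero _ _⟩
            up := ?_, down := ?_, right_up := ?_, right_down := ?_, left_up := ?_
            left_down := ?_ }⟩
  · intro y hy
    obtain ⟨z, rfl⟩ := toR y hy
    simp only [glueHalfLines_coe]
  · intro y hy
    obtain ⟨z, rfl⟩ := toL y hy
    simp only [glueHalfLines_neg_coe]
  · intro x hx
    obtain ⟨z, rfl⟩ := toR x hx
    rw [glueHalfLines_coe, h.fR.height_eq, h'.fR.height_eq]
    rcases hR with rfl | rfl
    · rw [neg_one_mul, neg_one_mul, glueHalfLines_neg_coe]
      simp
    · rw [neg_neg, one_mul, one_mul, glueHalfLines_coe]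
      exact congrArg NNReal.toReal (DFunLike.congr_fun (e1 rfl) z).symm
  · intro x hx
    obtain ⟨z, rfl⟩ := toR x hx
    rw [glueHalfLines_coe, h.gR.height_eq, h'.gR.height_eq]
    rcases hm with rfl | rfl
    · rw [neg_one_mul, neg_one_mul, glueHalfLines_neg_coe]
      exact congrArg (fun z : ℝ≥0 => -(z : ℝ)) (DFunLike.congr_fun (e2 rfl) z).symm
    · rw [neg_neg, one_mul, one_mul, glueHalfLines_coe]
      simp
  · intro x hx
    obtain ⟨z, rfl⟩ := toL x hx
    rw [glueHalfLines_neg_coe, height_neg_eq h.gR.toSlopeField h.gL,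
      height_neg_eq h'.gR.toSlopeField h'.gL]
    rcases hm with rfl | rfl
    · rw [one_mul, one_mul, glueHalfLines_coe]
      exact congrArg NNReal.toReal (DFunLike.congr_fun (e3 rfl) z).symm
    · rw [neg_one_mul, neg_one_mul, glueHalfLines_neg_coe]
      simp
  · intro x hx
    obtain ⟨z, rfl⟩ := toL x hx
    rw [glueHalfLines_neg_coe, height_neg_eq h.fR.toSlopeField h.fL,
      height_neg_eq h'.fR.toSlopeField h'.fL]
    rcases hL with rfl | rfl
    · rw [one_mul, one_mul, glueHalfLines_coe]
      simp
    · rw [neg_one_mul, neg_one_mul, glueHalfLines_neg_coe]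
      exact congrArg (fun z : ℝ≥0 => -(z : ℝ)) (DFunLike.congr_fun (e4 rfl) z).symm

namespace Matching

/-- The inverse changes of coordinates. -/
def symm (M : Matching f g f' g') : Matching f' g' f g where
  σ := M.σ.symm
  κ₁ := M.κ₁.symm
  κ₂ := M.κ₂.symm
  κ₃ := M.κ₃.symm
  κ₄ := M.κ₄.symm
  σ_zero := by rw [OrderIso.symm_apply_eq, M.σ_zero]
  κ_zero := by
    obtain ⟨h1, h2, h3, h4⟩ := M.κ_zero
    simp only [OrderIso.symm_apply_eq, h1, h2, h3, h4, and_self]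
  up y hy := by
    rw [OrderIso.symm_apply_eq, M.up _ (by rw [M.κ₁.le_symm_apply, M.κ_zero.1]; exact hy),
      OrderIso.apply_symm_apply]
  down y hy := by
    rw [OrderIso.symm_apply_eq, M.down _ (by
      rw [M.κ₄.symm_apply_le, M.κ_zero.2.2.2]; exact hy), OrderIso.apply_symm_apply]
  right_up x hx := by
    have := M.right_up (M.σ.symm x) (by
      rw [M.σ.le_symm_apply, M.σ_zero]; exact hx)
    rw [OrderIso.apply_symm_apply] at this
    rw [this, OrderIso.symm_apply_apply]
  right_down x hx := by
    have := M.right_down (M.σ.symm x) (by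
      rw [M.σ.le_symm_apply, M.σ_zero]; exact hx)
    rw [OrderIso.apply_symm_apply] at this
    rw [this, OrderIso.symm_apply_apply]
  left_up x hx := by
    have := M.left_up (M.σ.symm x) (by
      rw [M.σ.symm_apply_le, M.σ_zero]; exact hx)
    rw [OrderIso.apply_symm_apply] at this
    rw [this, OrderIso.symm_apply_apply]
  left_down x hx := by
    have := M.left_down (M.σ.symm x) (by
      rw [M.σ.symm_apply_le, M.σ_zero]; exact hx)
    rw [OrderIso.apply_symm_apply] at this
    rw [this, OrderIso.symm_apply_apply]

end Matching

end SlopeField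

/-! ### The homeomorphism of the plane given by a matching -/

namespace SlopeField

variable {f g f' g' : ℝ → ℝ → ℝ}

/-- The second coordinate of the point over `σ x` whose height for `f'` is `κ` of the height of
`(x, y)` for `f`. -/
noncomputable def transfer (f f' : ℝ → ℝ → ℝ) (σ κ : ℝ ≃o ℝ) (x y : ℝ) : ℝ :=
  flow f' (σ x) (κ (height f x y))

theorem continuous_transfer (hf : SlopeField f) (hf' : SlopeField f') (σ κ : ℝ ≃o ℝ) :
    Continuous fun p : ℝ × ℝ => transfer f f' σ κ p.1 p.2 :=
  hf'.continuous_flow.comp ((σ.continuous.comp continuous_fst).prodMk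
    (κ.continuous.comp hf.continuous_height))

theorem strictMono_transfer (hf : SlopeField f) (hf' : SlopeField f') (σ κ : ℝ ≃o ℝ) (x : ℝ) :
    StrictMono (transfer f f' σ κ x) :=
  (hf'.strictMono_flow _).comp (κ.strictMono.comp (hf.strictMono_height x))

theorem height_transfer (hf' : SlopeField f') (σ κ : ℝ ≃o ℝ) (x y : ℝ) :
    height f' (σ x) (transfer f f' σ κ x y) = κ (height f x y) := hf'.height_flow _ _

theorem transfer_symm (hf : SlopeField f) (hf' : SlopeField f') (σ κ : ℝ ≃o ℝ) (x y : ℝ) :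
    transfer f' f σ.symm κ.symm (σ x) (transfer f f' σ κ x y) = y := by
  rw [transfer, height_transfer hf', OrderIso.symm_apply_apply, OrderIso.symm_apply_apply,
    hf.flow_height]

theorem transfer_eq_zero (hf' : SlopeField f') {σ κ : ℝ ≃o ℝ} {x : ℝ}
    (h : height f' (σ x) 0 = κ (height f x 0)) : transfer f f' σ κ x 0 = 0 := by
  rw [transfer, ← h, hf'.flow_height]

theorem transfer_zero_left (hf : SlopeField f) (hf' : SlopeField f') {σ κ : ℝ ≃o ℝ} (h : σ 0 = 0)
    (y : ℝ) : transfer f f' σ κ 0 y = κ y := by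
  rw [transfer, h, hf'.flow_zero, hf.height_zero]

namespace Matching

variable (M : Matching f g f' g')

/-- The second coordinate of the homeomorphism, defined quadrant by quadrant. -/
noncomputable def snd (x y : ℝ) : ℝ :=
  if 0 ≤ x then
    if 0 ≤ y then transfer f f' M.σ M.κ₁ x y else transfer g g' M.σ M.κ₄ x y
  else
    if 0 ≤ y then transfer g g' M.σ M.κ₂ x y else transfer f f' M.σ M.κ₃ x y

theorem continuous_snd (hf : SlopeField f) (hg : SlopeField g) (hf' : SlopeField f')
    (hg' : SlopeField g') : Continuous fun p : ℝ × ℝ => M.snd p.1 p.2 := by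
  have c1 := continuous_transfer hf hf' M.σ M.κ₁
  have c2 := continuous_transfer hg hg' M.σ M.κ₂
  have c3 := continuous_transfer hf hf' M.σ M.κ₃
  have c4 := continuous_transfer hg hg' M.σ M.κ₄
  have cmax : Continuous fun p : ℝ × ℝ => (max p.1 0, p.2) := by fun_prop
  have cmin : Continuous fun p : ℝ × ℝ => (min p.1 0, p.2) := by fun_prop
  have hR : Continuous fun p : ℝ × ℝ => if 0 ≤ p.2 then transfer f f' M.σ M.κ₁ (max p.1 0) p.2
      else transfer g g' M.σ M.κ₄ (max p.1 0) p.2 := by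
    refine Continuous.if_le (c1.comp cmax) (c4.comp cmax) continuous_const _root_.continuous_snd
      fun p hp => ?_
    simp only [← hp]
    rw [transfer_eq_zero hf' (M.right_up _ (le_max_right _ _)),
      transfer_eq_zero hg' (M.right_down _ (le_max_right _ _))]
  have hL : Continuous fun p : ℝ × ℝ => if 0 ≤ p.2 then transfer g g' M.σ M.κ₂ (min p.1 0) p.2
      else transfer f f' M.σ M.κ₃ (min p.1 0) p.2 := by
    refine Continuous.if_le (c2.comp cmin) (c3.comp cmin) continuous_const _root_.continuous_snd
      fun p hp => ?_
    simp only [← hp]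
    rw [transfer_eq_zero hg' (M.left_up _ (min_le_right _ _)),
      transfer_eq_zero hf' (M.left_down _ (min_le_right _ _))]
  have := Continuous.if_le hR hL (continuous_const (y := (0 : ℝ))) continuous_fst (fun p hp => by
    simp only [← hp, max_self, min_self]
    rw [transfer_zero_left hf hf' M.σ_zero, transfer_zero_left hg hg' M.σ_zero,
      transfer_zero_left hf hf' M.σ_zero, transfer_zero_left hg hg' M.σ_zero]
    split_ifs with h
    · exact (M.up _ h).symm
    · exact (M.down _ (le_of_not_ge h)).symm)
  refine this.congr fun p => ?_
  by_cases h : 0 ≤ p.1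
  · simp only [snd, h, if_true, max_eq_left]
  · simp only [snd, h, if_false, min_eq_left (le_of_not_ge h)]

theorem snd_zero (hf' : SlopeField f') (hg' : SlopeField g') (x : ℝ) : M.snd x 0 = 0 := by
  by_cases h : 0 ≤ x
  · simp [snd, h, transfer_eq_zero hf' (M.right_up x h)]
  · simp [snd, h, transfer_eq_zero hg' (M.left_up x (le_of_not_ge h))]

theorem snd_pos (hf : SlopeField f) (hg : SlopeField g) (hf' : SlopeField f')
    (hg' : SlopeField g') {x y : ℝ} (hy : 0 < y) : 0 < M.snd x y := by
  by_cases h : 0 ≤ x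
  · simp only [snd, h, hy.le, if_true]
    rw [← transfer_eq_zero hf' (M.right_up x h)]
    exact strictMono_transfer hf hf' _ _ _ hy
  · simp only [snd, h, hy.le, if_true, if_false]
    rw [← transfer_eq_zero hg' (M.left_up x (le_of_not_ge h))]
    exact strictMono_transfer hg hg' _ _ _ hy

theorem snd_neg (hf : SlopeField f) (hg : SlopeField g) (hf' : SlopeField f')
    (hg' : SlopeField g') {x y : ℝ} (hy : y < 0) : M.snd x y < 0 := by
  by_cases h : 0 ≤ x
  · simp only [snd, h, not_le.2 hy, if_true, if_false]
    rw [← transfer_eq_zero hg' (M.right_down x h)]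
    exact strictMono_transfer hg hg' _ _ _ hy
  · simp only [snd, h, not_le.2 hy, if_false]
    rw [← transfer_eq_zero hf' (M.left_down x (le_of_not_ge h))]
    exact strictMono_transfer hf hf' _ _ _ hy

theorem snd_nonneg_iff (hf : SlopeField f) (hg : SlopeField g) (hf' : SlopeField f')
    (hg' : SlopeField g') {x y : ℝ} : 0 ≤ M.snd x y ↔ 0 ≤ y := by
  constructor
  · intro h
    by_contra! hy
    exact absurd h (not_le.2 (snd_neg M hf hg hf' hg' hy))
  · intro h
    rcases h.eq_or_lt with rfl | h
    · exact (snd_zero M hf' hg' x).ge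
    · exact (snd_pos M hf hg hf' hg' h).le

theorem σ_nonneg_iff {x : ℝ} : 0 ≤ M.σ x ↔ 0 ≤ x := by
  have := M.σ.le_iff_le (x := 0) (y := x)
  rwa [M.σ_zero] at this

theorem snd_symm (hf : SlopeField f) (hg : SlopeField g) (hf' : SlopeField f')
    (hg' : SlopeField g') (x y : ℝ) : M.symm.snd (M.σ x) (M.snd x y) = y := by
  have h1 := M.σ_nonneg_iff (x := x)
  have h2 := snd_nonneg_iff M hf hg hf' hg' (x := x) (y := y)
  rw [snd]
  simp only [h1, h2]
  rw [snd]
  split_ifs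
  · exact transfer_symm hf hf' _ _ _ _
  · exact transfer_symm hg hg' _ _ _ _
  · exact transfer_symm hg hg' _ _ _ _
  · exact transfer_symm hf hf' _ _ _ _

/-- The underlying map of the plane. -/
noncomputable def map (p : Plane) : Plane := !₂[M.σ (p 0), M.snd (p 0) (p 1)]

@[simp] theorem map_zero_coord (p : Plane) : M.map p 0 = M.σ (p 0) := rfl

@[simp] theorem map_one_coord (p : Plane) : M.map p 1 = M.snd (p 0) (p 1) := rfl

theorem continuous_map (hf : SlopeField f) (hg : SlopeField g) (hf' : SlopeField f')
    (hg' : SlopeField g') : Continuous M.map := by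
  have c : Continuous fun p : Plane => (p 0, p 1) := by fun_prop
  refine (PiLp.continuous_toLp 2 _).comp (continuous_pi fun i => ?_)
  fin_cases i
  · exact M.σ.continuous.comp (by fun_prop)
  · exact (continuous_snd M hf hg hf' hg').comp c

theorem map_symm_map (hf : SlopeField f) (hg : SlopeField g) (hf' : SlopeField f')
    (hg' : SlopeField g') (p : Plane) : M.symm.map (M.map p) = p := by
  ext i
  fin_cases i
  · exact M.σ.symm_apply_apply _
  · exact M.snd_symm hf hg hf' hg' _ _

/-- The homeomorphism of the plane given by a matching. -/
noncomputable def homeo (hf : SlopeField f) (hg : SlopeField g) (hf' : SlopeField f')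
    (hg' : SlopeField g') : Plane ≃ₜ Plane where
  toFun := M.map
  invFun := M.symm.map
  left_inv := M.map_symm_map hf hg hf' hg'
  right_inv := M.symm.map_symm_map hf' hg' hf hg
  continuous_toFun := M.continuous_map hf hg hf' hg'
  continuous_invFun := M.symm.continuous_map hf' hg' hf hg

theorem sign_map (hf : SlopeField f) (hg : SlopeField g) (hf' : SlopeField f')
    (hg' : SlopeField g') (p : Plane) (i : Fin 2) :
    SignType.sign (M.map p i) = SignType.sign (p i) := by
  have key : ∀ {u v : ℝ}, (0 < v → 0 < u) → (v < 0 → u < 0) → (v = 0 → u = 0) →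
      SignType.sign u = SignType.sign v := by
    intro u v h1 h2 h3
    rcases lt_trichotomy v 0 with h | h | h
    · rw [sign_neg h, sign_neg (h2 h)]
    · rw [h3 h, h]
    · rw [sign_pos h, sign_pos (h1 h)]
  fin_cases i
  · refine key (fun h => ?_) (fun h => ?_) (fun h => ?_)
    · exact (M.σ_zero ▸ M.σ.strictMono h : 0 < M.σ (p 0))
    · exact (M.σ_zero ▸ M.σ.strictMono h : M.σ (p 0) < 0)
    · exact (congrArg M.σ h).trans M.σ_zero
  · refine key (snd_pos M hf hg hf' hg') (snd_neg M hf hg hf' hg') (fun h => ?_)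
    have h : p 1 = 0 := h
    change M.snd (p 0) (p 1) = 0
    rw [h, snd_zero M hf' hg']

theorem height_map_up_right (hf' : SlopeField f') {p : Plane} (h0 : 0 < p 0) (h1 : 0 < p 1) :
    height f' (M.map p 0) (M.map p 1) = M.κ₁ (height f (p 0) (p 1)) := by
  rw [map_zero_coord, map_one_coord, snd, if_pos h0.le, if_pos h1.le, height_transfer hf']

theorem height_map_up_left (hg' : SlopeField g') {p : Plane} (h0 : p 0 < 0) (h1 : 0 < p 1) :
    height g' (M.map p 0) (M.map p 1) = M.κ₂ (height g (p 0) (p 1)) := by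
  rw [map_zero_coord, map_one_coord, snd, if_neg (not_le.2 h0), if_pos h1.le, height_transfer hg']

theorem height_map_down_left (hf' : SlopeField f') {p : Plane} (h0 : p 0 < 0) (h1 : p 1 < 0) :
    height f' (M.map p 0) (M.map p 1) = M.κ₃ (height f (p 0) (p 1)) := by
  rw [map_zero_coord, map_one_coord, snd, if_neg (not_le.2 h0), if_neg (not_le.2 h1),
    height_transfer hf']

theorem height_map_down_right (hg' : SlopeField g') {p : Plane} (h0 : 0 < p 0) (h1 : p 1 < 0) :
    height g' (M.map p 0) (M.map p 1) = M.κ₄ (height g (p 0) (p 1)) := by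
  rw [map_zero_coord, map_one_coord, snd, if_pos h0.le, if_neg (not_le.2 h1), height_transfer hg']

end Matching

end SlopeField

/-! ### Tame fields -/

namespace PiecewiseField

theorem eq_vec (p : Plane) : !₂[p 0, p 1] = p := by
  ext i
  fin_cases i <;> rfl

/-- The slope of the field `V` at `(x, y)`. -/
noncomputable def slope (V : Plane → Plane) (x y : ℝ) : ℝ := V !₂[x, y] 1 / V !₂[x, y] 0

theorem slope_apply (V : Plane → Plane) (p : Plane) : slope V (p 0) (p 1) = V p 1 / V p 0 := by
  rw [slope, eq_vec]

/-- The height over the vertical axis of the orbit of `V` through `p`. -/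
noncomputable def orbitHeight (V : Plane → Plane) (p : Plane) : ℝ :=
  SlopeField.height (slope V) (p 0) (p 1)

/-- The linear function `k x₁ + b x₂`, which increases along the trajectories of a tame field. -/
def clock (k b : ℝ) (p : Plane) : ℝ := k * p 0 + b * p 1

/-- A field on the whole plane with the behaviour that a field with a standard fold, or a small
perturbation of it, has near the origin: `X` points to the right, `a` and `b` are the signs of the
components of `Y`, `sL` and `sR` those of `X₂` on the left and on the right half of `Σ₂`, and `Y` is
steeper than `X`: `k` lies between the absolute values of their slopes. -/
structure Tame (Z : PiecewiseField) (a b sL sR k : ℝ) : Prop where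
  contX : Continuous Z.X
  contY : Continuous Z.Y
  sqa : a * a = 1
  sqb : b * b = 1
  X_zero : ∀ p, 0 < Z.X p 0
  Y_zero : ∀ p, 0 < a * Z.Y p 0
  Y_one : ∀ p, 0 < b * Z.Y p 1
  pair : SlopeField.IsPair (slope Z.X) (slope Z.Y) sL sR (a * b) k
  bdd : ∃ M, ∀ p, ‖Z.X p‖ ≤ M ∧ ‖Z.Y p‖ ≤ M
  clock_bdd : ∃ m > 0, ∀ p, m ≤ clock k b (Z.X p) ∧ m ≤ clock k b (Z.Y p)

theorem mem_slidEsc {Z : PiecewiseField} {i : Fin 2} {p : Plane} :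
    p ∈ Z.slidEsc i ↔ p i = 0 ∧ p (i + 1) ≠ 0 ∧ Z.X p i * Z.Y p i < 0 := by
  simp only [slidEsc, sliding, escaping, axis, mem_union, mem_ofPred_eq, mul_neg_iff,
    ← and_or_left]
  refine and_congr_right fun _ => ?_
  rcases lt_trichotomy (p (i + 1)) 0 with h | h | h
  · simp [h, h.ne, not_lt.2 h.le]
  · simp [h]
  · simp [h, h.ne', not_lt.2 h.le, or_comm]

theorem mem_switching {p : Plane} : p ∈ switching ↔ p 0 = 0 ∨ p 1 = 0 := mul_eq_zero

theorem plane_eq_zero {p : Plane} (h0 : p 0 = 0) (h1 : p 1 = 0) : p = 0 := by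
  ext i
  fin_cases i
  · exact h0
  · exact h1

theorem mem_axis_switching {p : Plane} {i : Fin 2} (h : p ∈ axis i) : p ∈ switching := by
  rw [mem_switching]
  fin_cases i
  · exact Or.inl h
  · exact Or.inr h

theorem mem_regionPos {p : Plane} : p ∈ regionPos ↔ (0 < p 0 ∧ 0 < p 1) ∨ (p 0 < 0 ∧ p 1 < 0) :=
  (show p ∈ regionPos ↔ 0 < p 0 * p 1 from Iff.rfl).trans mul_pos_iff

theorem mem_regionNeg {p : Plane} : p ∈ regionNeg ↔ (0 < p 0 ∧ p 1 < 0) ∨ (p 0 < 0 ∧ 0 < p 1) :=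
  (show p ∈ regionNeg ↔ p 0 * p 1 < 0 from Iff.rfl).trans mul_neg_iff

theorem isOpen_regionPos : IsOpen regionPos :=
  isOpen_lt continuous_const (by fun_prop : Continuous fun p : Plane => p 0 * p 1)

theorem isOpen_regionNeg : IsOpen regionNeg :=
  isOpen_lt (by fun_prop : Continuous fun p : Plane => p 0 * p 1) continuous_const

theorem isClosed_axis (i : Fin 2) : IsClosed (axis i) :=
  isClosed_eq (by fun_prop : Continuous fun p : Plane => p i) continuous_const

theorem slidingField_self (Z : PiecewiseField) (i : Fin 2) (p : Plane) :
    Z.slidingField i p i = 0 := by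
  simp [slidingField, mul_comm]

theorem clock_slidingField (Z : PiecewiseField) (k b : ℝ) (i : Fin 2) (p : Plane) :
    clock k b (Z.slidingField i p) = (Z.Y p i - Z.X p i)⁻¹ *
      (Z.Y p i * clock k b (Z.X p) - Z.X p i * clock k b (Z.Y p)) := by
  simp [slidingField, clock]; ring

/-- The sliding field is a convex combination of `X` and `Y`. -/
theorem clock_slidingField_pos {Z : PiecewiseField} {k b : ℝ} {i : Fin 2} {p : Plane}
    (hX : 0 < clock k b (Z.X p)) (hY : 0 < clock k b (Z.Y p)) (hle : Z.X p i * Z.Y p i ≤ 0)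
    (hne : Z.X p i ≠ Z.Y p i) : 0 < clock k b (Z.slidingField i p) := by
  rw [clock_slidingField]
  rcases hne.lt_or_gt with h | h
  · have h1 : Z.X p i ≤ 0 := by by_contra! hc; nlinarith
    have h2 : 0 ≤ Z.Y p i := by by_contra! hc; nlinarith
    refine mul_pos (inv_pos.2 (by linarith)) ?_
    rcases h1.eq_or_lt with h0 | h0
    · rw [h0] at h ⊢
      rw [zero_mul, sub_zero]
      exact mul_pos h hX
    · nlinarith [mul_nonneg h2 hX.le, mul_pos (neg_pos.2 h0) hY]
  · have h1 : Z.Y p i ≤ 0 := by by_contra! hc; nlinarith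
    have h2 : 0 ≤ Z.X p i := by by_contra! hc; nlinarith
    refine mul_pos_of_neg_of_neg (inv_lt_zero.2 (by linarith)) ?_
    rcases h1.eq_or_lt with h0 | h0
    · rw [h0] at h ⊢
      rw [zero_mul, zero_sub]
      exact neg_neg_of_pos (mul_pos h hY)
    · nlinarith [mul_nonneg h2 hY.le, mul_pos (neg_pos.2 h0) hX]

namespace Tame

variable {Z Z' : PiecewiseField} {a b sL sR k k' : ℝ}

theorem a_cases (h : Z.Tame a b sL sR k) : a = 1 ∨ a = -1 := mul_self_eq_one_iff.1 h.sqa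

theorem b_cases (h : Z.Tame a b sL sR k) : b = 1 ∨ b = -1 := mul_self_eq_one_iff.1 h.sqb

theorem sR_cases (h : Z.Tame a b sL sR k) : sR = b ∨ sR = -b := by
  have := mul_self_eq_one_iff.1 h.pair.fR.sq
  rcases h.b_cases with rfl | rfl <;> rcases this with rfl | rfl <;> simp

theorem sL_cases (h : Z.Tame a b sL sR k) : sL = b ∨ sL = -b := by
  have := mul_self_eq_one_iff.1 h.pair.fL.sq
  rcases h.b_cases with rfl | rfl
  · rcases this with h | h
    · right; linarith
    · left; linarith
  · rcases this with h | h
    · left; linarith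
    · right; linarith

theorem k_pos (h : Z.Tame a b sL sR k) : 0 < k := (abs_nonneg _).trans_lt (h.pair.abs_lt 0 0)

theorem clock_X_pos (h : Z.Tame a b sL sR k) (p : Plane) : 0 < clock k b (Z.X p) := by
  obtain ⟨m, hm, hp⟩ := h.clock_bdd
  exact hm.trans_le (hp p).1

theorem clock_Y_pos (h : Z.Tame a b sL sR k) (p : Plane) : 0 < clock k b (Z.Y p) := by
  obtain ⟨m, hm, hp⟩ := h.clock_bdd
  exact hm.trans_le (hp p).2

theorem right_pos (h : Z.Tame a b sL sR k) {p : Plane} (h0 : 0 < p 0) (h1 : p 1 = 0) :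
    0 < sR * Z.X p 1 := by
  have := h.pair.fR.pos (p 0) h0
  have e : slope Z.X (p 0) 0 = Z.X p 1 / Z.X p 0 := by rw [← slope_apply, h1]
  rw [e, ← mul_div_assoc] at this
  exact (div_pos_iff_of_pos_right (h.X_zero p)).1 this

theorem left_pos (h : Z.Tame a b sL sR k) {p : Plane} (h0 : p 0 < 0) (h1 : p 1 = 0) :
    0 < sL * Z.X p 1 := by
  have := h.pair.fL.pos (-p 0) (by linarith)
  have e : slope Z.X (p 0) 0 = Z.X p 1 / Z.X p 0 := by rw [← slope_apply, h1]
  rw [neg_neg, e, neg_mul_neg, ← mul_div_assoc] at this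
  exact (div_pos_iff_of_pos_right (h.X_zero p)).1 this

theorem Y_zero_ne (h : Z.Tame a b sL sR k) (p : Plane) : Z.Y p 0 ≠ 0 := by
  intro h0
  simpa [h0] using h.Y_zero p

theorem Y_one_ne (h : Z.Tame a b sL sR k) (p : Plane) : Z.Y p 1 ≠ 0 := by
  intro h0
  simpa [h0] using h.Y_one p

/-- The only possible tangency is the origin. -/
theorem mul_ne_zero_of_mem_axis (h : Z.Tame a b sL sR k) {p : Plane} (hp : p ≠ 0) {i : Fin 2}
    (hi : p ∈ axis i) : Z.X p i * Z.Y p i ≠ 0 := by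
  fin_cases i
  · exact mul_ne_zero (h.X_zero p).ne' (h.Y_zero_ne p)
  · have h1 : p 1 = 0 := hi
    refine mul_ne_zero ?_ (h.Y_one_ne p)
    intro h0
    rcases lt_trichotomy (p 0) 0 with hx | hx | hx
    · have := h.left_pos hx h1
      change Z.X p 1 = 0 at h0
      simp [h0] at this
    · exact hp (plane_eq_zero hx h1)
    · have := h.right_pos hx h1
      change Z.X p 1 = 0 at h0
      simp [h0] at this

theorem mem_crossing_zero (h : Z.Tame a b sL sR k) {p : Plane} :
    p ∈ Z.crossing 0 ↔ p 0 = 0 ∧ a = 1 := by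
  have h1 := h.X_zero p
  have h2 := h.Y_zero p
  simp only [crossing, axis, mem_ofPred_eq]
  refine and_congr_right fun _ => ?_
  rw [mul_pos_iff_of_pos_left h1]
  rcases h.a_cases with rfl | rfl
  · simpa using h2
  · constructor
    · intro h; linarith
    · intro h; norm_num at h

theorem mem_slidEsc_zero (h : Z.Tame a b sL sR k) {p : Plane} :
    p ∈ Z.slidEsc 0 ↔ p 0 = 0 ∧ p 1 ≠ 0 ∧ a = -1 := by
  have h1 := h.X_zero p
  have h2 := h.Y_zero p
  rw [mem_slidEsc]
  refine and_congr_right fun _ => and_congr_right fun _ => ?_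
  rw [mul_neg_iff, and_iff_right h1, or_iff_left (fun hc => by linarith [hc.1])]
  rcases h.a_cases with rfl | rfl
  · constructor
    · intro h; linarith
    · intro h; norm_num at h
  · constructor
    · intro; rfl
    · intro; linarith

/-- The sign of `X₂ Y₂` on the two halves of `Σ₂`. -/
theorem mul_one_pos (h : Z.Tame a b sL sR k) {p : Plane} {s : ℝ} (hs : s = b ∨ s = -b)
    (hX : 0 < s * Z.X p 1) : (0 < Z.X p 1 * Z.Y p 1 ↔ s = b) ∧
      (Z.X p 1 * Z.Y p 1 < 0 ↔ s = -b) := by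
  have hb := h.sqb
  have hY := h.Y_one p
  have hb0 : b ≠ 0 := by rintro rfl; simp at hb
  have hbn : b ≠ -b := fun h => hb0 (by linarith)
  have hpos := mul_pos hX hY
  rcases hs with rfl | rfl
  · have e : s * Z.X p 1 * (s * Z.Y p 1) = Z.X p 1 * Z.Y p 1 := by
      linear_combination (Z.X p 1 * Z.Y p 1) * hb
    rw [e] at hpos
    exact ⟨⟨fun _ => rfl, fun _ => hpos⟩, ⟨fun hc => absurd hc (not_lt.2 hpos.le),
      fun hc => absurd hc hbn⟩⟩
  · have e : -b * Z.X p 1 * (b * Z.Y p 1) = -(Z.X p 1 * Z.Y p 1) := by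
      linear_combination -(Z.X p 1 * Z.Y p 1) * hb
    rw [e] at hpos
    exact ⟨⟨fun hc => absurd hc (not_lt.2 (by linarith)), fun hc => absurd hc.symm hbn⟩,
      ⟨fun _ => rfl, fun _ => by linarith⟩⟩

theorem mem_crossing_one (h : Z.Tame a b sL sR k) {p : Plane} (hp : p ≠ 0) :
    p ∈ Z.crossing 1 ↔ p 1 = 0 ∧ ((0 < p 0 ∧ sR = b) ∨ (p 0 < 0 ∧ sL = b)) := by
  simp only [crossing, axis, mem_ofPred_eq]
  refine and_congr_right fun h1 => ?_
  rcases lt_trichotomy (p 0) 0 with hx | hx | hx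
  · rw [(h.mul_one_pos h.sL_cases (h.left_pos hx h1)).1]
    simp [hx, not_lt.2 hx.le]
  · exact absurd (plane_eq_zero hx h1) hp
  · rw [(h.mul_one_pos h.sR_cases (h.right_pos hx h1)).1]
    simp [hx, not_lt.2 hx.le]

theorem mem_slidEsc_one (h : Z.Tame a b sL sR k) {p : Plane} :
    p ∈ Z.slidEsc 1 ↔ p 1 = 0 ∧ ((0 < p 0 ∧ sR = -b) ∨ (p 0 < 0 ∧ sL = -b)) := by
  rw [mem_slidEsc]
  refine and_congr_right fun h1 => ?_
  change (p 0 ≠ 0 ∧ _) ↔ _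
  rcases lt_trichotomy (p 0) 0 with hx | hx | hx
  · rw [(h.mul_one_pos h.sL_cases (h.left_pos hx h1)).2]
    simp [hx, hx.ne, not_lt.2 hx.le]
  · simp [hx]
  · rw [(h.mul_one_pos h.sR_cases (h.right_pos hx h1)).2]
    simp [hx, hx.ne', not_lt.2 hx.le]

theorem zero_mem_closure {S : Set Plane} {c : ℝ → Plane} (hc : Continuous c) (h0 : c 0 = 0)
    (h : ∀ t, 0 < t → c t ∈ S) : 0 ∈ closure S := by
  rw [← h0]
  refine mem_closure_of_tendsto (hc.continuousWithinAt (s := Ioi 0) (x := 0)) ?_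
  filter_upwards [self_mem_nhdsWithin] with t ht using h t ht

theorem continuous_vec {u v : ℝ → ℝ} (hu : Continuous u) (hv : Continuous v) :
    Continuous fun t => (!₂[u t, v t] : Plane) := by
  refine (PiLp.continuous_toLp 2 _).comp (continuous_pi fun i => ?_)
  fin_cases i
  · exact hu
  · exact hv

theorem vec_zero : (!₂[0, 0] : Plane) = 0 := plane_eq_zero rfl rfl

theorem zero_mem_closure_slidEsc_zero (h : Z.Tame a b sL sR k) :
    0 ∈ closure (Z.slidEsc 0) ↔ a = -1 := by
  constructor
  · intro hc
    obtain ⟨p, hp⟩ := closure_nonempty_iff.1 ⟨_, hc⟩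
    exact (h.mem_slidEsc_zero.1 hp).2.2
  · intro ha
    exact zero_mem_closure (c := fun t => !₂[0, t])
      (continuous_vec continuous_const continuous_id) vec_zero
      fun t ht => h.mem_slidEsc_zero.2 ⟨rfl, ht.ne', ha⟩

theorem zero_mem_closure_slidEsc_one (h : Z.Tame a b sL sR k) :
    0 ∈ closure (Z.slidEsc 1) ↔ sL = -b ∨ sR = -b := by
  constructor
  · intro hc
    obtain ⟨p, hp⟩ := closure_nonempty_iff.1 ⟨_, hc⟩
    rcases (h.mem_slidEsc_one.1 hp).2 with h | h
    · exact Or.inr h.2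
    · exact Or.inl h.2
  · rintro (hs | hs)
    · exact zero_mem_closure (c := fun t => !₂[-t, 0])
        (continuous_vec continuous_neg continuous_const) (by simp)
        fun t ht => h.mem_slidEsc_one.2 ⟨rfl, Or.inr ⟨neg_lt_zero.2 ht, hs⟩⟩
    · exact zero_mem_closure (c := fun t => !₂[t, 0])
        (continuous_vec continuous_id continuous_const) vec_zero
        fun t ht => h.mem_slidEsc_one.2 ⟨rfl, Or.inl ⟨ht, hs⟩⟩

theorem b_ne_neg (h : Z.Tame a b sL sR k) : b ≠ -b := by
  rcases h.b_cases with rfl | rfl <;> norm_num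

/-- `Σ` is the closure of its crossing part if both lines are crossing; on `Σ₂` this means that `X₂`
and `Y₂` have the same sign on both halves. -/
theorem allCrossing_iff (h : Z.Tame a b sL sR k) :
    Z.AllCrossing ↔ a = 1 ∧ sL = b ∧ sR = b := by
  have hb := h.b_ne_neg
  constructor
  · intro hall
    -- a curve in `Σ` that starts at the origin cannot leave a closed set which contains the
    -- crossing points
    have along : ∀ {u v : ℝ → ℝ} (S : Set Plane), Continuous u → Continuous v → u 0 = 0 →
        v 0 = 0 → (∀ t, u t = 0 ∨ v t = 0) → IsClosed S → Z.crossing 0 ∪ Z.crossing 1 ⊆ S →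
        (∀ t, 0 < t → !₂[u t, v t] ∉ S) → False := by
      intro u v S hu hv hu0 hv0 huv hS hsub hnot
      have hc := continuous_vec hu hv
      have ht : Tendsto (fun t => (!₂[u t, v t] : Plane)) (𝓝[>] 0) (𝓝 0) := by
        have := hc.continuousWithinAt (s := Ioi 0) (x := 0)
        rwa [ContinuousWithinAt, hu0, hv0, vec_zero] at this
      obtain ⟨t, ht1, ht2⟩ := ((ht.eventually hall).and self_mem_nhdsWithin).exists
      exact hnot t ht2 (hS.closure_subset_iff.2 hsub (ht1 (mem_switching.2 (huv t))))
    refine ⟨?_, ?_, ?_⟩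
    · by_contra ha
      refine along (u := fun _ => 0) (v := id) (axis 1) continuous_const continuous_id rfl rfl
        (fun _ => Or.inl rfl) (isClosed_axis 1) ?_ fun t ht => ht.ne'
      rintro p (hp | hp)
      · exact absurd (h.mem_crossing_zero.1 hp).2 ha
      · exact hp.1
    · by_contra hs
      refine along (u := Neg.neg) (v := fun _ => 0) {p | 0 ≤ p 0} continuous_neg continuous_const
        (by simp) rfl (fun _ => Or.inr rfl)
        (isClosed_le continuous_const (by fun_prop : Continuous fun p : Plane => p 0)) ?_
        fun t ht => not_le.2 (neg_lt_zero.2 ht)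
      rintro p (hp | hp)
      · exact (h.mem_crossing_zero.1 hp).1.ge
      · by_cases hp0 : p = 0
        · simp [hp0]
        · rcases ((h.mem_crossing_one hp0).1 hp).2 with h' | h'
          · exact h'.1.le
          · exact absurd h'.2 hs
    · by_contra hs
      refine along (u := id) (v := fun _ => 0) {p | p 0 ≤ 0} continuous_id continuous_const
        rfl rfl (fun _ => Or.inr rfl)
        (isClosed_le (by fun_prop : Continuous fun p : Plane => p 0) continuous_const) ?_
        fun t ht => not_le.2 ht
      rintro p (hp | hp)
      · exact (h.mem_crossing_zero.1 hp).1.le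
      · by_cases hp0 : p = 0
        · simp [hp0]
        · rcases ((h.mem_crossing_one hp0).1 hp).2 with h' | h'
          · exact absurd h'.2 hs
          · exact h'.1.le
  · rintro ⟨ha, hL, hR⟩
    refine Eventually.of_forall fun p hp => subset_closure ?_
    rcases mem_switching.1 hp with h0 | h0
    · exact Or.inl (h.mem_crossing_zero.2 ⟨h0, ha⟩)
    · by_cases hx : p 0 = 0
      · exact Or.inl (h.mem_crossing_zero.2 ⟨hx, ha⟩)
      · refine Or.inr ((h.mem_crossing_one fun hp => hx (by simp [hp])).2 ⟨h0, ?_⟩)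
        rcases lt_or_gt_of_ne hx with h' | h'
        · exact Or.inr ⟨h', hL⟩
        · exact Or.inl ⟨h', hR⟩

theorem mul_nonpos_of_mem_closure (h : Z.Tame a b sL sR k) {i : Fin 2}
    (hc : 0 ∈ closure (Z.slidEsc i)) : Z.X 0 i * Z.Y 0 i ≤ 0 := by
  have hX := h.contX
  have hY := h.contY
  have hcl : IsClosed {p | Z.X p i * Z.Y p i ≤ 0} :=
    isClosed_le (by fun_prop) continuous_const
  exact hcl.closure_subset_iff.2 (fun p hp => (mem_slidEsc.1 hp).2.2.le) hc

theorem slidesThroughOrigin_zero_iff (h : Z.Tame a b sL sR k) :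
    Z.SlidesThroughOrigin 0 ↔ a = -1 ∧ sL = b ∧ sR = b := by
  have hb := h.b_ne_neg
  constructor
  · rintro ⟨h1, h2, -⟩
    rw [h.zero_mem_closure_slidEsc_zero] at h1
    change 0 ∉ closure (Z.slidEsc 1) at h2
    rw [h.zero_mem_closure_slidEsc_one, not_or] at h2
    exact ⟨h1, h.sL_cases.resolve_right h2.1, h.sR_cases.resolve_right h2.2⟩
  · rintro ⟨h1, h2, h3⟩
    refine ⟨h.zero_mem_closure_slidEsc_zero.2 h1, ?_, ?_, ?_⟩
    · change 0 ∉ closure (Z.slidEsc 1)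
      rw [h.zero_mem_closure_slidEsc_one, h2, h3]
      simp [hb]
    · refine zero_mem_closure (c := fun t => !₂[t, 0])
        (continuous_vec continuous_id continuous_const) vec_zero fun t ht => ?_
      have hne : (!₂[t, 0] : Plane) ≠ 0 := fun hc => ht.ne' (congrArg (fun p : Plane => p 0) hc)
      exact (h.mem_crossing_one hne).2 ⟨rfl, Or.inl ⟨ht, h3⟩⟩
    · have hX := h.X_zero 0
      have hY := h.Y_zero 0
      rw [h1] at hY
      intro he
      linarith

theorem slidesThroughOrigin_one_iff (h : Z.Tame a b sL sR k) :
    Z.SlidesThroughOrigin 1 ↔ a = 1 ∧ (sL = -b ∨ sR = -b) := by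
  constructor
  · rintro ⟨h1, h2, -⟩
    rw [h.zero_mem_closure_slidEsc_one] at h1
    change 0 ∉ closure (Z.slidEsc 0) at h2
    rw [h.zero_mem_closure_slidEsc_zero] at h2
    exact ⟨h.a_cases.resolve_right h2, h1⟩
  · rintro ⟨h1, h2⟩
    have hc := h.zero_mem_closure_slidEsc_one.2 h2
    refine ⟨hc, ?_, ?_, ?_⟩
    · change 0 ∉ closure (Z.slidEsc 0)
      rw [h.zero_mem_closure_slidEsc_zero, h1]
      norm_num
    · exact zero_mem_closure (c := fun t => !₂[0, t])
        (continuous_vec continuous_const continuous_id) vec_zero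
        fun t _ => h.mem_crossing_zero.2 ⟨rfl, h1⟩
    · intro he
      have := h.mul_nonpos_of_mem_closure hc
      rw [he] at this
      exact absurd this (not_le.2 (mul_self_pos.2 (h.Y_one_ne 0)))

theorem not_allCrossing_of_slides (h : Z.Tame a b sL sR k) {i : Fin 2}
    (hs : Z.SlidesThroughOrigin i) : ¬ Z.AllCrossing := by
  have hb := h.b_ne_neg
  rw [h.allCrossing_iff]
  rintro ⟨h1, h2, h3⟩
  fin_cases i
  · have := (h.slidesThroughOrigin_zero_iff.1 hs).1
    rw [h1] at this
    norm_num at this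
  · rcases (h.slidesThroughOrigin_one_iff.1 hs).2 with h' | h'
    · exact hb (h2 ▸ h')
    · exact hb (h3 ▸ h')

theorem slidesThroughOrigin_iff (h : Z.Tame a b sL sR k) (h' : Z'.Tame a b sL sR k') (i : Fin 2) :
    Z.SlidesThroughOrigin i ↔ Z'.SlidesThroughOrigin i := by
  fin_cases i
  · exact h.slidesThroughOrigin_zero_iff.trans h'.slidesThroughOrigin_zero_iff.symm
  · exact h.slidesThroughOrigin_one_iff.trans h'.slidesThroughOrigin_one_iff.symm

theorem mem_slidEsc_congr (h : Z.Tame a b sL sR k) (h' : Z'.Tame a b sL sR k') {p q : Plane}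
    (hpq : ∀ i, SignType.sign (p i) = SignType.sign (q i)) (i : Fin 2) :
    p ∈ Z.slidEsc i ↔ q ∈ Z'.slidEsc i := by
  have e : ∀ i, p i = 0 ↔ q i = 0 := fun i => by rw [← sign_eq_zero_iff, hpq, sign_eq_zero_iff]
  have e1 : ∀ i, 0 < p i ↔ 0 < q i := fun i => by rw [← sign_eq_one_iff, hpq, sign_eq_one_iff]
  have e2 : ∀ i, p i < 0 ↔ q i < 0 := fun i => by
    rw [← sign_eq_neg_one_iff, hpq, sign_eq_neg_one_iff]
  fin_cases i
  · refine h.mem_slidEsc_zero.trans (Iff.trans ?_ h'.mem_slidEsc_zero.symm)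
    rw [e, Ne, e]
  · refine h.mem_slidEsc_one.trans (Iff.trans ?_ h'.mem_slidEsc_one.symm)
    rw [e, e1, e2]

theorem mem_crossing_congr (h : Z.Tame a b sL sR k) (h' : Z'.Tame a b sL sR k') {p q : Plane}
    (hp : p ≠ 0) (hpq : ∀ i, SignType.sign (p i) = SignType.sign (q i)) (i : Fin 2) :
    p ∈ Z.crossing i ↔ q ∈ Z'.crossing i := by
  have e : ∀ i, p i = 0 ↔ q i = 0 := fun i => by rw [← sign_eq_zero_iff, hpq, sign_eq_zero_iff]
  have e1 : ∀ i, 0 < p i ↔ 0 < q i := fun i => by rw [← sign_eq_one_iff, hpq, sign_eq_one_iff]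
  have e2 : ∀ i, p i < 0 ↔ q i < 0 := fun i => by
    rw [← sign_eq_neg_one_iff, hpq, sign_eq_neg_one_iff]
  have hq : q ≠ 0 := fun hq => hp (plane_eq_zero ((e 0).2 (by simp [hq])) ((e 1).2 (by simp [hq])))
  fin_cases i
  · refine h.mem_crossing_zero.trans (Iff.trans ?_ h'.mem_crossing_zero.symm)
    rw [e]
  · refine (h.mem_crossing_one hp).trans (Iff.trans ?_ (h'.mem_crossing_one hq).symm)
    rw [e, e1, e2]

end Tame

end PiecewiseField

/-! ### Admissible curves -/

/-- `f` is strictly increasing at `t`, relative to `I`. -/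
def StrictIncAt (I : Set ℝ) (f : ℝ → ℝ) (t : ℝ) : Prop :=
  ∀ᶠ s in 𝓝[I] t, (s < t → f s < f t) ∧ (t < s → f t < f s)

theorem StrictIncAt.of_hasDerivWithinAt {I : Set ℝ} {f : ℝ → ℝ} {f' t : ℝ}
    (h : HasDerivWithinAt f f' I t) (hf' : 0 < f') : StrictIncAt I f t := by
  have h1 := (hasDerivWithinAt_iff_tendsto_slope.1 h).eventually (lt_mem_nhds hf')
  rw [eventually_nhdsWithin_iff] at h1
  rw [StrictIncAt, eventually_nhdsWithin_iff]
  filter_upwards [h1] with s hs hsI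
  constructor
  · intro hlt
    have := hs ⟨hsI, hlt.ne⟩
    rw [slope_def_field] at this
    have h2 := (div_pos_iff.1 this).resolve_left (fun hc => by linarith [hc.2])
    linarith [h2.1]
  · intro hlt
    have := hs ⟨hsI, hlt.ne'⟩
    rw [slope_def_field] at this
    have h2 := (div_pos_iff.1 this).resolve_right (fun hc => by linarith [hc.2])
    linarith [h2.1]

/-- Strict increase is inherited by `F` if near `t` the values of `F` depend on those of `f` in a
strictly increasing way. -/
theorem StrictIncAt.of_imp {I : Set ℝ} {f F : ℝ → ℝ} {t : ℝ} (h : StrictIncAt I f t)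
    (hF : ∀ᶠ s in 𝓝[I] t, (f s < f t → F s < F t) ∧ (f t < f s → F t < F s)) :
    StrictIncAt I F t := by
  filter_upwards [h, hF] with s h1 h2 using ⟨fun hs => h2.1 (h1.1 hs), fun hs => h2.2 (h1.2 hs)⟩

namespace PiecewiseField

/-- The direction in which a tame field slides along `Σ_i`. -/
def slideDir (b : ℝ) (i : Fin 2) : ℝ := if i = 0 then b else 1

/-- The laws of motion of a tame field without reference to speed: in the two regions the height of
the orbit is locally constant and the curve moves in the right direction, on sliding points it moves
in the right direction along the axis. -/
inductive AdmissibleAt (Z : PiecewiseField) (a b : ℝ) (I : Set ℝ) (c : ℝ → Plane) (t : ℝ) : Prop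
  | pos (h : c t ∈ regionPos)
      (hP : ∀ᶠ s in 𝓝[I] t, orbitHeight Z.X (c s) = orbitHeight Z.X (c t))
      (hm : StrictIncAt I (fun s => c s 0) t) : AdmissibleAt Z a b I c t
  | neg (h : c t ∈ regionNeg)
      (hP : ∀ᶠ s in 𝓝[I] t, orbitHeight Z.Y (c s) = orbitHeight Z.Y (c t))
      (hm : StrictIncAt I (fun s => a * c s 0) t) : AdmissibleAt Z a b I c t
  | slide (i : Fin 2) (h : c t ∈ Z.slidEsc i) (hi : ∀ᶠ s in 𝓝[I] t, c s ∈ axis i)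
      (hm : StrictIncAt I (fun s => slideDir b i * c s (i + 1)) t) : AdmissibleAt Z a b I c t
  | cross (i : Fin 2) (h : c t ∈ Z.crossing i) (h0 : c t ≠ 0)
      (hi : ∀ᶠ s in 𝓝[I \ {t}] t, c s ∉ switching) : AdmissibleAt Z a b I c t
  | origin_pos (h : c t = 0) (hA : Z.AllCrossing)
      (hP : ∀ᶠ s in 𝓝[I] t, c s ∈ insert 0 regionPos ∧ orbitHeight Z.X (c s) = 0)
      (hm : StrictIncAt I (fun s => c s 0) t) : AdmissibleAt Z a b I c t
  | origin_neg (h : c t = 0) (hA : Z.AllCrossing)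
      (hP : ∀ᶠ s in 𝓝[I] t, c s ∈ insert 0 regionNeg ∧ orbitHeight Z.Y (c s) = 0)
      (hm : StrictIncAt I (fun s => a * c s 0) t) : AdmissibleAt Z a b I c t
  | origin_slide (i : Fin 2) (h : c t = 0) (hs : Z.SlidesThroughOrigin i)
      (hi : ∀ᶠ s in 𝓝[I] t, c s ∈ insert 0 (Z.slidEsc i))
      (hm : StrictIncAt I (fun s => slideDir b i * c s (i + 1)) t) : AdmissibleAt Z a b I c t
  | origin_rest (h : ∀ s ∈ I, c s = 0) (hA : ¬ Z.AllCrossing)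
      (hs : ∀ i, ¬ Z.SlidesThroughOrigin i) : AdmissibleAt Z a b I c t

theorem hasDerivWithinAt_coord {I : Set ℝ} {c : ℝ → Plane} {v : Plane} {t : ℝ}
    (h : HasDerivWithinAt c v I t) (i : Fin 2) : HasDerivWithinAt (fun s => c s i) (v i) I t :=
  (EuclideanSpace.proj i : Plane →L[ℝ] ℝ).hasFDerivAt.comp_hasDerivWithinAt t h

theorem orbitHeight_zero {V : Plane → Plane} (hV : SlopeField (slope V)) : orbitHeight V 0 = 0 :=
  hV.height_zero 0

/-- An orbit of `V` keeps its height: as a graph over `x₁` it solves the scalar equation. -/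
theorem orbitHeight_eq_of_isIntegral {V : Plane → Plane} (hV : SlopeField (slope V))
    (hV0 : ∀ p, V p 0 ≠ 0) {M : ℝ} (hM : ∀ p, ‖V p‖ ≤ M) {I : Set ℝ} (hI : I.OrdConnected)
    {c : ℝ → Plane} (hc : ∀ t ∈ I, HasDerivWithinAt c (V (c t)) I t) {s t : ℝ} (hs : s ∈ I)
    (ht : t ∈ I) : orbitHeight V (c s) = orbitHeight V (c t) := by
  wlog hst : s ≤ t generalizing s t
  · exact (this ht hs (le_of_not_ge hst)).symm
  obtain ⟨K, hK⟩ := hV.lip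
  have hsub : Icc s t ⊆ I := hI.out hs ht
  set y₀ := orbitHeight V (c s)
  have hright : ∀ {u : ℝ} {f : ℝ → ℝ} {f' : ℝ}, u ∈ Ico s t → HasDerivWithinAt f f' I u →
      HasDerivWithinAt f f' (Ici u) u := by
    intro u f f' hu h
    refine (h.mono (?_ : Ico u t ⊆ I)).mono_of_mem_nhdsWithin (Ico_mem_nhdsGE hu.2)
    exact fun x hx => hsub ⟨hu.1.trans hx.1, hx.2.le⟩
  have hd0 := fun u hu => hasDerivWithinAt_coord (hc u hu) 0
  have hd1 := fun u hu => hasDerivWithinAt_coord (hc u hu) 1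
  have hg : ∀ u ∈ I, HasDerivWithinAt (fun u => SlopeField.flow (slope V) (c u 0) y₀)
      (slope V (c u 0) (SlopeField.flow (slope V) (c u 0) y₀) * V (c u) 0) I u := fun u hu =>
    (hV.hasDerivAt_flow (c u 0) y₀).comp_hasDerivWithinAt u (hd0 u hu)
  have hM0 : 0 ≤ M := (norm_nonneg _).trans (hM 0)
  have key := ODE_solution_unique_of_mem_Icc_right (a := s) (b := t)
    (v := fun u z => slope V (c u 0) z * V (c u) 0) (s := fun _ => univ) (K := K * M.toNNReal)
    (f := fun u => c u 1) (g := fun u => SlopeField.flow (slope V) (c u 0) y₀)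
    (fun u _ => LipschitzWith.lipschitzOnWith <| LipschitzWith.of_dist_le_mul fun z w => by
      rw [Real.dist_eq, ← sub_mul, abs_mul, NNReal.coe_mul, Real.coe_toNNReal _ hM0, mul_right_comm]
      refine mul_le_mul ?_ ?_ (abs_nonneg _) (mul_nonneg K.2 dist_nonneg)
      · exact (hK (c u 0)).dist_le_mul z w
      · exact (PiLp.norm_apply_le (V (c u)) 0).trans (hM _))
    (fun u hu => ((hd1 u (hsub hu)).continuousWithinAt.mono hsub))
    (fun u hu => by
      have := hright hu (hd1 u (hsub (Ico_subset_Icc_self hu)))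
      rwa [slope_apply, div_mul_cancel₀ _ (hV0 _)])
    (fun _ _ => trivial)
    (fun u hu => (hg u (hsub hu)).continuousWithinAt.mono hsub)
    (fun u hu => hright hu (hg u (hsub (Ico_subset_Icc_self hu))))
    (fun _ _ => trivial) (hV.flow_height _ _).symm
  have h2 : c t 1 = SlopeField.flow (slope V) (c t 0) y₀ := key ⟨hst, le_rfl⟩
  rw [orbitHeight, h2, hV.height_flow]

theorem slideDir_mul_pos {k b : ℝ} {v : Plane} {i : Fin 2} (hk : 0 < k) (hv : v i = 0)
    (h : 0 < clock k b v) : 0 < slideDir b i * v (i + 1) := by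
  fin_cases i
  · have h0 : v 0 = 0 := hv
    change 0 < b * v 1
    simpa [clock, h0] using h
  · have h0 : v 1 = 0 := hv
    change 0 < 1 * v 0
    rw [one_mul]
    exact (mul_pos_iff_of_pos_left hk).1 (by simpa [clock, h0] using h)

theorem eventually_orbitHeight_eq {V : Plane → Plane} (hV : SlopeField (slope V))
    (hV0 : ∀ p, V p 0 ≠ 0) {M : ℝ} (hM : ∀ p, ‖V p‖ ≤ M) {I : Set ℝ} (hI : I.OrdConnected)
    {c : ℝ → Plane} {t : ℝ} (ht : t ∈ I)
    (hc : ∀ᶠ s in 𝓝[I] t, HasDerivWithinAt c (V (c s)) I s) :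
    ∀ᶠ s in 𝓝[I] t, orbitHeight V (c s) = orbitHeight V (c t) := by
  rw [eventually_nhdsWithin_iff, Metric.eventually_nhds_iff] at hc
  obtain ⟨ε, hε, hc⟩ := hc
  have hJ : (I ∩ Metric.ball t ε).OrdConnected :=
    hI.inter (by rw [Real.ball_eq_Ioo]; exact ordConnected_Ioo)
  filter_upwards [inter_mem_nhdsWithin I (Metric.ball_mem_nhds t hε)] with s hs
  exact orbitHeight_eq_of_isIntegral hV hV0 hM hJ
    (fun u hu => (hc hu.2 hu.1).mono inter_subset_left) hs ⟨ht, Metric.mem_ball_self hε⟩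

namespace Tame

variable {Z Z' : PiecewiseField} {a b sL sR k k' : ℝ}

theorem slopeX (h : Z.Tame a b sL sR k) : SlopeField (slope Z.X) := h.pair.fR.toSlopeField

theorem slopeY (h : Z.Tame a b sL sR k) : SlopeField (slope Z.Y) := h.pair.gR.toSlopeField

theorem not_tangencyLaw (h : Z.Tame a b sL sR k) {I : Set ℝ} {c : ℝ → Plane} {t : ℝ} :
    ¬ Z.TangencyLaw I c t := by
  rintro ⟨h0, ⟨i, hi, hm⟩, -⟩
  exact h.mul_ne_zero_of_mem_axis h0 hi hm

theorem hasDerivWithinAt_of_mem_regionPos (h : Z.Tame a b sL sR k) {I : Set ℝ} {c : ℝ → Plane}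
    {t : ℝ} (ht : Z.OrdinaryLaw I c t ∨ Z.TangencyLaw I c t ∨ Z.OriginLaw I c t)
    (hp : c t ∈ regionPos) : HasDerivWithinAt c (Z.X (c t)) I t := by
  have hsw : c t ∉ switching := fun hc => (ne_of_gt hp) hc
  rcases ht with ⟨-, h1 | h1 | ⟨i, h1, -⟩ | ⟨i, h1, -⟩⟩ | h1 | h1
  · exact h1.2
  · exact absurd hp (fun hp => lt_asymm (show (0 : ℝ) < _ from hp) h1.1)
  · exact absurd (mem_axis_switching (mem_slidEsc.1 h1).1) hsw
  · exact absurd (mem_axis_switching h1.1) hsw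
  · exact absurd h1 h.not_tangencyLaw
  · exact absurd (by rw [h1.1, mem_switching]; exact Or.inl rfl) hsw

theorem hasDerivWithinAt_of_mem_regionNeg (h : Z.Tame a b sL sR k) {I : Set ℝ} {c : ℝ → Plane}
    {t : ℝ} (ht : Z.OrdinaryLaw I c t ∨ Z.TangencyLaw I c t ∨ Z.OriginLaw I c t)
    (hp : c t ∈ regionNeg) : HasDerivWithinAt c (Z.Y (c t)) I t := by
  have hsw : c t ∉ switching := fun hc => (ne_of_lt hp) hc
  rcases ht with ⟨-, h1 | h1 | ⟨i, h1, -⟩ | ⟨i, h1, -⟩⟩ | h1 | h1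
  · exact absurd hp (fun hp => lt_asymm (show _ < (0 : ℝ) from hp) h1.1)
  · exact h1.2
  · exact absurd (mem_axis_switching (mem_slidEsc.1 h1).1) hsw
  · exact absurd (mem_axis_switching h1.1) hsw
  · exact absurd h1 h.not_tangencyLaw
  · exact absurd (by rw [h1.1, mem_switching]; exact Or.inl rfl) hsw

theorem clock_slide_pos (h : Z.Tame a b sL sR k) {i : Fin 2} {p : Plane} (hp : p ∈ Z.slidEsc i) :
    0 < clock k b (Z.slidingField i p) := by
  have h1 := (mem_slidEsc.1 hp).2.2
  refine clock_slidingField_pos (h.clock_X_pos p) (h.clock_Y_pos p) h1.le fun he => ?_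
  rw [he] at h1
  exact absurd h1 (not_lt.2 (mul_self_nonneg _))

theorem clock_slide_zero_pos (h : Z.Tame a b sL sR k) {i : Fin 2} (hs : Z.SlidesThroughOrigin i) :
    0 < clock k b (Z.slidingField i 0) :=
  clock_slidingField_pos (h.clock_X_pos 0) (h.clock_Y_pos 0) (h.mul_nonpos_of_mem_closure hs.1)
    hs.2.2.2

/-- Trajectories are admissible curves. -/
theorem admissibleAt (h : Z.Tame a b sL sR k) {I : Set ℝ} {c : ℝ → Plane}
    (hc : Z.IsTrajectory I c) {t : ℝ} (ht : t ∈ I) : Z.AdmissibleAt a b I c t := by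
  obtain ⟨hI, hcont, hlaw⟩ := hc
  obtain ⟨M, hM⟩ := h.bdd
  have hX := fun {t : ℝ} => eventually_orbitHeight_eq h.slopeX (fun p => (h.X_zero p).ne')
    (fun p => (hM p).1) hI (c := c) (t := t)
  have hY := fun {t : ℝ} => eventually_orbitHeight_eq h.slopeY (fun p => h.Y_zero_ne p)
    (fun p => (hM p).2) hI (c := c) (t := t)
  rcases hlaw t ht with ⟨h0, h1 | h1 | ⟨i, h1, h2, h3⟩ | ⟨i, h1, h2⟩⟩ | h1 | ⟨h0, h1⟩
  · refine .pos h1.1 (hX ht ?_) (.of_hasDerivWithinAt (hasDerivWithinAt_coord h1.2 0) (h.X_zero _))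
    filter_upwards [hcont t ht (isOpen_regionPos.mem_nhds h1.1), self_mem_nhdsWithin] with s hs hsI
    exact h.hasDerivWithinAt_of_mem_regionPos (hlaw s hsI) hs
  · refine .neg h1.1 (hY ht ?_) (.of_hasDerivWithinAt
      ((hasDerivWithinAt_coord h1.2 0).const_mul a) (h.Y_zero _))
    filter_upwards [hcont t ht (isOpen_regionNeg.mem_nhds h1.1), self_mem_nhdsWithin] with s hs hsI
    exact h.hasDerivWithinAt_of_mem_regionNeg (hlaw s hsI) hs
  · exact .slide i h1 h2 (.of_hasDerivWithinAt
      ((hasDerivWithinAt_coord h3 (i + 1)).const_mul (slideDir b i))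
      (slideDir_mul_pos h.k_pos (slidingField_self Z i _) (h.clock_slide_pos h1)))
  · exact .cross i h1 h0 h2
  · exact absurd h1 h.not_tangencyLaw
  · rcases h1 with ⟨hA, h1 | h1⟩ | ⟨hA, i, hs, h1, h2⟩ | ⟨hA, hs, h1⟩
    · refine .origin_pos h0 hA ?_ (.of_hasDerivWithinAt
        (hasDerivWithinAt_coord (h1.self_of_nhdsWithin ht).2 0) (h.X_zero _))
      have e := hX ht (h1.mono fun s hs => hs.2)
      rw [h0, orbitHeight_zero h.slopeX] at e
      exact (h1.mono fun s hs => hs.1).and e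
    · refine .origin_neg h0 hA ?_ (.of_hasDerivWithinAt
        ((hasDerivWithinAt_coord (h1.self_of_nhdsWithin ht).2 0).const_mul a) (h.Y_zero _))
      have e := hY ht (h1.mono fun s hs => hs.2)
      rw [h0, orbitHeight_zero h.slopeY] at e
      exact (h1.mono fun s hs => hs.1).and e
    · exact .origin_slide i h0 hs h1 (.of_hasDerivWithinAt
        ((hasDerivWithinAt_coord h2 (i + 1)).const_mul (slideDir b i))
        (slideDir_mul_pos h.k_pos (slidingField_self Z i _) (h.clock_slide_zero_pos hs)))
    · exact .origin_rest h1 hA hs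

end Tame

end PiecewiseField

namespace PiecewiseField

namespace Tame

variable {Z Z' : PiecewiseField} {a b sL sR k k' : ℝ}

/-- The homeomorphism given by a matching maps admissible curves to admissible curves. -/
theorem admissibleAt_map (h : Z.Tame a b sL sR k) (h' : Z'.Tame a b sL sR k')
    (M : SlopeField.Matching (slope Z.X) (slope Z.Y) (slope Z'.X) (slope Z'.Y)) {I : Set ℝ}
    {c : ℝ → Plane} (hc : ContinuousOn c I) {t : ℝ} (ht : t ∈ I)
    (had : Z.AdmissibleAt a b I c t) : Z'.AdmissibleAt a b I (fun s => M.map (c s)) t := by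
  have hX := h.slopeX
  have hY := h.slopeY
  have hX' := h'.slopeX
  have hY' := h'.slopeY
  have hsign := M.sign_map hX hY hX' hY'
  have epos : ∀ p i, 0 < M.map p i ↔ 0 < p i := fun p i => by
    rw [← sign_eq_one_iff, hsign, sign_eq_one_iff]
  have eneg : ∀ p i, M.map p i < 0 ↔ p i < 0 := fun p i => by
    rw [← sign_eq_neg_one_iff, hsign, sign_eq_neg_one_iff]
  have ezero : ∀ p i, M.map p i = 0 ↔ p i = 0 := fun p i => by
    rw [← sign_eq_zero_iff, hsign, sign_eq_zero_iff]
  have hpos : ∀ p, M.map p ∈ regionPos ↔ p ∈ regionPos := fun p => by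
    simp only [mem_regionPos, epos, eneg]
  have hneg : ∀ p, M.map p ∈ regionNeg ↔ p ∈ regionNeg := fun p => by
    simp only [mem_regionNeg, epos, eneg]
  have hz : ∀ p, M.map p = 0 ↔ p = 0 := fun p =>
    ⟨fun hp => plane_eq_zero ((ezero p 0).1 (by simp [hp])) ((ezero p 1).1 (by simp [hp])),
      fun hp => plane_eq_zero ((ezero p 0).2 (by simp [hp])) ((ezero p 1).2 (by simp [hp]))⟩
  have hax : ∀ p i, M.map p ∈ axis i ↔ p ∈ axis i := fun p i => ezero p i
  have hsw : ∀ p, M.map p ∈ switching ↔ p ∈ switching := fun p => by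
    rw [mem_switching, mem_switching, ezero, ezero]
  have hsl : ∀ p i, M.map p ∈ Z'.slidEsc i ↔ p ∈ Z.slidEsc i := fun p i =>
    (h.mem_slidEsc_congr h' (fun i => (hsign p i).symm) i).symm
  have hslz : ∀ p i, M.map p ∈ insert 0 (Z'.slidEsc i) ↔ p ∈ insert 0 (Z.slidEsc i) :=
    fun p i => by rw [mem_insert_iff, mem_insert_iff, hz, hsl]
  have hA : Z.AllCrossing ↔ Z'.AllCrossing := by rw [h.allCrossing_iff, h'.allCrossing_iff]
  have hmx : StrictIncAt I (fun s => c s 0) t → StrictIncAt I (fun s => M.map (c s) 0) t :=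
    fun hm => hm.of_imp (Eventually.of_forall fun s =>
      ⟨fun hs => M.σ.strictMono hs, fun hs => M.σ.strictMono hs⟩)
  have hmax : StrictIncAt I (fun s => a * c s 0) t →
      StrictIncAt I (fun s => a * M.map (c s) 0) t := by
    refine fun hm => hm.of_imp (Eventually.of_forall fun s => ?_)
    rcases h.a_cases with rfl | rfl
    · simp only [one_mul]
      exact ⟨fun hs => M.σ.strictMono hs, fun hs => M.σ.strictMono hs⟩
    · simp only [neg_one_mul, neg_lt_neg_iff]
      exact ⟨fun hs => M.σ.strictMono hs, fun hs => M.σ.strictMono hs⟩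
  have hsnd : StrictMono (M.snd 0) := by
    intro y z hyz
    -- over the vertical axis the map is `κ₁` above and `κ₄` below
    have e : ∀ y, M.snd 0 y = if 0 ≤ y then M.κ₁ y else M.κ₄ y := by
      intro y
      simp only [SlopeField.Matching.snd, le_refl, if_true]
      rw [SlopeField.transfer_zero_left hX hX' M.σ_zero, SlopeField.transfer_zero_left hY hY' M.σ_zero]
    rw [e, e]
    split_ifs with h1 h2 h2
    · exact M.κ₁.strictMono hyz
    · linarith
    · have h3 := M.κ₄.strictMono (lt_of_not_ge h1)
      have h4 := M.κ₁.monotone h2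
      rw [M.κ_zero.2.2.2] at h3
      rw [M.κ_zero.1] at h4
      exact h3.trans_le h4
    · exact M.κ₄.strictMono hyz
  have hslide : ∀ i, (∀ᶠ s in 𝓝[I] t, c s ∈ axis i) →
      StrictIncAt I (fun s => slideDir b i * c s (i + 1)) t →
      StrictIncAt I (fun s => slideDir b i * M.map (c s) (i + 1)) t := by
    intro i hi hm
    have hti := hi.self_of_nhdsWithin ht
    fin_cases i
    · refine hm.of_imp (hi.mono fun s hs => ?_)
      have e1 : M.map (c s) 1 = M.snd 0 (c s 1) := by
        rw [M.map_one_coord]; exact congrArg (fun x => M.snd x _) hs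
      have e2 : M.map (c t) 1 = M.snd 0 (c t 1) := by
        rw [M.map_one_coord]; exact congrArg (fun x => M.snd x _) hti
      change (b * c s 1 < b * c t 1 → b * M.map (c s) 1 < b * M.map (c t) 1) ∧
        (b * c t 1 < b * c s 1 → b * M.map (c t) 1 < b * M.map (c s) 1)
      rw [e1, e2]
      rcases h.b_cases with rfl | rfl
      · simp only [one_mul, hsnd.lt_iff_lt, imp_self, and_self]
      · simp only [neg_one_mul, neg_lt_neg_iff, hsnd.lt_iff_lt, imp_self, and_self]
    · refine hm.of_imp (Eventually.of_forall fun s => ?_)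
      change (1 * c s 0 < 1 * c t 0 → 1 * M.σ (c s 0) < 1 * M.σ (c t 0)) ∧
        (1 * c t 0 < 1 * c s 0 → 1 * M.σ (c t 0) < 1 * M.σ (c s 0))
      simp only [one_mul, M.σ.lt_iff_lt, imp_self, and_self]
  have hcoord : ∀ i : Fin 2, ContinuousWithinAt (fun s => c s i) I t := fun i =>
    (by fun_prop : Continuous fun p : Plane => p i).continuousAt.comp_continuousWithinAt (hc t ht)
  cases had with
  | pos h1 hP hm =>
    refine .pos ((hpos _).2 h1) ?_ (hmx hm)
    rcases mem_regionPos.1 h1 with ⟨u, v⟩ | ⟨u, v⟩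
    · filter_upwards [hP, (hcoord 0).eventually (lt_mem_nhds u),
        (hcoord 1).eventually (lt_mem_nhds v)] with s e u' v'
      rw [orbitHeight, orbitHeight, M.height_map_up_right hX' u v, M.height_map_up_right hX' u' v']
      exact congrArg M.κ₁ e
    · filter_upwards [hP, (hcoord 0).eventually (gt_mem_nhds u),
        (hcoord 1).eventually (gt_mem_nhds v)] with s e u' v'
      rw [orbitHeight, orbitHeight, M.height_map_down_left hX' u v,
        M.height_map_down_left hX' u' v']
      exact congrArg M.κ₃ e
  | neg h1 hP hm =>
    refine .neg ((hneg _).2 h1) ?_ (hmax hm)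
    rcases mem_regionNeg.1 h1 with ⟨u, v⟩ | ⟨u, v⟩
    · filter_upwards [hP, (hcoord 0).eventually (lt_mem_nhds u),
        (hcoord 1).eventually (gt_mem_nhds v)] with s e u' v'
      rw [orbitHeight, orbitHeight, M.height_map_down_right hY' u v,
        M.height_map_down_right hY' u' v']
      exact congrArg M.κ₄ e
    · filter_upwards [hP, (hcoord 0).eventually (gt_mem_nhds u),
        (hcoord 1).eventually (lt_mem_nhds v)] with s e u' v'
      rw [orbitHeight, orbitHeight, M.height_map_up_left hY' u v, M.height_map_up_left hY' u' v']
      exact congrArg M.κ₂ e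
  | slide i h1 hi hm =>
    exact .slide i ((hsl _ i).2 h1) (hi.mono fun s hs => (hax _ i).2 hs) (hslide i hi hm)
  | cross i h1 h0 hi =>
    exact .cross i ((h.mem_crossing_congr h' h0 (fun i => (hsign _ i).symm) i).1 h1)
      (fun hc => h0 ((hz _).1 hc)) (hi.mono fun s hs hc => hs ((hsw _).1 hc))
  | origin_pos h0 h1 hP hm =>
    refine .origin_pos ((hz _).2 h0) (hA.1 h1) (hP.mono fun s hs => ?_) (hmx hm)
    rcases hs with ⟨hs | hs, e⟩
    · have : M.map (c s) = 0 := (hz _).2 hs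
      rw [this]
      exact ⟨mem_insert _ _, orbitHeight_zero hX'⟩
    · refine ⟨Or.inr ((hpos _).2 hs), ?_⟩
      rcases mem_regionPos.1 hs with ⟨u, v⟩ | ⟨u, v⟩
      · rw [orbitHeight, M.height_map_up_right hX' u v]
        exact (congrArg M.κ₁ e).trans M.κ_zero.1
      · rw [orbitHeight, M.height_map_down_left hX' u v]
        exact (congrArg M.κ₃ e).trans M.κ_zero.2.2.1
  | origin_neg h0 h1 hP hm =>
    refine .origin_neg ((hz _).2 h0) (hA.1 h1) (hP.mono fun s hs => ?_) (hmax hm)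
    rcases hs with ⟨hs | hs, e⟩
    · have : M.map (c s) = 0 := (hz _).2 hs
      rw [this]
      exact ⟨mem_insert _ _, orbitHeight_zero hY'⟩
    · refine ⟨Or.inr ((hneg _).2 hs), ?_⟩
      rcases mem_regionNeg.1 hs with ⟨u, v⟩ | ⟨u, v⟩
      · rw [orbitHeight, M.height_map_down_right hY' u v]
        exact (congrArg M.κ₄ e).trans M.κ_zero.2.2.2
      · rw [orbitHeight, M.height_map_up_left hY' u v]
        exact (congrArg M.κ₂ e).trans M.κ_zero.2.1
  | origin_slide i h0 hs hi hm =>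
    refine .origin_slide i ((hz _).2 h0) ((h.slidesThroughOrigin_iff h' i).1 hs)
      (hi.mono fun s hs => (hslz _ i).2 hs) (hslide i (hi.mono fun s hs => ?_) hm)
    rcases hs with hs | hs
    · rw [hs]; rfl
    · exact (mem_slidEsc.1 hs).1
  | origin_rest h0 h1 hs =>
    exact .origin_rest (fun s hs => (hz _).2 (h0 s hs)) (fun hc => h1 (hA.2 hc))
      fun i hi => hs i ((h.slidesThroughOrigin_iff h' i).2 hi)

end Tame

end PiecewiseField

/-! ### Changes of time -/

theorem StrictIncAt.mono {I J : Set ℝ} {f : ℝ → ℝ} {t : ℝ} (h : StrictIncAt I f t) (hJ : J ⊆ I) :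
    StrictIncAt J f t := h.filter_mono (nhdsWithin_mono t hJ)

theorem strictMonoOn_of_strictIncAt {I : Set ℝ} (hI : I.OrdConnected) {f : ℝ → ℝ}
    (hf : ContinuousOn f I) (h : ∀ t ∈ I, StrictIncAt I f t) : StrictMonoOn f I := by
  have hweak : ∀ x ∈ I, ∀ y ∈ I, x ≤ y → f x ≤ f y := by
    intro x hx y hy hxy
    have hsub : Icc x y ⊆ I := hI.out hx hy
    have hcl : IsClosed ({s | f x ≤ f s} ∩ Icc x y) := by
      have := (hf.mono hsub).preimage_isClosed_of_isClosed isClosed_Icc (isClosed_Ici (a := f x))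
      rwa [inter_comm] at this
    refine hcl.Icc_subset_of_forall_exists_gt (le_refl (f x)) ?_ ⟨hxy, le_rfl⟩
    rintro s ⟨hs, hs'⟩ z hz
    have hs1 : f x ≤ f s := hs
    have hsz : s < min z y := lt_min hz hs'.2
    have h1 : ∀ᶠ u in 𝓝[>] s, f s < f u := by
      have h2 : 𝓝[>] s ≤ 𝓝[I] s := by
        have : Ioc s y ⊆ I := fun u hu => hsub ⟨hs'.1.trans hu.1.le, hu.2⟩
        rw [← nhdsWithin_Ioc_eq_nhdsGT hs'.2]
        exact nhdsWithin_mono s this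
      filter_upwards [h2 (h s (hsub ⟨hs'.1, hs'.2.le⟩)), self_mem_nhdsWithin] with u hu hus
      exact hu.2 hus
    obtain ⟨u, hu1, hu2⟩ := (h1.and (Ioc_mem_nhdsGT hsz)).exists
    exact ⟨u, hs1.trans hu1.le, hu2.1, hu2.2.trans (min_le_left _ _)⟩
  intro x hx y hy hxy
  have hsub : Icc x y ⊆ I := hI.out hx hy
  have h2 : 𝓝[>] x ≤ 𝓝[I] x := by
    rw [← nhdsWithin_Ioc_eq_nhdsGT hxy]
    exact nhdsWithin_mono x (Ioc_subset_Icc_self.trans hsub)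
  have h3 : ∀ᶠ u in 𝓝[>] x, (u < x → f u < f x) ∧ (x < u → f x < f u) := h2 (h x hx)
  obtain ⟨u, hu1, hu2⟩ := (h3.and (Ioc_mem_nhdsGT hxy)).exists
  exact (hu1.2 hu2.1).trans_le (hweak u (hsub ⟨hu2.1.le, hu2.2⟩) y hy hu2.2)

/-- Strict increase extends to an exceptional point by continuity. -/
theorem StrictIncAt.of_punctured {I : Set ℝ} (hI : I.OrdConnected) {f : ℝ → ℝ}
    (hf : ContinuousOn f I) {t : ℝ} (ht : t ∈ I)
    (h : ∀ᶠ s in 𝓝[I \ {t}] t, StrictIncAt I f s) : StrictIncAt I f t := by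
  rw [eventually_nhdsWithin_iff, Metric.eventually_nhds_iff] at h
  obtain ⟨ε, hε, h⟩ := h
  filter_upwards [inter_mem_nhdsWithin I (Metric.ball_mem_nhds t hε)] with s hs
  have hdist : |s - t| < ε := hs.2
  have hmid : ∀ u v, u ∈ I → v ∈ I → t ∉ Ioo u v → |u - t| < ε → |v - t| < ε →
      StrictMonoOn f (Ioo u v) := by
    intro u v hu hv htn hue hve
    have hsub : Ioo u v ⊆ I := Ioo_subset_Icc_self.trans (hI.out hu hv)
    refine strictMonoOn_of_strictIncAt ordConnected_Ioo (hf.mono hsub) fun r hr =>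
      (h ?_ ⟨hsub hr, fun hc => htn (hc ▸ hr)⟩).mono hsub
    rw [abs_lt] at hue hve
    rw [Real.dist_eq, abs_lt]
    constructor <;> linarith [hr.1, hr.2]
  -- a continuous function that increases on an open interval increases on its closure
  have hend : ∀ u v, u ∈ I → v ∈ I → u < v → StrictMonoOn f (Ioo u v) → f u < f v := by
    intro u v hu hv huv hm
    have hsub : Icc u v ⊆ I := hI.out hu hv
    have h1 : f u ≤ f ((2 * u + v) / 3) := by
      have hc : Tendsto f (𝓝[>] u) (𝓝 (f u)) := by
        rw [← nhdsWithin_Ioc_eq_nhdsGT huv]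
        exact (hf u hu).mono (Ioc_subset_Icc_self.trans hsub)
      refine le_of_tendsto hc ?_
      filter_upwards [Ioo_mem_nhdsGT (show u < (2 * u + v) / 3 by linarith)] with r hr
      exact (hm ⟨hr.1, by linarith [hr.2]⟩ ⟨by linarith, by linarith⟩ hr.2).le
    have h2 : f ((u + 2 * v) / 3) ≤ f v := by
      have hc : Tendsto f (𝓝[<] v) (𝓝 (f v)) := by
        rw [← nhdsWithin_Ico_eq_nhdsLT huv]
        exact (hf v hv).mono (Ico_subset_Icc_self.trans hsub)
      refine ge_of_tendsto hc ?_
      filter_upwards [Ioo_mem_nhdsLT (show (u + 2 * v) / 3 < v by linarith)] with r hr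
      exact (hm ⟨by linarith, by linarith⟩ ⟨by linarith [hr.1], hr.2⟩ hr.1).le
    have h3 : f ((2 * u + v) / 3) < f ((u + 2 * v) / 3) :=
      hm ⟨by linarith, by linarith⟩ ⟨by linarith, by linarith⟩ (by linarith)
    linarith
  have ht0 : |t - t| < ε := by simpa using hε
  exact ⟨fun hst => hend s t hs.1 ht hst (hmid s t hs.1 ht (fun hc => lt_irrefl _ hc.2) hdist ht0),
    fun hst => hend t s ht hs.1 hst (hmid t s ht hs.1 (fun hc => lt_irrefl _ hc.1) ht0 hdist)⟩

theorem exists_inverse_of_strictMonoOn {I : Set ℝ} (hI : I.OrdConnected) {f : ℝ → ℝ}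
    (hf : ContinuousOn f I) (hm : StrictMonoOn f I) :
    (f '' I).OrdConnected ∧ ∃ g : ℝ → ℝ, StrictMonoOn g (f '' I) ∧ g '' (f '' I) = I ∧
      ContinuousOn g (f '' I) ∧ (∀ t ∈ I, g (f t) = t) ∧ ∀ s ∈ f '' I, f (g s) = s := by
  have hJ : (f '' I).OrdConnected :=
    (hI.isPreconnected.image f hf).ordConnected
  refine ⟨hJ, Function.invFunOn f I, ?_⟩
  have hgf : ∀ t ∈ I, Function.invFunOn f I (f t) = t := fun t ht =>
    hm.injOn (Function.invFunOn_mem ⟨t, ht, rfl⟩) ht (Function.invFunOn_eq ⟨t, ht, rfl⟩)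
  have hfg : ∀ s ∈ f '' I, f (Function.invFunOn f I s) = s := fun s hs => Function.invFunOn_eq hs
  have hmono : StrictMonoOn (Function.invFunOn f I) (f '' I) := by
    rintro _ ⟨s, hs, rfl⟩ _ ⟨t, ht, rfl⟩ hst
    rw [hgf s hs, hgf t ht]
    exact (hm.lt_iff_lt hs ht).1 hst
  refine ⟨hmono, ?_, ?_, hgf, hfg⟩
  · ext t
    constructor
    · rintro ⟨_, ⟨s, hs, rfl⟩, rfl⟩
      rwa [hgf s hs]
    · exact fun ht => ⟨f t, ⟨t, ht, rfl⟩, hgf t ht⟩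
  · have hc := (hm.orderIso f I).symm.continuous
    rw [continuousOn_iff_continuous_domRestrict]
    refine (continuous_subtype_val.comp hc).congr fun s => ?_
    obtain ⟨t, ht⟩ := (hm.orderIso f I).surjective s
    rw [← ht]
    simp only [Function.comp, OrderIso.symm_apply_apply]
    exact (hgf t t.2).symm

/-- The derivative of an inverse function, relative to a set. -/
theorem hasDerivWithinAt_inverse {J : Set ℝ} {f g : ℝ → ℝ} {f' s : ℝ}
    (hg : ContinuousWithinAt g J s) {S : Set ℝ} (hS : MapsTo g J S)
    (hf : HasDerivWithinAt f f' S (g s)) (hf' : f' ≠ 0) (hs : s ∈ J)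
    (hfg : ∀ᶠ r in 𝓝[J] s, f (g r) = r) : HasDerivWithinAt g f'⁻¹ J s := by
  have h1 : HasFDerivWithinAt f
      (ContinuousLinearEquiv.unitsEquivAut ℝ (Units.mk0 f' hf') : ℝ →L[ℝ] ℝ) S (g s) :=
    hf.hasFDerivWithinAt
  have h2 := (h1.of_local_left_inverse (hg.tendsto_nhdsWithin hS) hs hfg).hasDerivWithinAt
  have e : ((ContinuousLinearEquiv.unitsEquivAut ℝ (Units.mk0 f' hf')).symm : ℝ →L[ℝ] ℝ) 1 =
      f'⁻¹ := by
    rw [ContinuousLinearEquiv.coe_coe, ContinuousLinearEquiv.symm_apply_eq]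
    simp [hf']
  rwa [e] at h2

/-- The primitive of a bounded positive function which is continuous, relative to an interval, at
the relevant points. -/
theorem exists_primitive {J : Set ℝ} (hJ : J.OrdConnected) {l : ℝ → ℝ} (hl : Measurable l)
    {m M : ℝ} (hm : 0 < m) (hml : ∀ s, m ≤ l s) (hlM : ∀ s, l s ≤ M) :
    ∃ θ : ℝ → ℝ, StrictMono θ ∧ Continuous θ ∧
      ∀ s ∈ J, ContinuousWithinAt l J s → HasDerivWithinAt θ (l s) J s := by
  have hint : ∀ u v, IntervalIntegrable l MeasureTheory.volume u v := by
    intro u v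
    refine (intervalIntegrable_const (c := M)).mono_fun hl.aestronglyMeasurable ?_
    refine Eventually.of_forall fun s => ?_
    simp only [Real.norm_eq_abs]
    rw [abs_of_pos (hm.trans_le (hml s))]
    exact (hlM s).trans (le_abs_self M)
  have hsub : ∀ u v, (∫ r in (0 : ℝ)..v, l r) - ∫ r in (0 : ℝ)..u, l r = ∫ r in u..v, l r :=
    fun u v => intervalIntegral.integral_interval_sub_left (hint _ _) (hint _ _)
  refine ⟨fun s => ∫ r in (0 : ℝ)..s, l r, ?_, ?_, ?_⟩
  · intro u v huv
    have h1 : ∫ r in u..v, m ≤ ∫ r in u..v, l r :=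
      intervalIntegral.integral_mono_on huv.le (by simp) (hint u v) fun s _ => hml s
    rw [intervalIntegral.integral_const, smul_eq_mul] at h1
    have h2 := mul_pos (sub_pos.2 huv) hm
    have h3 := hsub u v
    simp only
    linarith
  · exact intervalIntegral.continuous_primitive (fun u v => hint u v) 0
  · intro s hs hc
    rw [hasDerivWithinAt_iff_isLittleO, Asymptotics.isLittleO_iff]
    intro ε hε
    have h1 : ∀ᶠ r in 𝓝[J] s, |l r - l s| < ε := by
      have := hc.eventually (Metric.ball_mem_nhds (l s) hε)
      filter_upwards [this] with r hr using hr
    rw [eventually_nhdsWithin_iff, Metric.eventually_nhds_iff] at h1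
    obtain ⟨η, hη, h1⟩ := h1
    filter_upwards [inter_mem_nhdsWithin J (Metric.ball_mem_nhds s hη)] with r hr
    have e : (∫ u in (0 : ℝ)..r, l u) - (∫ u in (0 : ℝ)..s, l u) - (r - s) • l s =
        ∫ u in s..r, (l u - l s) := by
      rw [hsub, intervalIntegral.integral_sub (hint _ _) (by simp),
        intervalIntegral.integral_const]
    rw [e]
    refine intervalIntegral.norm_integral_le_of_norm_le_const fun u hu => ?_
    have huI : u ∈ uIcc s r := uIoc_subset_uIcc hu
    refine (h1 (y := u) ?_ (hJ.uIcc_subset hs hr.1 huI)).le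
    have h2 : |u - s| ≤ |r - s| := abs_sub_left_of_mem_uIcc huI
    exact lt_of_le_of_lt h2 hr.2

/-! ### Admissible curves are trajectories up to a change of time -/

theorem tendsto_reparam {I J : Set ℝ} {g : ℝ → ℝ} {r : ℝ} (hg : ContinuousWithinAt g J r)
    (hJ : MapsTo g J I) : Tendsto g (𝓝[J] r) (𝓝[I] (g r)) := hg.tendsto_nhdsWithin hJ

theorem StrictIncAt.comp {I J : Set ℝ} {f g : ℝ → ℝ} {r : ℝ} (h : StrictIncAt I f (g r))
    (hg : ContinuousWithinAt g J r) (hJ : MapsTo g J I) (hm : StrictMonoOn g J) (hr : r ∈ J) :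
    StrictIncAt J (fun s => f (g s)) r := by
  filter_upwards [(tendsto_reparam hg hJ).eventually h, self_mem_nhdsWithin] with s hs hsJ
  exact ⟨fun hlt => hs.1 (hm hsJ hr hlt), fun hlt => hs.2 (hm hr hsJ hlt)⟩

namespace PiecewiseField

theorem AdmissibleAt.comp {Z : PiecewiseField} {a b : ℝ} {I J : Set ℝ} {c : ℝ → Plane} {g : ℝ → ℝ}
    {r : ℝ} (h : Z.AdmissibleAt a b I c (g r)) (hg : ContinuousWithinAt g J r) (hJ : MapsTo g J I)
    (hm : StrictMonoOn g J) (hr : r ∈ J) : Z.AdmissibleAt a b J (fun s => c (g s)) r := by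
  have ht := tendsto_reparam hg hJ
  cases h with
  | pos h hP hi => exact .pos h (ht.eventually hP) (hi.comp hg hJ hm hr)
  | neg h hP hi => exact .neg h (ht.eventually hP) (hi.comp hg hJ hm hr)
  | slide i h hP hi => exact .slide i h (ht.eventually hP) (hi.comp hg hJ hm hr)
  | cross i h h0 hi =>
    refine .cross i h h0 (Tendsto.eventually (f := g) ?_ hi)
    have hpunct : MapsTo g (J \ {r}) (I \ {g r}) := fun s hs =>
      ⟨hJ hs.1, fun he => hs.2 (hm.injOn hs.1 hr he)⟩
    exact (hg.mono sdiff_subset).tendsto_nhdsWithin hpunct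
  | origin_pos h hA hP hi => exact .origin_pos h hA (ht.eventually hP) (hi.comp hg hJ hm hr)
  | origin_neg h hA hP hi => exact .origin_neg h hA (ht.eventually hP) (hi.comp hg hJ hm hr)
  | origin_slide i h hs hP hi =>
    exact .origin_slide i h hs (ht.eventually hP) (hi.comp hg hJ hm hr)
  | origin_rest h hA hs => exact .origin_rest (fun s hs => h _ (hJ hs)) hA hs

theorem continuous_clock (k b : ℝ) : Continuous (clock k b) := by
  unfold clock; fun_prop

section Graph

variable {V : Plane → Plane} {k b : ℝ}

/-- Along an orbit of `V`, a graph over the first coordinate, the clock has derivative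
`clock V / V₁` with respect to that coordinate. -/
theorem hasDerivAt_clock_flow (hV : SlopeField (slope V)) {p : Plane} (hV0 : V p 0 ≠ 0) :
    HasDerivAt (fun x => k * x + b * SlopeField.flow (slope V) x (orbitHeight V p))
      (clock k b (V p) / V p 0) (p 0) := by
  have h1 := ((hasDerivAt_id (p 0)).const_mul k).add
    ((hV.hasDerivAt_flow (p 0) (orbitHeight V p)).const_mul b)
  have e : k * 1 + b * slope V (p 0) (SlopeField.flow (slope V) (p 0) (orbitHeight V p)) =
      clock k b (V p) / V p 0 := by
    rw [orbitHeight, hV.flow_height, slope_apply, clock]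
    field_simp
  rw [e] at h1
  exact h1

theorem strictIncAt_clock_of_orbit (hV : SlopeField (slope V)) {σ : ℝ} (hσ : σ * σ = 1)
    {I : Set ℝ} {c : ℝ → Plane} {t : ℝ} (hc : ContinuousWithinAt c I t)
    (hV0 : 0 < σ * V (c t) 0) (hclock : 0 < clock k b (V (c t)))
    (hP : ∀ᶠ s in 𝓝[I] t, orbitHeight V (c s) = orbitHeight V (c t))
    (hm : StrictIncAt I (fun s => σ * c s 0) t) : StrictIncAt I (fun s => clock k b (c s)) t := by
  have hne : V (c t) 0 ≠ 0 := by
    intro h; rw [h, mul_zero] at hV0; exact lt_irrefl _ hV0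
  have h1 := hasDerivAt_clock_flow (k := k) (b := b) hV hne
  have e0 : σ * (σ * c t 0) = c t 0 := by rw [← mul_assoc, hσ, one_mul]
  rw [← e0] at h1
  have h2 := h1.comp (σ * c t 0) ((hasDerivAt_id (σ * c t 0)).const_mul σ)
  have hpos : 0 < clock k b (V (c t)) / V (c t) 0 * (σ * 1) := by
    have : clock k b (V (c t)) / V (c t) 0 * (σ * 1) =
        clock k b (V (c t)) * (σ * V (c t) 0) / (V (c t) 0) ^ 2 := by field_simp
    rw [this]
    positivity
  have h3 : StrictIncAt univ _ (σ * c t 0) := .of_hasDerivWithinAt h2.hasDerivWithinAt hpos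
  rw [StrictIncAt, nhdsWithin_univ] at h3
  have hc0 : ContinuousWithinAt (fun s => σ * c s 0) I t := by
    have : Continuous fun p : Plane => σ * p 0 := by fun_prop
    exact this.continuousAt.comp_continuousWithinAt hc
  refine hm.of_imp ?_
  filter_upwards [hc0.eventually h3, hP] with s hs hPs
  have e1 : ∀ r, orbitHeight V (c r) = orbitHeight V (c t) →
      k * (σ * (σ * c r 0)) + b * SlopeField.flow (slope V) (σ * (σ * c r 0)) (orbitHeight V (c t)) =
        clock k b (c r) := by
    intro r hr
    rw [← mul_assoc σ σ, hσ, one_mul, ← hr, orbitHeight, hV.flow_height, clock]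
  change (_ → k * (σ * (σ * c s 0)) + b * SlopeField.flow (slope V) (σ * (σ * c s 0)) _ <
    k * (σ * (σ * c t 0)) + b * SlopeField.flow (slope V) (σ * (σ * c t 0)) _) ∧ (_ →
    k * (σ * (σ * c t 0)) + b * SlopeField.flow (slope V) (σ * (σ * c t 0)) _ <
    k * (σ * (σ * c s 0)) + b * SlopeField.flow (slope V) (σ * (σ * c s 0)) _) at hs
  rwa [e1 s hPs, e1 t rfl] at hs

theorem hasDerivWithinAt_plane {c : ℝ → Plane} {v : Plane} {I : Set ℝ} {t : ℝ}
    (h : ∀ i, HasDerivWithinAt (fun s => c s i) (v i) I t) : HasDerivWithinAt c v I t := by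
  rw [hasDerivWithinAt_iff_hasFDerivWithinAt, hasFDerivWithinAt_euclidean]
  intro i
  refine (h i).hasFDerivWithinAt.congr_fderiv ?_
  ext
  simp

/-- A curve on an orbit of `V` which is parametrized by the clock is differentiable. -/
theorem hasDerivWithinAt_of_orbit (hV : SlopeField (slope V)) {J : Set ℝ} {c : ℝ → Plane} {t : ℝ}
    (hc : ContinuousWithinAt c J t) (ht : t ∈ J) (hV0 : V (c t) 0 ≠ 0)
    (hclock : 0 < clock k b (V (c t)))
    (hP : ∀ᶠ s in 𝓝[J] t, orbitHeight V (c s) = orbitHeight V (c t))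
    (hs : ∀ᶠ s in 𝓝[J] t, clock k b (c s) = s) :
    HasDerivWithinAt c ((clock k b (V (c t)))⁻¹ • V (c t)) J t := by
  have hc0 : ContinuousWithinAt (fun s => c s 0) J t := by
    have : Continuous fun p : Plane => p 0 := by fun_prop
    exact this.continuousAt.comp_continuousWithinAt hc
  have h0 := hasDerivWithinAt_inverse (S := univ) hc0 (mapsTo_univ _ _)
    (hasDerivAt_clock_flow (k := k) (b := b) hV hV0).hasDerivWithinAt
    (div_ne_zero hclock.ne' hV0) ht (by
      filter_upwards [hP, hs] with s h1 h2
      rw [← h1, orbitHeight, hV.flow_height, ← clock, h2])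
  have h1 := (hV.hasDerivAt_flow (c t 0) (orbitHeight V (c t))).comp_hasDerivWithinAt t h0
  have e1 : (fun s => c s 1) =ᶠ[𝓝[J] t]
      fun s => SlopeField.flow (slope V) (c s 0) (orbitHeight V (c t)) := by
    filter_upwards [hP] with s h
    rw [← h, orbitHeight, hV.flow_height]
  have h1' := h1.congr_of_eventuallyEq e1 (e1.self_of_nhdsWithin ht)
  rw [orbitHeight, hV.flow_height, slope_apply] at h1'
  refine hasDerivWithinAt_plane fun i => ?_
  fin_cases i
  · refine h0.congr_deriv ?_
    simp [div_eq_inv_mul]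
  · refine h1'.congr_deriv ?_
    simp
    field_simp

/-- A curve on an axis which is parametrized by the clock is differentiable. -/
theorem hasDerivWithinAt_of_axis {J : Set ℝ} {c : ℝ → Plane} {t : ℝ} {i : Fin 2} {v : Plane}
    (hv : v i = 0) (hclock : clock k b v ≠ 0) (ht : t ∈ J) (hi : ∀ᶠ s in 𝓝[J] t, c s ∈ axis i)
    (hs : ∀ᶠ s in 𝓝[J] t, clock k b (c s) = s) :
    HasDerivWithinAt c ((clock k b v)⁻¹ • v) J t := by
  have e : c =ᶠ[𝓝[J] t] fun s => s • ((clock k b v)⁻¹ • v) := by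
    filter_upwards [hi, hs] with s h1 h2
    have h1' : c s i = 0 := h1
    conv_rhs => rw [← h2]
    fin_cases i
    · change c s 0 = 0 at h1'
      change v 0 = 0 at hv
      have hb : b ≠ 0 ∧ v 1 ≠ 0 := by simpa [clock, hv] using hclock
      ext j
      fin_cases j
      · simp [h1', hv]
      · simp only [clock, hv, h1']
        simp
        field_simp [hb.1, hb.2]
    · change c s 1 = 0 at h1'
      change v 1 = 0 at hv
      have hb : k ≠ 0 ∧ v 0 ≠ 0 := by simpa [clock, hv] using hclock
      ext j
      fin_cases j
      · simp only [clock, hv, h1']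
        simp
        field_simp [hb.1, hb.2]
      · simp [h1', hv]
  refine HasDerivWithinAt.congr_of_eventuallyEq ?_ e (e.self_of_nhdsWithin ht)
  simpa using (hasDerivWithinAt_id t J).smul_const ((clock k b v)⁻¹ • v)

end Graph

end PiecewiseField

namespace PiecewiseField

theorem strictIncAt_clock_of_axis {k b : ℝ} (hk : 0 < k) {I : Set ℝ} {c : ℝ → Plane} {t : ℝ}
    {i : Fin 2} (ht : t ∈ I) (hi : ∀ᶠ s in 𝓝[I] t, c s ∈ axis i)
    (hm : StrictIncAt I (fun s => slideDir b i * c s (i + 1)) t) :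
    StrictIncAt I (fun s => clock k b (c s)) t := by
  have e : ∃ l > 0, ∀ p ∈ axis i, clock k b p = l * (slideDir b i * p (i + 1)) := by
    fin_cases i
    · refine ⟨1, one_pos, fun p hp => ?_⟩
      have hp : p 0 = 0 := hp
      change clock k b p = 1 * (b * p 1)
      rw [clock, hp]; ring
    · refine ⟨k, hk, fun p hp => ?_⟩
      have hp : p 1 = 0 := hp
      change clock k b p = k * (1 * p 0)
      rw [clock, hp]; ring
  obtain ⟨l, hl, e⟩ := e
  refine hm.of_imp ?_
  filter_upwards [hi] with s hs
  rw [e _ hs, e _ (hi.self_of_nhdsWithin ht), mul_lt_mul_iff_right₀ hl, mul_lt_mul_iff_right₀ hl]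
  exact ⟨id, id⟩

/-- The origin is a trajectory by itself and `c` stays there. -/
def Rests (Z : PiecewiseField) (I : Set ℝ) (c : ℝ → Plane) : Prop :=
  (∀ s ∈ I, c s = 0) ∧ ¬ Z.AllCrossing ∧ ∀ i, ¬ Z.SlidesThroughOrigin i

namespace Tame

variable {Z : PiecewiseField} {a b sL sR k : ℝ}

theorem strictIncAt_clock_of_not_crossing (h : Z.Tame a b sL sR k) {I : Set ℝ} {c : ℝ → Plane}
    {t : ℝ} (hc : ContinuousWithinAt c I t) (ht : t ∈ I) (had : Z.AdmissibleAt a b I c t)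
    (hrest : ¬ Z.Rests I c) (hcross : ∀ i, c t ∈ Z.crossing i → c t = 0) :
    StrictIncAt I (fun s => clock k b (c s)) t := by
  have hX := fun hP hm => strictIncAt_clock_of_orbit (k := k) (b := b) (σ := 1) h.slopeX
    (one_mul 1) hc (by rw [one_mul]; exact h.X_zero _) (h.clock_X_pos _) hP (by simpa using hm)
  have hY := fun hP hm => strictIncAt_clock_of_orbit (k := k) (b := b) h.slopeY
    h.sqa hc (h.Y_zero _) (h.clock_Y_pos _) hP hm
  cases had with
  | pos h1 hP hm => exact hX hP hm
  | neg h1 hP hm => exact hY hP hm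
  | slide i h1 hi hm => exact strictIncAt_clock_of_axis h.k_pos ht hi hm
  | cross i h1 h0 hi => exact absurd (hcross i h1) h0
  | origin_pos h0 h1 hP hm =>
    exact hX (hP.mono fun s hs => by rw [hs.2, h0, orbitHeight_zero h.slopeX]) hm
  | origin_neg h0 h1 hP hm =>
    exact hY (hP.mono fun s hs => by rw [hs.2, h0, orbitHeight_zero h.slopeY]) hm
  | origin_slide i h0 hs hi hm =>
    refine strictIncAt_clock_of_axis h.k_pos ht (hi.mono fun s hs => ?_) hm
    rcases hs with hs | hs
    · rw [hs]; rfl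
    · exact (mem_slidEsc.1 hs).1
  | origin_rest h0 h1 hs => exact absurd ⟨h0, h1, hs⟩ hrest

/-- The clock increases along an admissible curve that does not rest at the origin. -/
theorem strictMonoOn_clock (h : Z.Tame a b sL sR k) {I : Set ℝ} {c : ℝ → Plane}
    (hI : I.OrdConnected) (hc : ContinuousOn c I) (had : ∀ t ∈ I, Z.AdmissibleAt a b I c t)
    (hrest : ¬ Z.Rests I c) : StrictMonoOn (fun s => clock k b (c s)) I := by
  have hcc : ContinuousOn (fun s => clock k b (c s)) I := (continuous_clock k b).comp_continuousOn hc
  refine strictMonoOn_of_strictIncAt hI hcc fun t ht => ?_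
  by_cases hx : ∀ i, c t ∈ Z.crossing i → c t = 0
  · exact h.strictIncAt_clock_of_not_crossing (hc t ht) ht (had t ht) hrest hx
  push Not at hx
  obtain ⟨i, hi, h0⟩ := hx
  have hne : ∀ j, c t ∉ Z.slidEsc j := by
    intro j hj
    have h1 := mem_slidEsc.1 hj
    have h2 : 0 < Z.X (c t) i * Z.Y (c t) i := hi.2
    rcases eq_or_ne j i with rfl | hji
    · exact lt_asymm h1.2.2 h2
    · have : j + 1 = i := by revert hji; fin_cases i <;> fin_cases j <;> simp
      exact h1.2.1 (this ▸ hi.1)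
  have hsw := mem_axis_switching hi.1
  cases had t ht with
  | pos h1 => exact absurd hsw (ne_of_gt h1)
  | neg h1 => exact absurd hsw (ne_of_lt h1)
  | slide j h1 => exact absurd h1 (hne j)
  | cross j h1 _ hj =>
    refine StrictIncAt.of_punctured hI hcc ht ?_
    filter_upwards [hj, self_mem_nhdsWithin] with s hs hsI
    exact h.strictIncAt_clock_of_not_crossing (hc s hsI.1) hsI.1 (had s hsI.1) hrest
      fun l hl => absurd (mem_axis_switching hl.1) hs
  | origin_pos h1 => exact absurd h1 h0
  | origin_neg h1 => exact absurd h1 h0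
  | origin_slide _ h1 => exact absurd h1 h0
  | origin_rest h1 h2 h3 => exact absurd ⟨h1, h2, h3⟩ hrest

end Tame

open scoped Classical in
/-- The velocity of the trajectory through `p`, if `p` is not a crossing point; `v₀` is the velocity
at the origin. -/
noncomputable def velocity (Z : PiecewiseField) (v₀ p : Plane) : Plane :=
  if p = 0 then v₀ else if p ∈ regionPos then Z.X p else if p ∈ regionNeg then Z.Y p else
    if p ∈ axis 0 then Z.slidingField 0 p else Z.slidingField 1 p

theorem velocity_zero (Z : PiecewiseField) (v₀ : Plane) : Z.velocity v₀ 0 = v₀ := if_pos rfl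

theorem zero_notMem_regionPos : (0 : Plane) ∉ regionPos := by simp [regionPos]

theorem zero_notMem_regionNeg : (0 : Plane) ∉ regionNeg := by simp [regionNeg]

theorem notMem_regionNeg_of_pos {p : Plane} (hp : p ∈ regionPos) : p ∉ regionNeg :=
  fun h => lt_asymm (show (0 : ℝ) < _ from hp) h

theorem velocity_of_mem_regionPos (Z : PiecewiseField) (v₀ : Plane) {p : Plane}
    (hp : p ∈ regionPos) : Z.velocity v₀ p = Z.X p := by
  rw [velocity, if_neg (fun h : p = 0 => zero_notMem_regionPos (h ▸ hp)), if_pos hp]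

theorem velocity_of_mem_regionNeg (Z : PiecewiseField) (v₀ : Plane) {p : Plane}
    (hp : p ∈ regionNeg) : Z.velocity v₀ p = Z.Y p := by
  rw [velocity, if_neg (fun h : p = 0 => zero_notMem_regionNeg (h ▸ hp)),
    if_neg (fun h : p ∈ regionPos => notMem_regionNeg_of_pos h hp), if_pos hp]

theorem velocity_of_mem_axis (Z : PiecewiseField) (v₀ : Plane) {p : Plane} {i : Fin 2}
    (hp : p ∈ axis i) (h0 : p ≠ 0) : Z.velocity v₀ p = Z.slidingField i p := by
  have hsw := mem_axis_switching hp
  rw [velocity, if_neg h0, if_neg (fun h : p ∈ regionPos => ne_of_gt h hsw),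
    if_neg (fun h : p ∈ regionNeg => ne_of_lt h hsw)]
  fin_cases i
  · exact if_pos hp
  · refine if_neg fun h => h0 (plane_eq_zero h hp)

theorem measurable_slidingField {Z : PiecewiseField} (hX : Continuous Z.X) (hY : Continuous Z.Y)
    (i : Fin 2) : Measurable (Z.slidingField i) := by
  have hXm : Measurable fun p => Z.X p i := (by fun_prop : Continuous fun p => Z.X p i).measurable
  have hYm : Measurable fun p => Z.Y p i := (by fun_prop : Continuous fun p => Z.Y p i).measurable
  exact (hYm.sub hXm).inv.smul ((hYm.smul hX.measurable).sub (hXm.smul hY.measurable))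

theorem measurable_velocity {Z : PiecewiseField} (hX : Continuous Z.X) (hY : Continuous Z.Y)
    (v₀ : Plane) : Measurable (Z.velocity v₀) := by
  unfold velocity
  refine Measurable.ite (measurableSet_singleton 0) measurable_const ?_
  refine Measurable.ite isOpen_regionPos.measurableSet hX.measurable ?_
  refine Measurable.ite isOpen_regionNeg.measurableSet hY.measurable ?_
  exact Measurable.ite (isClosed_axis 0).measurableSet (measurable_slidingField hX hY 0)
    (measurable_slidingField hX hY 1)

/-- A sliding vector is a convex combination of `X` and `Y`. -/
theorem clock_slidingField_mem {Z : PiecewiseField} {k b : ℝ} {i : Fin 2} {p : Plane} {m M : ℝ}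
    (hX : clock k b (Z.X p) ∈ Icc m M) (hY : clock k b (Z.Y p) ∈ Icc m M)
    (hle : Z.X p i * Z.Y p i ≤ 0) (hne : Z.X p i ≠ Z.Y p i) :
    clock k b (Z.slidingField i p) ∈ Icc m M := by
  set d := Z.Y p i - Z.X p i with hd
  have hd0 : d ≠ 0 := sub_ne_zero.2 hne.symm
  have hd2 : 0 < d ^ 2 := by positivity
  have e : clock k b (Z.slidingField i p) =
      (Z.Y p i * d / d ^ 2) • clock k b (Z.X p) + (-Z.X p i * d / d ^ 2) • clock k b (Z.Y p) := by
    rw [clock_slidingField, ← hd, smul_eq_mul, smul_eq_mul]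
    field_simp
    ring
  rw [e]
  refine convex_Icc m M hX hY (div_nonneg ?_ hd2.le) (div_nonneg ?_ hd2.le) ?_
  · rw [hd]; nlinarith [sq_nonneg (Z.Y p i)]
  · rw [hd]; nlinarith [sq_nonneg (Z.X p i)]
  · rw [hd]; field_simp; ring

theorem continuousAt_slidingField {Z : PiecewiseField} (hX : Continuous Z.X) (hY : Continuous Z.Y)
    {i : Fin 2} {p : Plane} (hne : Z.X p i ≠ Z.Y p i) : ContinuousAt (Z.slidingField i) p := by
  have hXm : Continuous fun p => Z.X p i := by fun_prop
  have hYm : Continuous fun p => Z.Y p i := by fun_prop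
  exact ((hYm.sub hXm).continuousAt.inv₀ (sub_ne_zero.2 hne.symm)).smul
    ((hYm.smul hX).sub (hXm.smul hY)).continuousAt

namespace Tame

variable {Z : PiecewiseField} {a b sL sR k : ℝ}

theorem clock_bounds (h : Z.Tame a b sL sR k) : ∃ m > 0, ∃ M, ∀ p,
    clock k b (Z.X p) ∈ Icc m M ∧ clock k b (Z.Y p) ∈ Icc m M := by
  obtain ⟨m, hm, hp⟩ := h.clock_bdd
  obtain ⟨M, hM⟩ := h.bdd
  have key : ∀ v : Plane, ‖v‖ ≤ M → clock k b v ≤ k * M + |b| * M := by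
    intro v hv
    have h0 : v 0 ≤ M := (le_abs_self _).trans ((PiLp.norm_apply_le v 0).trans hv)
    have h1 : |v 1| ≤ M := (PiLp.norm_apply_le v 1).trans hv
    have h2 : b * v 1 ≤ |b| * M := (le_abs_self _).trans
      (by rw [abs_mul]; exact mul_le_mul_of_nonneg_left h1 (abs_nonneg b))
    exact add_le_add (mul_le_mul_of_nonneg_left h0 h.k_pos.le) h2
  exact ⟨m, hm, _, fun p => ⟨⟨(hp p).1, key _ (hM p).1⟩, ⟨(hp p).2, key _ (hM p).2⟩⟩⟩

/-- A curve parametrized by the clock has the velocity `V / clock V`, where `V` is the field it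
obeys. The value `v₀` at the origin is the one for which `V` is continuous along the curve; crossing points
are excluded. -/
theorem velocity_spec (h : Z.Tame a b sL sR k) {m M : ℝ}
    (hb : ∀ p, clock k b (Z.X p) ∈ Icc m M ∧ clock k b (Z.Y p) ∈ Icc m M) (hm : 0 < m)
    {J : Set ℝ} {c : ℝ → Plane} (hc : ContinuousOn c J)
    (had : ∀ t ∈ J, Z.AdmissibleAt a b J c t) (hclock : ∀ t ∈ J, clock k b (c t) = t)
    (hrest : ¬ Z.Rests J c) :
    ∃ v₀ : Plane, ∀ t ∈ J, (∀ i, c t ∈ Z.crossing i → c t = 0) →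
      ContinuousWithinAt (fun s => Z.velocity v₀ (c s)) J t ∧
      clock k b (Z.velocity v₀ (c t)) ∈ Icc m M ∧
      HasDerivWithinAt c ((clock k b (Z.velocity v₀ (c t)))⁻¹ • Z.velocity v₀ (c t)) J t ∧
      (c t = 0 → (Z.AllCrossing ∧ (∀ᶠ s in 𝓝[J] t, c s ∈ insert 0 regionPos) ∧ v₀ = Z.X 0) ∨
        (Z.AllCrossing ∧ (∀ᶠ s in 𝓝[J] t, c s ∈ insert 0 regionNeg) ∧ v₀ = Z.Y 0) ∨
        ∃ i, Z.SlidesThroughOrigin i ∧ (∀ᶠ s in 𝓝[J] t, c s ∈ insert 0 (Z.slidEsc i)) ∧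
          v₀ = Z.slidingField i 0) := by
  have hev : ∀ t, ∀ᶠ s in 𝓝[J] t, clock k b (c s) = s := fun t =>
    eventually_nhdsWithin_of_forall hclock
  -- the three kinds of motion
  have hX : ∀ {t}, t ∈ J → (∀ᶠ s in 𝓝[J] t, orbitHeight Z.X (c s) = orbitHeight Z.X (c t)) →
      HasDerivWithinAt c ((clock k b (Z.X (c t)))⁻¹ • Z.X (c t)) J t := fun ht hP =>
    hasDerivWithinAt_of_orbit h.slopeX (hc _ ht) ht (h.X_zero _).ne' (h.clock_X_pos _) hP (hev _)
  have hY : ∀ {t}, t ∈ J → (∀ᶠ s in 𝓝[J] t, orbitHeight Z.Y (c s) = orbitHeight Z.Y (c t)) →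
      HasDerivWithinAt c ((clock k b (Z.Y (c t)))⁻¹ • Z.Y (c t)) J t := fun ht hP =>
    hasDerivWithinAt_of_orbit h.slopeY (hc _ ht) ht (h.Y_zero_ne _) (h.clock_Y_pos _) hP (hev _)
  have hS : ∀ {t i}, t ∈ J → (∀ᶠ s in 𝓝[J] t, c s ∈ axis i) →
      clock k b (Z.slidingField i (c t)) ∈ Icc m M → HasDerivWithinAt c
        ((clock k b (Z.slidingField i (c t)))⁻¹ • Z.slidingField i (c t)) J t := fun ht hi hb =>
    hasDerivWithinAt_of_axis (slidingField_self Z _ _) (hm.trans_le hb.1).ne' ht hi (hev _)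
  -- the claim at a time near which the curve obeys one continuous field
  have wrap : ∀ {v₀ t} (V : Plane → Plane), t ∈ J → ContinuousAt V (c t) →
      (∀ᶠ s in 𝓝[J] t, Z.velocity v₀ (c s) = V (c s)) → clock k b (V (c t)) ∈ Icc m M →
      HasDerivWithinAt c ((clock k b (V (c t)))⁻¹ • V (c t)) J t →
      ContinuousWithinAt (fun s => Z.velocity v₀ (c s)) J t ∧
      clock k b (Z.velocity v₀ (c t)) ∈ Icc m M ∧
      HasDerivWithinAt c ((clock k b (Z.velocity v₀ (c t)))⁻¹ • Z.velocity v₀ (c t)) J t := by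
    intro v₀ t V ht hV he hb hd
    have e := he.self_of_nhdsWithin ht
    rw [e]
    exact ⟨(hV.comp_continuousWithinAt (hc t ht)).congr_of_eventuallyEq he e, hb, hd⟩
  have hbS : ∀ i, Z.SlidesThroughOrigin i → clock k b (Z.slidingField i 0) ∈ Icc m M := fun i hi =>
    clock_slidingField_mem (hb 0).1 (hb 0).2 (h.mul_nonpos_of_mem_closure hi.1) hi.2.2.2
  have honly : ∀ {s t}, s ∈ J → t ∈ J → c s = 0 → c t = 0 → s = t := by
    intro s t hs ht h1 h2
    rw [← hclock s hs, ← hclock t ht, h1, h2]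
  have hne : ∀ {v₀ t}, t ∈ J → c t ≠ 0 → (∀ i, c t ∈ Z.crossing i → c t = 0) →
      ContinuousWithinAt (fun s => Z.velocity v₀ (c s)) J t ∧
      clock k b (Z.velocity v₀ (c t)) ∈ Icc m M ∧
      HasDerivWithinAt c ((clock k b (Z.velocity v₀ (c t)))⁻¹ • Z.velocity v₀ (c t)) J t := by
    intro v₀ t ht h0 hx
    cases had t ht with
    | pos h1 hP hm =>
      refine wrap Z.X ht h.contX.continuousAt ?_ (hb _).1 (hX ht hP)
      filter_upwards [hc t ht (isOpen_regionPos.mem_nhds h1)] with s hs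
        using velocity_of_mem_regionPos Z v₀ hs
    | neg h1 hP hm =>
      refine wrap Z.Y ht h.contY.continuousAt ?_ (hb _).2 (hY ht hP)
      filter_upwards [hc t ht (isOpen_regionNeg.mem_nhds h1)] with s hs
        using velocity_of_mem_regionNeg Z v₀ hs
    | slide i h1 hi hm =>
      have h2 := (mem_slidEsc.1 h1).2.2
      have hXY : Z.X (c t) i ≠ Z.Y (c t) i := fun he => by
        rw [he] at h2; exact absurd h2 (not_lt.2 (mul_self_nonneg _))
      have hbs := clock_slidingField_mem (hb (c t)).1 (hb (c t)).2 h2.le hXY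
      refine wrap (Z.slidingField i) ht (continuousAt_slidingField h.contX h.contY hXY) ?_ hbs
        (hS ht hi hbs)
      filter_upwards [hi, hc t ht (isOpen_ne.mem_nhds h0)] with s hs hs0
        using velocity_of_mem_axis Z v₀ hs hs0
    | cross i h1 => exact absurd (hx i h1) h0
    | origin_pos h1 => exact absurd h1 h0
    | origin_neg h1 => exact absurd h1 h0
    | origin_slide _ h1 => exact absurd h1 h0
    | origin_rest h1 h2 h3 => exact absurd ⟨h1, h2, h3⟩ hrest
  -- the clock vanishes at the origin, so the curve is there once at most and `v₀` is chosen for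
  -- that time
  by_cases hex : ∃ t₀ ∈ J, c t₀ = 0
  · obtain ⟨t₀, ht₀, h0⟩ := hex
    suffices hsuff : ∃ v₀ : Plane, ((ContinuousWithinAt (fun s => Z.velocity v₀ (c s)) J t₀ ∧
      clock k b (Z.velocity v₀ (c t₀)) ∈ Icc m M ∧
      HasDerivWithinAt c ((clock k b (Z.velocity v₀ (c t₀)))⁻¹ • Z.velocity v₀ (c t₀)) J t₀) ∧
      ((Z.AllCrossing ∧ (∀ᶠ s in 𝓝[J] t₀, c s ∈ insert 0 regionPos) ∧ v₀ = Z.X 0) ∨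
        (Z.AllCrossing ∧ (∀ᶠ s in 𝓝[J] t₀, c s ∈ insert 0 regionNeg) ∧ v₀ = Z.Y 0) ∨
        ∃ i, Z.SlidesThroughOrigin i ∧ (∀ᶠ s in 𝓝[J] t₀, c s ∈ insert 0 (Z.slidEsc i)) ∧
          v₀ = Z.slidingField i 0)) by
      obtain ⟨v₀, h1, h2⟩ := hsuff
      refine ⟨v₀, fun t ht hx => ?_⟩
      by_cases ht0 : c t = 0
      · obtain rfl := honly ht₀ ht h0 ht0
        exact ⟨h1.1, h1.2.1, h1.2.2, fun _ => h2⟩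
      · obtain ⟨h3, h4, h5⟩ := hne (v₀ := v₀) ht ht0 hx
        exact ⟨h3, h4, h5, fun hc => absurd hc ht0⟩
    cases had t₀ ht₀ with
    | pos h1 => exact absurd (h0 ▸ h1) zero_notMem_regionPos
    | neg h1 => exact absurd (h0 ▸ h1) zero_notMem_regionNeg
    | slide i h1 => exact absurd (h0 ▸ rfl) (mem_slidEsc.1 h1).2.1
    | cross i h1 h2 => exact absurd h0 h2
    | origin_pos h1 hA hP hm =>
      refine ⟨Z.X 0, wrap Z.X ht₀ h.contX.continuousAt ?_ (hb _).1 (hX ht₀ ?_),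
        Or.inl ⟨hA, hP.mono fun s hs => hs.1, rfl⟩⟩
      · filter_upwards [hP] with s hs
        rcases hs.1 with h2 | h2
        · rw [h2, velocity_zero]
        · exact velocity_of_mem_regionPos Z _ h2
      · exact hP.mono fun s hs => by rw [hs.2, h0, orbitHeight_zero h.slopeX]
    | origin_neg h1 hA hP hm =>
      refine ⟨Z.Y 0, wrap Z.Y ht₀ h.contY.continuousAt ?_ (hb _).2 (hY ht₀ ?_),
        Or.inr (Or.inl ⟨hA, hP.mono fun s hs => hs.1, rfl⟩)⟩
      · filter_upwards [hP] with s hs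
        rcases hs.1 with h2 | h2
        · rw [h2, velocity_zero]
        · exact velocity_of_mem_regionNeg Z _ h2
      · exact hP.mono fun s hs => by rw [hs.2, h0, orbitHeight_zero h.slopeY]
    | origin_slide i h1 hs hi hm =>
      have hax : ∀ᶠ s in 𝓝[J] t₀, c s ∈ axis i := hi.mono fun s hs => by
        rcases hs with hs | hs
        · rw [hs]; rfl
        · exact (mem_slidEsc.1 hs).1
      refine ⟨Z.slidingField i 0, wrap (Z.slidingField i) ht₀ ?_ ?_ ?_ ?_,
        Or.inr (Or.inr ⟨i, hs, hi, rfl⟩)⟩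
      · rw [h0]; exact continuousAt_slidingField h.contX h.contY hs.2.2.2
      · filter_upwards [hax] with s hs
        by_cases h2 : c s = 0
        · rw [h2, velocity_zero]
        · exact velocity_of_mem_axis Z _ hs h2
      · rw [h0]; exact hbS i hs
      · exact hS ht₀ hax (by rw [h0]; exact hbS i hs)
    | origin_rest h1 h2 h3 => exact absurd ⟨h1, h2, h3⟩ hrest
  · push Not at hex
    refine ⟨0, fun t ht hx => ?_⟩
    obtain ⟨h3, h4, h5⟩ := hne (v₀ := 0) ht (hex t ht) hx
    exact ⟨h3, h4, h5, fun hc => absurd hc (hex t ht)⟩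

end Tame

end PiecewiseField

namespace PiecewiseField

namespace Tame

variable {Z Z' : PiecewiseField} {a b sL sR k k' : ℝ}

/-- The passage from the clock to the time of the trajectory. -/
theorem exists_time (h : Z.Tame a b sL sR k) {J : Set ℝ} {c : ℝ → Plane} (hJ : J.OrdConnected)
    (hc : ContinuousOn c J) (had : ∀ t ∈ J, Z.AdmissibleAt a b J c t)
    (hclock : ∀ t ∈ J, clock k b (c t) = t) (hrest : ¬ Z.Rests J c) :
    ∃ (K : Set ℝ) (τ : ℝ → ℝ), K.OrdConnected ∧ StrictMonoOn τ K ∧ τ '' K = J ∧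
      ContinuousOn τ K ∧ Z.IsTrajectory K (fun t => c (τ t)) := by
  classical
  obtain ⟨m, hm, M, hb⟩ := h.clock_bounds
  obtain ⟨v₀, hv⟩ := h.velocity_spec hb hm hc had hclock hrest
  have hmM : m ≤ M := (hb 0).1.1.trans (hb 0).1.2
  -- the speed of the clock, truncated to its known range
  set w : ℝ → ℝ := fun s => max m (min M (clock k b (Z.velocity v₀ (J.piecewise c 0 s)))) with hw
  have hwm : ∀ s, m ≤ w s := fun s => le_max_left _ _
  have hwM : ∀ s, w s ≤ M := fun s => max_le hmM (min_le_left _ _)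
  have hw0 : ∀ s, 0 < w s := fun s => hm.trans_le (hwm s)
  have hcm : Measurable (J.piecewise c 0) :=
    hc.measurable_piecewise continuousOn_const hJ.measurableSet
  have hwmeas : Measurable w :=
    measurable_const.max (measurable_const.min ((continuous_clock k b).measurable.comp
      ((measurable_velocity h.contX h.contY v₀).comp hcm)))
  obtain ⟨θ, hθm, hθc, hθd⟩ := exists_primitive hJ hwmeas.inv (inv_pos.2 (hm.trans_le hmM))
    (fun s => inv_anti₀ (hw0 s) (hwM s)) (fun s => inv_anti₀ hm (hwm s))
  obtain ⟨hK, τ, hτm, hτi, hτc, -, hθτ⟩ :=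
    exists_inverse_of_strictMonoOn hJ hθc.continuousOn (hθm.strictMonoOn J)
  have hmaps : MapsTo τ (θ '' J) J := fun r hr => hτi ▸ mem_image_of_mem τ hr
  have hwval : ∀ s ∈ J, w s = max m (min M (clock k b (Z.velocity v₀ (c s)))) := fun s hs => by
    simp only [hw, piecewise_eq_of_mem _ _ _ hs]
  -- the derivative of the reparametrized curve
  have hder : ∀ r ∈ θ '' J, (∀ i, c (τ r) ∈ Z.crossing i → c (τ r) = 0) →
      HasDerivWithinAt (fun t => c (τ t)) (Z.velocity v₀ (c (τ r))) (θ '' J) r := by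
    intro r hr hx
    have hs := hmaps hr
    obtain ⟨h1, h2, h3, -⟩ := hv (τ r) hs hx
    have ew : w (τ r) = clock k b (Z.velocity v₀ (c (τ r))) := by
      rw [hwval _ hs, min_eq_right h2.2, max_eq_right h2.1]
    have hwc : ContinuousWithinAt (fun s => (w s)⁻¹) J (τ r) := by
      refine ContinuousWithinAt.inv₀ ?_ (hw0 _).ne'
      refine ContinuousWithinAt.congr (f := fun s => max m (min M (clock k b
        (Z.velocity v₀ (c s))))) ?_ hwval (hwval _ hs)
      have hf : Continuous fun v : Plane => max m (min M (clock k b v)) :=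
        continuous_const.max (continuous_const.min (continuous_clock k b))
      exact hf.continuousAt.comp_continuousWithinAt h1
    have h4 := hasDerivWithinAt_inverse (hτc r hr) hmaps (hθd (τ r) hs hwc)
      (inv_ne_zero (hw0 _).ne') hr (eventually_nhdsWithin_of_forall hθτ)
    have h5 := h3.scomp r h4 hmaps
    simp only [Pi.inv_apply, inv_inv] at h5
    rwa [ew, smul_smul, mul_inv_cancel₀ (hm.trans_le h2.1).ne', one_smul] at h5
  refine ⟨θ '' J, τ, hK, hτm, hτi, hτc, hK, hc.comp hτc hmaps, fun r hr => ?_⟩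
  have hs := hmaps hr
  have hadr := (had (τ r) hs).comp (hτc r hr) hmaps hτm hr
  -- the law at the origin asks for the field on a whole neighbourhood in time
  have hzero : c (τ r) = 0 → ∀ {S : Set Plane} {V : Plane → Plane},
      (∀ᶠ s in 𝓝[J] τ r, c s ∈ insert 0 S) → v₀ = V 0 →
      (∀ p ∈ S, Z.velocity v₀ p = V p) → (∀ p ∈ S, ∀ i, p ∉ Z.crossing i) →
      ∀ᶠ s in 𝓝[θ '' J] r, c (τ s) ∈ insert 0 S ∧
        HasDerivWithinAt (fun t => c (τ t)) (V (c (τ s))) (θ '' J) s := by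
    intro h0 S V hS hV0 hV hSc
    filter_upwards [(tendsto_reparam (hτc r hr) hmaps).eventually hS, self_mem_nhdsWithin]
      with s hsS hsK
    refine ⟨hsS, ?_⟩
    rcases hsS with h1 | h1
    · have := hder s hsK fun _ _ => h1
      rw [h1, velocity_zero, hV0] at this
      rwa [h1]
    · have := hder s hsK fun i hi => absurd hi (hSc _ h1 i)
      rwa [hV _ h1] at this
  have hsplit := fun hx => (hv (τ r) hs hx).2.2.2
  cases hadr with
  | pos h1 =>
    refine Or.inl ⟨fun h0 => zero_notMem_regionPos (h0 ▸ h1), Or.inl ⟨h1, ?_⟩⟩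
    have := hder r hr fun i hi => absurd (mem_axis_switching hi.1) (ne_of_gt h1)
    rwa [velocity_of_mem_regionPos Z _ h1] at this
  | neg h1 =>
    refine Or.inl ⟨fun h0 => zero_notMem_regionNeg (h0 ▸ h1), Or.inr (Or.inl ⟨h1, ?_⟩)⟩
    have := hder r hr fun i hi => absurd (mem_axis_switching hi.1) (ne_of_lt h1)
    rwa [velocity_of_mem_regionNeg Z _ h1] at this
  | slide i h1 hi =>
    have h2 := mem_slidEsc.1 h1
    have h0 : c (τ r) ≠ 0 := fun h0 => h2.2.1 (by rw [h0]; rfl)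
    refine Or.inl ⟨h0, Or.inr (Or.inr (Or.inl ⟨i, h1, hi, ?_⟩))⟩
    have := hder r hr fun j hj => by
      exfalso
      have h3 : 0 < Z.X (c (τ r)) j * Z.Y (c (τ r)) j := hj.2
      rcases eq_or_ne j i with rfl | hji
      · exact lt_asymm h3 h2.2.2
      · have : i + 1 = j := by revert hji; fin_cases i <;> fin_cases j <;> simp
        exact h2.2.1 (this ▸ hj.1)
    rwa [velocity_of_mem_axis Z _ h2.1 h0] at this
  | cross i h1 h0 hi => exact Or.inl ⟨h0, Or.inr (Or.inr (Or.inr ⟨i, h1, hi⟩))⟩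
  | origin_rest h0 hA hS =>
    exact Or.inr (Or.inr ⟨h0 r hr, Or.inr (Or.inr ⟨hA, hS, h0⟩)⟩)
  | origin_pos h0 | origin_neg h0 | origin_slide _ h0 =>
    refine Or.inr (Or.inr ⟨h0, ?_⟩)
    rcases hsplit (fun _ _ => h0) h0 with ⟨hA, hS, hV⟩ | ⟨hA, hS, hV⟩ | ⟨i, hi, hS, hV⟩
    · exact Or.inl ⟨hA, Or.inl (hzero h0 hS hV (fun p hp => velocity_of_mem_regionPos Z _ hp)
        fun p hp i hc => ne_of_gt hp (mem_axis_switching hc.1))⟩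
    · exact Or.inl ⟨hA, Or.inr (hzero h0 hS hV (fun p hp => velocity_of_mem_regionNeg Z _ hp)
        fun p hp i hc => ne_of_lt hp (mem_axis_switching hc.1))⟩
    · refine Or.inr (Or.inl ⟨h.not_allCrossing_of_slides hi, i, hi,
        (tendsto_reparam (hτc r hr) hmaps).eventually hS, ?_⟩)
      have := hder r hr fun _ _ => h0
      rwa [h0, velocity_zero, hV] at this

/-- Admissible curves are trajectories up to an increasing change of time. -/
theorem exists_isTrajectory (h : Z.Tame a b sL sR k) {I : Set ℝ} {c : ℝ → Plane}
    (hI : I.OrdConnected) (hc : ContinuousOn c I) (had : ∀ t ∈ I, Z.AdmissibleAt a b I c t) :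
    ∃ (K : Set ℝ) (τ : ℝ → ℝ), StrictMonoOn τ K ∧ τ '' K = I ∧
      Z.IsTrajectory K (fun t => c (τ t)) := by
  by_cases hrest : Z.Rests I c
  · exact ⟨I, id, strictMonoOn_id, image_id I, hI, hc, fun t ht =>
      Or.inr (Or.inr ⟨hrest.1 t ht, Or.inr (Or.inr ⟨hrest.2.1, hrest.2.2, hrest.1⟩)⟩)⟩
  · have hcc : ContinuousOn (fun s => clock k b (c s)) I :=
      (continuous_clock k b).comp_continuousOn hc
    obtain ⟨hJ, g, hgm, hgi, hgc, -, hfg⟩ := exists_inverse_of_strictMonoOn hI hcc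
      (h.strictMonoOn_clock hI hc had hrest)
    set J := (fun s => clock k b (c s)) '' I
    have hmaps : MapsTo g J I := fun r hr => hgi ▸ mem_image_of_mem g hr
    obtain ⟨K, τ, -, hτm, hτi, -, htraj⟩ := h.exists_time hJ (hc.comp hgc hmaps)
      (fun r hr => (had (g r) (hmaps hr)).comp (hgc r hr) hmaps hgm hr) hfg
      (fun hz => hrest ⟨fun s hs => by
        obtain ⟨r, hr, rfl⟩ : s ∈ g '' J := hgi.symm ▸ hs
        exact hz.1 r hr, hz.2⟩)
    refine ⟨K, fun t => g (τ t), ?_, ?_, htraj⟩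
    · intro s hs t ht hst
      exact hgm (hτi ▸ mem_image_of_mem τ hs) (hτi ▸ mem_image_of_mem τ ht) (hτm hs ht hst)
    · rw [← hgi, ← hτi, image_image]

end Tame

end PiecewiseField

/-! ### Localization -/

namespace PiecewiseField

/-- The two fields of `Z` and `Z'` agree on the open neighbourhood `W` of the origin. -/
structure AgreeOn (Z Z' : PiecewiseField) (W : Set Plane) : Prop where
  isOpen : IsOpen W
  zero_mem : 0 ∈ W
  eqX : EqOn Z.X Z'.X W
  eqY : EqOn Z.Y Z'.Y W

/-- There is no tangency point in `W`, except perhaps the origin. -/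
def NoTangency (Z : PiecewiseField) (W : Set Plane) : Prop :=
  ∀ p ∈ W, p ≠ 0 → ∀ i, p ∈ axis i → Z.X p i * Z.Y p i ≠ 0

theorem NoTangency.mono {Z : PiecewiseField} {W W' : Set Plane} (h : Z.NoTangency W)
    (hW : W' ⊆ W) : Z.NoTangency W' := fun p hp => h p (hW hp)

theorem NoTangency.not_tangencyLaw {Z : PiecewiseField} {W : Set Plane} (h : Z.NoTangency W)
    {I : Set ℝ} {c : ℝ → Plane} {t : ℝ} (ht : c t ∈ W) : ¬ Z.TangencyLaw I c t := by
  rintro ⟨h0, ⟨i, hi, hm⟩, -⟩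
  exact h _ ht h0 i hi hm

theorem mem_closure_congr_of_isOpen {S T W : Set Plane} (hW : IsOpen W)
    (h : ∀ p ∈ W, p ∈ S ↔ p ∈ T) {p : Plane} (hp : p ∈ W) : p ∈ closure S ↔ p ∈ closure T := by
  rw [mem_closure_iff_nhdsWithin_neBot, mem_closure_iff_nhdsWithin_neBot,
    nhdsWithin_eq_nhdsWithin hp hW (u := T) ?_]
  ext q
  exact ⟨fun hq => ⟨(h q hq.2).1 hq.1, hq.2⟩, fun hq => ⟨(h q hq.2).2 hq.1, hq.2⟩⟩

namespace AgreeOn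

variable {Z Z' : PiecewiseField} {W : Set Plane}

theorem symm (h : AgreeOn Z Z' W) : AgreeOn Z' Z W := ⟨h.1, h.2, h.3.symm, h.4.symm⟩

theorem noTangency (h : AgreeOn Z Z' W) (hZ : Z.NoTangency W) : Z'.NoTangency W := by
  intro p hp h0 i hi
  rw [← h.eqX hp, ← h.eqY hp]
  exact hZ p hp h0 i hi

theorem mem_slidEsc_iff (h : AgreeOn Z Z' W) {p : Plane} (hp : p ∈ W) (i : Fin 2) :
    p ∈ Z.slidEsc i ↔ p ∈ Z'.slidEsc i := by
  rw [mem_slidEsc, mem_slidEsc, h.eqX hp, h.eqY hp]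

theorem mem_crossing_iff (h : AgreeOn Z Z' W) {p : Plane} (hp : p ∈ W) (i : Fin 2) :
    p ∈ Z.crossing i ↔ p ∈ Z'.crossing i := by
  simp only [crossing, mem_ofPred_eq, h.eqX hp, h.eqY hp]

theorem slidingField_eq (h : AgreeOn Z Z' W) {p : Plane} (hp : p ∈ W) (i : Fin 2) :
    Z.slidingField i p = Z'.slidingField i p := by
  rw [slidingField, slidingField, h.eqX hp, h.eqY hp]

theorem allCrossing_iff (h : AgreeOn Z Z' W) : Z.AllCrossing ↔ Z'.AllCrossing := by
  have key : ∀ᶠ p in 𝓝 (0 : Plane), (p ∈ closure (Z.crossing 0 ∪ Z.crossing 1) ↔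
      p ∈ closure (Z'.crossing 0 ∪ Z'.crossing 1)) := by
    filter_upwards [h.isOpen.mem_nhds h.zero_mem] with p hp
    refine mem_closure_congr_of_isOpen h.isOpen (fun q hq => ?_) hp
    rw [mem_union, mem_union, h.mem_crossing_iff hq, h.mem_crossing_iff hq]
  exact eventually_congr (key.mono fun p hp => by rw [hp])

theorem slidesThroughOrigin_iff (h : AgreeOn Z Z' W) (i : Fin 2) :
    Z.SlidesThroughOrigin i ↔ Z'.SlidesThroughOrigin i := by
  have hs := fun j => mem_closure_congr_of_isOpen h.isOpen
    (fun q hq => h.mem_slidEsc_iff hq j) h.zero_mem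
  have hc := fun j => mem_closure_congr_of_isOpen h.isOpen
    (fun q hq => h.mem_crossing_iff hq j) h.zero_mem
  rw [SlidesThroughOrigin, SlidesThroughOrigin, hs, hs, hc, h.eqX h.zero_mem, h.eqY h.zero_mem]

theorem isTrajectory (h : AgreeOn Z Z' W) (hZ : Z.NoTangency W) {I : Set ℝ} {c : ℝ → Plane}
    (hI : MapsTo c I W) (hc : Z.IsTrajectory I c) : Z'.IsTrajectory I c := by
  refine ⟨hc.1, hc.2.1, fun t ht => ?_⟩
  have hW := hI ht
  rcases hc.2.2 t ht with ⟨h0, h1⟩ | h1 | ⟨h0, h1⟩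
  · refine Or.inl ⟨h0, ?_⟩
    rcases h1 with h1 | h1 | ⟨i, h1, h2, h3⟩ | ⟨i, h1, h2⟩
    · exact Or.inl ⟨h1.1, h.eqX hW ▸ h1.2⟩
    · exact Or.inr (Or.inl ⟨h1.1, h.eqY hW ▸ h1.2⟩)
    · exact Or.inr (Or.inr (Or.inl ⟨i, (h.mem_slidEsc_iff hW i).1 h1, h2,
        h.slidingField_eq hW i ▸ h3⟩))
    · exact Or.inr (Or.inr (Or.inr ⟨i, (h.mem_crossing_iff hW i).1 h1, h2⟩))
  · exact absurd h1 (hZ.not_tangencyLaw hW)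
  · refine Or.inr (Or.inr ⟨h0, ?_⟩)
    have hS := fun i => h.slidesThroughOrigin_iff i
    rw [← h.allCrossing_iff]
    simp only [← hS, ← h.slidingField_eq h.zero_mem]
    rcases h1 with ⟨hA, h1⟩ | ⟨hA, i, hs, h1, h2⟩ | h1
    · refine Or.inl ⟨hA, h1.imp (fun h1 => ?_) (fun h1 => ?_)⟩
      · filter_upwards [h1, self_mem_nhdsWithin] with s hs hsI
        exact ⟨hs.1, h.eqX (hI hsI) ▸ hs.2⟩
      · filter_upwards [h1, self_mem_nhdsWithin] with s hs hsI
        exact ⟨hs.1, h.eqY (hI hsI) ▸ hs.2⟩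
    · refine Or.inr (Or.inl ⟨hA, i, hs, ?_, h2⟩)
      filter_upwards [h1, self_mem_nhdsWithin] with s hs hsI
      exact hs.imp_right (h.mem_slidEsc_iff (hI hsI) i).1
    · exact Or.inr (Or.inr h1)

end AgreeOn

theorem Tame.noTangency {Z : PiecewiseField} {a b sL sR k : ℝ} (h : Z.Tame a b sL sR k)
    (W : Set Plane) : Z.NoTangency W := fun _ _ h0 _ hi => h.mul_ne_zero_of_mem_axis h0 hi

/-- Near the origin `Z` agrees with a tame field of the given type. -/
def TameAt (Z : PiecewiseField) (a b sL sR : ℝ) : Prop :=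
  ∃ Z' k W, Tame Z' a b sL sR k ∧ AgreeOn Z Z' W

/-- `h` is a homeomorphism between neighbourhoods of the origin which fixes the origin and carries
the trajectories of `Z` to those of `Z'` and conversely. -/
structure Conjugates (h : OpenPartialHomeomorph Plane Plane) (Z Z' : PiecewiseField) : Prop where
  zero_mem : 0 ∈ h.source
  map_zero : h 0 = 0
  carries : CarriesTrajectories h Z Z'
  carries_symm : CarriesTrajectories h.symm Z' Z

/-- `h` maps every open quadrant and every open half-axis to itself. -/
def PreservesSigns (h : OpenPartialHomeomorph Plane Plane) : Prop :=
  ∀ p ∈ h.source, ∀ i, SignType.sign (h p i) = SignType.sign (p i)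

theorem Tame.carries {Z Z' : PiecewiseField} {a b sL sR k k' : ℝ} (h : Z.Tame a b sL sR k)
    (h' : Z'.Tame a b sL sR k')
    (M : SlopeField.Matching (slope Z.X) (slope Z.Y) (slope Z'.X) (slope Z'.Y)) {I : Set ℝ}
    {c : ℝ → Plane} (hc : Z.IsTrajectory I c) : ∃ (J : Set ℝ) (τ : ℝ → ℝ), StrictMonoOn τ J ∧ τ '' J = I ∧
      Z'.IsTrajectory J (fun t => M.map (c (τ t))) :=
  h'.exists_isTrajectory hc.1
    ((M.continuous_map h.slopeX h.slopeY h'.slopeX h'.slopeY).comp_continuousOn hc.2.1)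
    fun _ ht => admissibleAt_map h h' M hc.2.1 ht (h.admissibleAt hc ht)

/-- Two fields that agree near the origin with tame fields of the same type are equivalent there. -/
theorem TameAt.exists_conjugates {Z Z' : PiecewiseField} {a b sL sR : ℝ} (hZ : Z.TameAt a b sL sR)
    (hZ' : Z'.TameAt a b sL sR) :
    ∃ h : OpenPartialHomeomorph Plane Plane, Conjugates h Z Z' ∧ PreservesSigns h ∧
      Z.NoTangency h.source ∧ Z'.NoTangency h.target := by
  obtain ⟨Y, k, W, hY, hW⟩ := hZ
  obtain ⟨Y', k', W', hY', hW'⟩ := hZ'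
  obtain ⟨M⟩ := SlopeField.exists_matching hY.pair hY'.pair
  set H := M.homeo hY.slopeX hY.slopeY hY'.slopeX hY'.slopeY with hH
  have hHc : Continuous H := H.continuous
  have hH0 : H 0 = 0 := by
    refine plane_eq_zero ?_ ?_
    · rw [← sign_eq_zero_iff]
      exact (M.sign_map hY.slopeX hY.slopeY hY'.slopeX hY'.slopeY 0 0).trans (by simp)
    · rw [← sign_eq_zero_iff]
      exact (M.sign_map hY.slopeX hY.slopeY hY'.slopeX hY'.slopeY 0 1).trans (by simp)
  set h := H.toOpenPartialHomeomorph.restrOpen (W ∩ H ⁻¹' W')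
    (hW.isOpen.inter (hW'.isOpen.preimage hHc)) with hh
  have hsrc : h.source = W ∩ H ⁻¹' W' := by simp [hh]
  have htgt : ∀ p ∈ h.target, H.symm p ∈ W ∧ p ∈ W' := by
    intro p hp
    have := h.map_target hp
    rw [hsrc] at this
    have e : h (h.symm p) = p := h.right_inv hp
    exact ⟨this.1, by simpa using (show H (H.symm p) ∈ W' from this.2)⟩
  have hT := hW.symm.noTangency (hY.noTangency W)
  have hT' := hW'.symm.noTangency (hY'.noTangency W')
  refine ⟨h, ⟨?_, hH0, ?_, ?_⟩, ?_, hT.mono (by rw [hsrc]; exact inter_subset_left),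
    hT'.mono fun p hp => (htgt p hp).2⟩
  · rw [hsrc]
    exact ⟨hW.zero_mem, by rw [mem_preimage, hH0]; exact hW'.zero_mem⟩
  · intro I c hc hI
    rw [hsrc] at hI
    obtain ⟨J, τ, h1, h2, h3⟩ := hY.carries hY' M
      (hW.isTrajectory hT (fun t ht => (hI ht).1) hc)
    refine ⟨J, τ, h1, h2, hW'.symm.isTrajectory (hY'.noTangency W') (fun t ht => ?_) h3⟩
    exact (hI (h2 ▸ mem_image_of_mem τ ht)).2
  · intro I c hc hI
    have hI' : ∀ t ∈ I, H.symm (c t) ∈ W ∧ c t ∈ W' := fun t ht => htgt _ (hI ht)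
    obtain ⟨J, τ, h1, h2, h3⟩ := hY'.carries hY M.symm
      (hW'.isTrajectory hT' (fun t ht => (hI' t ht).2) hc)
    refine ⟨J, τ, h1, h2, hW.symm.isTrajectory (hY.noTangency W) (fun t ht => ?_) h3⟩
    exact (hI' _ (h2 ▸ mem_image_of_mem τ ht)).1
  · exact fun p _ i => M.sign_map hY.slopeX hY.slopeY hY'.slopeX hY'.slopeY p i

end PiecewiseField

/-! ### Orientation -/

namespace PiecewiseField

theorem norm_polar_one (t : ℝ) : ‖polar 1 t‖ = 1 := by
  rw [EuclideanSpace.norm_eq, Fin.sum_univ_two]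
  simp [polar]

theorem polar_eq_smul (r t : ℝ) : polar r t = r • polar 1 t := by
  ext i
  fin_cases i <;> simp [polar]

theorem continuous_polar (r : ℝ) : Continuous (polar r) :=
  Tame.continuous_vec (by fun_prop) (by fun_prop)

/-- A homeomorphism that maps each quadrant to itself turns every point by an angle of absolute
value less than `π / 2`, so it preserves the orientation. -/
theorem PreservesSigns.preservesOrientation {h : OpenPartialHomeomorph Plane Plane}
    (hs : PreservesSigns h) (h0 : 0 ∈ h.source) : PreservesOrientation h := by
  obtain ⟨ε, hε, hball⟩ := Metric.isOpen_iff.1 h.open_source 0 h0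
  filter_upwards [Ioo_mem_nhdsGT hε] with r hr
  have hsrc : ∀ t, polar r t ∈ h.source := fun t => hball (by
    rw [mem_ball_zero_iff, polar_eq_smul, norm_smul, norm_polar_one, mul_one, Real.norm_eq_abs,
      abs_of_pos hr.1]
    exact hr.2)
  have hq : Continuous fun t => h (polar r t) :=
    h.continuousOn.comp_continuous (continuous_polar r) hsrc
  have hmul : ∀ t i, 0 ≤ h (polar r t) i * polar 1 t i ∧
      (polar 1 t i ≠ 0 → 0 < h (polar r t) i * polar 1 t i) := by
    intro t i
    have e : SignType.sign (h (polar r t) i) = SignType.sign (polar 1 t i) := by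
      rw [hs _ (hsrc t) i, polar_eq_smul r t]
      simp [sign_mul, sign_pos hr.1]
    rcases lt_trichotomy (polar 1 t i) 0 with hp | hp | hp
    · rw [sign_neg hp, sign_eq_neg_one_iff] at e
      exact ⟨(mul_pos_of_neg_of_neg e hp).le, fun _ => mul_pos_of_neg_of_neg e hp⟩
    · rw [hp]; simp
    · rw [sign_pos hp, sign_eq_one_iff] at e
      exact ⟨(mul_pos e hp).le, fun _ => mul_pos e hp⟩
  -- the angle by which the point with angle `t` is turned is the argument of `w t`
  set w : ℝ → ℂ := fun t => (⟨h (polar r t) 0, h (polar r t) 1⟩ : ℂ) *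
    (⟨Real.cos t, -Real.sin t⟩ : ℂ) with hw
  have hwre : ∀ t, 0 < (w t).re := by
    intro t
    have e : (w t).re = h (polar r t) 0 * polar 1 t 0 + h (polar r t) 1 * polar 1 t 1 := by
      simp [hw, polar, Complex.mul_re]
    rw [e]
    by_cases hc : polar 1 t 0 = 0
    · have : polar 1 t 1 ≠ 0 := by
        intro hc1
        have h1 : polar 1 t = 0 := plane_eq_zero hc hc1
        have h2 := norm_polar_one t
        rw [h1, norm_zero] at h2
        exact zero_ne_one h2
      exact add_pos_of_nonneg_of_pos (hmul t 0).1 ((hmul t 1).2 this)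
    · exact add_pos_of_pos_of_nonneg ((hmul t 0).2 hc) (hmul t 1).1
  have hwc : Continuous w := by
    have h1 : ∀ {u v : ℝ → ℝ}, Continuous u → Continuous v →
        Continuous fun t => (⟨u t, v t⟩ : ℂ) := fun hu hv =>
      Complex.equivRealProdCLM.symm.continuous.comp (hu.prodMk hv)
    have hp : ∀ i, Continuous fun p : Plane => p i := fun i => by fun_prop
    exact (h1 ((hp 0).comp hq) ((hp 1).comp hq)).mul
      (h1 Real.continuous_cos Real.continuous_sin.neg)
  refine ⟨fun t => t + (w t).arg, ?_, ?_, ?_⟩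
  · refine continuous_id.add (continuous_iff_continuousAt.2 fun t => ?_)
    exact (Complex.continuousAt_arg (Or.inl (hwre t))).comp hwc.continuousAt
  · intro t
    have : w (t + 2 * Real.pi) = w t := by simp [hw, polar]
    simp only [this]; ring
  · intro t
    have h1 : h (polar r t) = ‖w t‖ • polar 1 (t + (w t).arg) := by
      have e1 : ‖w t‖ * Real.cos (w t).arg = (w t).re := Complex.norm_mul_cos_arg _
      have e2 : ‖w t‖ * Real.sin (w t).arg = (w t).im := Complex.norm_mul_sin_arg _
      have e3 : (w t).re = h (polar r t) 0 * Real.cos t + h (polar r t) 1 * Real.sin t := by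
        simp [hw, Complex.mul_re]
      have e4 : (w t).im = -h (polar r t) 0 * Real.sin t + h (polar r t) 1 * Real.cos t := by
        simp [hw, Complex.mul_im]
      have e5 := Real.sin_sq_add_cos_sq t
      ext i
      fin_cases i
      · change h (polar r t) 0 = ‖w t‖ * (1 * Real.cos (t + (w t).arg))
        rw [Real.cos_add]
        linear_combination (-Real.cos t) * e1 + Real.sin t * e2 - Real.cos t * e3 +
          Real.sin t * e4 - h (polar r t) 0 * e5
      · change h (polar r t) 1 = ‖w t‖ * (1 * Real.sin (t + (w t).arg))
        rw [Real.sin_add]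
        linear_combination (-Real.sin t) * e1 - Real.cos t * e2 - Real.sin t * e3 -
          Real.cos t * e4 - h (polar r t) 1 * e5
    have h2 : ‖h (polar r t)‖ = ‖w t‖ := by
      conv_lhs => rw [h1]
      rw [norm_smul, norm_polar_one, mul_one, norm_norm]
    rw [h2]
    exact h1

theorem Conjugates.locallyEquivalent {h : OpenPartialHomeomorph Plane Plane}
    {Z Z' : PiecewiseField} (hc : Conjugates h Z Z') (hs : PreservesSigns h) :
    LocallyEquivalent Z Z' := by
  refine ⟨h, hc.zero_mem, hc.map_zero, hs.preservesOrientation hc.zero_mem, fun p hp => ?_,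
    hc.carries, hc.carries_symm⟩
  have e : ∀ i, h p i = 0 ↔ p i = 0 := fun i => by
    rw [← sign_eq_zero_iff, hs p hp, sign_eq_zero_iff]
  rw [mem_switching, mem_switching, e, e]

end PiecewiseField

/-! ### Truncation -/

/-- The nearest point of `[-ε, ε]`. -/
def clamp (ε x : ℝ) : ℝ := max (-ε) (min ε x)

theorem continuous_clamp (ε : ℝ) : Continuous (clamp ε) := by unfold clamp; fun_prop

theorem abs_clamp_le {ε : ℝ} (hε : 0 ≤ ε) (x : ℝ) : |clamp ε x| ≤ ε :=
  abs_le.2 ⟨le_max_left _ _, max_le (by linarith) (min_le_left _ _)⟩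

theorem clamp_of_abs_le {ε x : ℝ} (h : |x| ≤ ε) : clamp ε x = x := by
  rw [abs_le] at h
  rw [clamp, min_eq_right h.2, max_eq_right h.1]

theorem clamp_of_le {ε x : ℝ} (hε : 0 ≤ ε) (h : ε ≤ x) : clamp ε x = ε := by
  rw [clamp, min_eq_left h, max_eq_right (by linarith)]

theorem clamp_neg {ε : ℝ} (hε : 0 ≤ ε) (x : ℝ) : clamp ε (-x) = -clamp ε x := by
  simp only [clamp, max_def, min_def]
  split_ifs <;> linarith

theorem clamp_pos {ε x : ℝ} (hε : 0 < ε) (h : 0 < x) : 0 < clamp ε x :=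
  lt_max_of_lt_right (lt_min hε h)

theorem abs_clamp_sub_le (ε x y : ℝ) : |clamp ε x - clamp ε y| ≤ |x - y| := by
  rw [clamp, clamp, max_comm (-ε), max_comm (-ε)]
  refine (abs_max_sub_max_le_abs _ _ _).trans ?_
  refine (abs_min_sub_min_le_max _ _ _ _).trans ?_
  rw [sub_self, abs_zero, max_eq_right (abs_nonneg _)]

namespace PiecewiseField

theorem dist_vec (x y y' : ℝ) : dist (!₂[x, y] : Plane) !₂[x, y'] = |y - y'| := by
  rw [EuclideanSpace.dist_eq, Fin.sum_univ_two]
  simp [Real.dist_eq, Real.sqrt_sq_eq_abs]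

/-- The field `V` on the box `[-ε, ε] × [-η, η]`, extended to the plane through the nearest point
of the box. -/
noncomputable def truncate (ε η : ℝ) (V : Plane → Plane) (p : Plane) : Plane :=
  V !₂[clamp ε (p 0), clamp η (p 1)]

theorem slope_truncate (ε η : ℝ) (V : Plane → Plane) (x y : ℝ) :
    slope (truncate ε η V) x y = slope V (clamp ε x) (clamp η y) := rfl

theorem truncate_eq {ε η : ℝ} {V : Plane → Plane} {p : Plane} (h0 : |p 0| ≤ ε) (h1 : |p 1| ≤ η) :
    truncate ε η V p = V p := by
  rw [truncate, clamp_of_abs_le h0, clamp_of_abs_le h1, eq_vec]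

theorem continuous_truncate {ε η : ℝ} (hε : 0 ≤ ε) (hη : 0 ≤ η) {V : Plane → Plane}
    (hV : ∀ p : Plane, |p 0| ≤ ε → |p 1| ≤ η → ContinuousAt V p) :
    Continuous (truncate ε η V) := by
  have h0 : ∀ i, Continuous fun p : Plane => p i := fun i => by fun_prop
  refine continuous_iff_continuousAt.2 fun p => ?_
  refine ContinuousAt.comp (f := fun p : Plane => (!₂[clamp ε (p 0), clamp η (p 1)] : Plane))
    (hV _ (abs_clamp_le hε _) (abs_clamp_le hη _)) ?_
  refine Continuous.continuousAt ((PiLp.continuous_toLp 2 _).comp (continuous_pi fun i => ?_))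
  fin_cases i
  · exact (continuous_clamp ε).comp (h0 0)
  · exact (continuous_clamp η).comp (h0 1)

theorem slopeField_truncate {ε η C : ℝ} {K : ℝ≥0} (hε : 0 ≤ ε) (hη : 0 ≤ η) {V : Plane → Plane}
    (hV : ∀ p : Plane, |p 0| ≤ ε → |p 1| ≤ η → ContinuousAt V p ∧ V p 0 ≠ 0)
    (hC : ∀ x y, |x| ≤ ε → |y| ≤ η → |slope V x y| ≤ C)
    (hK : ∀ x y y', |x| ≤ ε → |y| ≤ η → |y'| ≤ η → |slope V x y - slope V x y'| ≤ K * |y - y'|) :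
    SlopeField (slope (truncate ε η V)) where
  cont := by
    have hc := continuous_truncate hε hη fun p h0 h1 => (hV p h0 h1).1
    have hv : Continuous fun q : ℝ × ℝ => (!₂[q.1, q.2] : Plane) := by
      refine (PiLp.continuous_toLp 2 _).comp (continuous_pi fun i => ?_)
      fin_cases i
      · exact continuous_fst
      · exact continuous_snd
    have hi : ∀ i, Continuous fun q : ℝ × ℝ => truncate ε η V !₂[q.1, q.2] i := fun i =>
      (by fun_prop : Continuous fun p : Plane => p i).comp (hc.comp hv)
    exact (hi 1).div (hi 0) fun q => (hV _ (abs_clamp_le hε _) (abs_clamp_le hη _)).2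
  lip := ⟨K, fun x => LipschitzWith.of_dist_le_mul fun y y' => by
    rw [Real.dist_eq, Real.dist_eq, slope_truncate, slope_truncate]
    exact (hK _ _ _ (abs_clamp_le hε _) (abs_clamp_le hη _) (abs_clamp_le hη _)).trans
      (mul_le_mul_of_nonneg_left (abs_clamp_sub_le _ _ _) K.2)⟩
  bdd := ⟨C.toNNReal, fun x y => (hC _ _ (abs_clamp_le hε _) (abs_clamp_le hη _)).trans
    (Real.le_coe_toNNReal C)⟩

theorem continuousAt_slope {V : Plane → Plane} {p : Plane} (hV : ContinuousAt V p)
    (h0 : V p 0 ≠ 0) : ContinuousAt (fun q => V q 1 / V q 0) p := by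
  have hi : ∀ i, ContinuousAt (fun q => V q i) p := fun i =>
    (by fun_prop : Continuous fun p : Plane => p i).continuousAt.comp hV
  exact (hi 1).div (hi 0) h0

theorem contDiffAt_slope {V : Plane → Plane} {p : Plane} (hV : ContDiffAt ℝ 1 V p)
    (h0 : V p 0 ≠ 0) : ContDiffAt ℝ 1 (fun q => V q 1 / V q 0) p := by
  have hi := fun i => (contDiffAt_euclidean.1 hV) i
  exact (hi 1).div (hi 0) h0

theorem eventually_box {P : Plane → Prop} (h : ∀ᶠ p in 𝓝 (0 : Plane), P p) :
    ∃ ρ > 0, ∀ p : Plane, |p 0| ≤ ρ → |p 1| ≤ ρ → P p := by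
  obtain ⟨ε, hε, h⟩ := Metric.eventually_nhds_iff.1 h
  refine ⟨ε / 2, by positivity, fun p h0 h1 => h ?_⟩
  rw [dist_zero_right, EuclideanSpace.norm_eq, Fin.sum_univ_two, Real.norm_eq_abs,
    Real.norm_eq_abs, Real.sqrt_lt' hε]
  nlinarith [abs_nonneg (p 0), abs_nonneg (p 1)]

/-- On short vertical segments around a point of the horizontal axis the sign of the slope is that
at the point. -/
theorem exists_slope_bound {V : Plane → Plane} {x s : ℝ} (hV : ContinuousAt V !₂[x, 0])
    (h0 : V !₂[x, 0] 0 ≠ 0) (hs : 0 < s * slope V x 0) :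
    ∃ η > 0, ∃ m > 0, ∀ y, |y| ≤ η → m ≤ s * slope V x y := by
  have hc : ContinuousAt (fun y : ℝ => s * slope V x y) 0 := by
    refine continuousAt_const.mul (ContinuousAt.comp (f := fun y : ℝ => (!₂[x, y] : Plane))
      (continuousAt_slope hV h0) (Tame.continuous_vec continuous_const continuous_id).continuousAt)
  obtain ⟨η, hη, h⟩ := Metric.eventually_nhds_iff.1 (hc.eventually (lt_mem_nhds (half_lt_self hs)))
  refine ⟨η / 2, by positivity, _, half_pos hs, fun y hy => (h ?_).le⟩
  rw [Real.dist_eq, sub_zero]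
  linarith

theorem rightSigned_truncate {ε η s m : ℝ} (hε : 0 < ε) (hη : 0 ≤ η) {V : Plane → Plane}
    (hV : SlopeField (slope (truncate ε η V))) (hs : s * s = 1)
    (hpos : ∀ x, 0 < x → x ≤ ε → 0 < s * slope V x 0) (hm : 0 < m)
    (hfar : ∀ y, |y| ≤ η → m ≤ s * slope V ε y) : RightSigned (slope (truncate ε η V)) s where
  toSlopeField := hV
  sq := hs
  pos x hx := by
    rw [slope_truncate, clamp_of_abs_le (show |(0 : ℝ)| ≤ η by simpa using hη)]
    exact hpos _ (clamp_pos hε hx) ((le_abs_self _).trans (abs_clamp_le hε.le x))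
  far := ⟨ε, hε, m, hm, fun x y hx => by
    rw [slope_truncate, clamp_of_le hε.le hx]
    exact hfar _ (abs_clamp_le hη y)⟩

theorem leftSigned_truncate {ε η s m : ℝ} (hε : 0 < ε) (hη : 0 ≤ η) {V : Plane → Plane}
    (hV : SlopeField (slope (truncate ε η V))) (hs : s * s = 1)
    (hpos : ∀ x, 0 < x → x ≤ ε → 0 < s * slope V (-x) 0) (hm : 0 < m)
    (hfar : ∀ y, |y| ≤ η → m ≤ s * slope V (-ε) y) :
    RightSigned (fun x y => -slope (truncate ε η V) (-x) y) (-s) where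
  toSlopeField := hV.reflect
  sq := by rw [neg_mul_neg, hs]
  pos x hx := by
    rw [neg_mul_neg, slope_truncate, clamp_of_abs_le (show |(0 : ℝ)| ≤ η by simpa using hη),
      clamp_neg hε.le]
    exact hpos _ (clamp_pos hε hx) ((le_abs_self _).trans (abs_clamp_le hε.le x))
  far := ⟨ε, hε, m, hm, fun x y hx => by
    rw [neg_mul_neg, slope_truncate, clamp_neg hε.le, clamp_of_le hε.le hx]
    exact hfar _ (abs_clamp_le hη y)⟩

/-- A field of class `C¹` near the origin for which `Y` is steeper than `X` and `X₂` has constant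
signs on the two halves of the horizontal axis agrees with a tame field near the origin. -/
theorem tameAt_of_signs {Z : PiecewiseField} {a b sL sR : ℝ} (hX : ContDiffAt ℝ 1 Z.X 0)
    (hY : ContDiffAt ℝ 1 Z.Y 0) (ha : a * a = 1) (hb : b * b = 1) (hX0 : 0 < Z.X 0 0)
    (hY0 : 0 < a * Z.Y 0 0) (hY1 : 0 < b * Z.Y 0 1)
    (hsteep : |Z.X 0 1| * |Z.Y 0 0| < Z.X 0 0 * |Z.Y 0 1|) (hsL : sL * sL = 1)
    (hsR : sR * sR = 1) (hR : ∀ᶠ x : ℝ in 𝓝[>] 0, 0 < sR * Z.X !₂[x, 0] 1)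
    (hL : ∀ᶠ x : ℝ in 𝓝[>] 0, 0 < sL * Z.X !₂[-x, 0] 1) : Z.TameAt a b sL sR := by
  have hY0' : Z.Y 0 0 ≠ 0 := fun h => by simp [h] at hY0
  have hY1' : Z.Y 0 1 ≠ 0 := fun h => by simp [h] at hY1
  have eaY : |Z.Y 0 0| = a * Z.Y 0 0 := by
    rw [← abs_of_pos hY0, abs_mul]
    rcases mul_self_eq_one_iff.1 ha with h | h <;> simp [h]
  have ebY : |Z.Y 0 1| = b * Z.Y 0 1 := by
    rw [← abs_of_pos hY1, abs_mul]
    rcases mul_self_eq_one_iff.1 hb with h | h <;> simp [h]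
  have habY : a * b * (Z.Y 0 1 / Z.Y 0 0) = |Z.Y 0 1| / |Z.Y 0 0| := by
    have ha0 : a ≠ 0 := fun h => by simp [h] at ha
    rw [eaY, ebY]
    field_simp
    rw [sq, ha]; ring
  have hlt : |Z.X 0 1| / Z.X 0 0 < |Z.Y 0 1| / |Z.Y 0 0| := by
    rw [div_lt_div_iff₀ hX0 (abs_pos.2 hY0')]
    linarith
  -- `k` separates the slopes at the origin, hence nearby
  obtain ⟨k, hk1, hk2⟩ := exists_between hlt
  have hk0 : 0 < k := lt_of_le_of_lt (by positivity) hk1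
  have hX1k : |Z.X 0 1| < k * Z.X 0 0 := (div_lt_iff₀ hX0).1 hk1
  have hY1k : k * |Z.Y 0 0| < |Z.Y 0 1| := (lt_div_iff₀ (abs_pos.2 hY0')).1 hk2
  have habs : |b| = 1 := by rcases mul_self_eq_one_iff.1 hb with h | h <;> simp [h]
  have hcX : 0 < clock k b (Z.X 0) := by
    have : -(b * Z.X 0 1) ≤ |Z.X 0 1| := by
      refine (neg_le_abs _).trans ?_
      rw [abs_mul, habs, one_mul]
    simp only [clock]
    linarith
  have hcY : 0 < clock k b (Z.Y 0) := by
    have : -(Z.Y 0 0) ≤ |Z.Y 0 0| := neg_le_abs _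
    simp only [clock, ← ebY]
    nlinarith
  -- the open conditions
  have cX := hX.continuousAt
  have cY := hY.continuousAt
  have ci : ∀ i, Continuous fun p : Plane => p i := fun i => by fun_prop
  have cXi : ∀ i, ContinuousAt (fun p => Z.X p i) 0 := fun i => (ci i).continuousAt.comp cX
  have cYi : ∀ i, ContinuousAt (fun p => Z.Y p i) 0 := fun i => (ci i).continuousAt.comp cY
  have csX := continuousAt_slope cX hX0.ne'
  have csY := continuousAt_slope cY hY0'
  obtain ⟨K, T, hT, hKT⟩ := (contDiffAt_slope hX hX0.ne').exists_lipschitzOnWith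
  obtain ⟨K', T', hT', hKT'⟩ := (contDiffAt_slope hY hY0').exists_lipschitzOnWith
  set μ := min (clock k b (Z.X 0)) (clock k b (Z.Y 0)) / 2 with hμ
  have hμ0 : 0 < μ := half_pos (lt_min hcX hcY)
  have hμX : μ < clock k b (Z.X 0) := by
    have := min_le_left (clock k b (Z.X 0)) (clock k b (Z.Y 0)); rw [hμ]; linarith
  have hμY : μ < clock k b (Z.Y 0) := by
    have := min_le_right (clock k b (Z.X 0)) (clock k b (Z.Y 0)); rw [hμ]; linarith
  have hall : ∀ᶠ p in 𝓝 (0 : Plane), (ContinuousAt Z.X p ∧ ContinuousAt Z.Y p) ∧ 0 < Z.X p 0 ∧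
      0 < a * Z.Y p 0 ∧ 0 < b * Z.Y p 1 ∧ |Z.X p 1 / Z.X p 0| < k ∧
      (k < a * b * (Z.Y p 1 / Z.Y p 0) ∧ a * b * (Z.Y p 1 / Z.Y p 0) <
        a * b * (Z.Y 0 1 / Z.Y 0 0) + 1) ∧
      (‖Z.X p‖ < ‖Z.X 0‖ + 1 ∧ ‖Z.Y p‖ < ‖Z.Y 0‖ + 1) ∧
      (μ < clock k b (Z.X p) ∧ μ < clock k b (Z.Y p)) ∧ p ∈ T ∧ p ∈ T' := by
    have hXe := (hX.eventually (by simp)).mono fun p hp => hp.continuousAt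
    have hYe := (hY.eventually (by simp)).mono fun p hp => hp.continuousAt
    refine (hXe.and hYe).and (Eventually.and ?_ <| Eventually.and ?_ <| Eventually.and ?_ <|
      Eventually.and ?_ <| Eventually.and (Eventually.and ?_ ?_) <|
      Eventually.and (Eventually.and ?_ ?_) <| Eventually.and (Eventually.and ?_ ?_) <|
      Eventually.and hT hT')
    · exact (cXi 0).eventually (lt_mem_nhds hX0)
    · exact (continuousAt_const.mul (cYi 0)).eventually (lt_mem_nhds hY0)
    · exact (continuousAt_const.mul (cYi 1)).eventually (lt_mem_nhds hY1)
    · refine csX.abs.eventually (gt_mem_nhds ?_)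
      change |Z.X 0 1 / Z.X 0 0| < k
      rwa [abs_div, abs_of_pos hX0]
    · refine (continuousAt_const.mul csY).eventually (lt_mem_nhds ?_)
      change k < a * b * (Z.Y 0 1 / Z.Y 0 0)
      rwa [habY]
    · exact (continuousAt_const.mul csY).eventually (gt_mem_nhds (lt_add_one _))
    · exact cX.norm.eventually (gt_mem_nhds (lt_add_one _))
    · exact cY.norm.eventually (gt_mem_nhds (lt_add_one _))
    · exact ((continuous_clock k b).continuousAt.comp cX).eventually (lt_mem_nhds hμX)
    · exact ((continuous_clock k b).continuousAt.comp cY).eventually (lt_mem_nhds hμY)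
  obtain ⟨ρ, hρ, hall⟩ := eventually_box hall
  obtain ⟨ε, ⟨hε, hε1⟩, hερ⟩ : ∃ ε, (0 < ε ∧ ∀ x, 0 < x → x ≤ ε →
      0 < sR * Z.X !₂[x, 0] 1 ∧ 0 < sL * Z.X !₂[-x, 0] 1) ∧ ε ≤ ρ := by
    obtain ⟨u, hu, h⟩ := mem_nhdsGT_iff_exists_Ioc_subset.1 (hR.and hL)
    exact ⟨min u ρ, ⟨lt_min hu hρ, fun x hx hxu => h ⟨hx, hxu.trans (min_le_left _ _)⟩⟩,
      min_le_right _ _⟩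
  have hbox : ∀ x y, |x| ≤ ε → |y| ≤ ρ → _ := fun x y hx hy =>
    hall !₂[x, y] (hx.trans hερ) hy
  have hzρ : |(0 : ℝ)| ≤ ρ := by simpa using hρ.le
  have hslR : ∀ x, 0 < x → x ≤ ε → 0 < sR * slope Z.X x 0 := fun x hx hxε => by
    rw [slope, ← mul_div_assoc]
    exact div_pos (hε1 x hx hxε).1 (hbox x 0 (by rwa [abs_of_pos hx]) hzρ).2.1
  have hslL : ∀ x, 0 < x → x ≤ ε → 0 < sL * slope Z.X (-x) 0 := fun x hx hxε => by
    rw [slope, ← mul_div_assoc]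
    exact div_pos (hε1 x hx hxε).2 (hbox (-x) 0 (by rwa [abs_neg, abs_of_pos hx]) hzρ).2.1
  have hεε : |ε| ≤ ε := (abs_of_pos hε).le
  have hεn : |-ε| ≤ ε := (abs_neg ε).le.trans hεε
  -- the box is so flat that the slope of `X` keeps its sign on the two vertical sides
  obtain ⟨η₁, hη₁, m₁, hm₁, hfar₁⟩ := exists_slope_bound (hbox ε 0 hεε hzρ).1.1
    (hbox ε 0 hεε hzρ).2.1.ne' (hslR ε hε le_rfl)
  obtain ⟨η₂, hη₂, m₂, hm₂, hfar₂⟩ := exists_slope_bound (hbox (-ε) 0 hεn hzρ).1.1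
    (hbox (-ε) 0 hεn hzρ).2.1.ne' (hslL ε hε le_rfl)
  set η := min ρ (min η₁ η₂) with hη
  have hη0 : 0 < η := lt_min hρ (lt_min hη₁ hη₂)
  have hηρ : η ≤ ρ := min_le_left _ _
  have hη1 : η ≤ η₁ := (min_le_right _ _).trans (min_le_left _ _)
  have hη2 : η ≤ η₂ := (min_le_right _ _).trans (min_le_right _ _)
  have hab : a * b * (a * b) = 1 := by rw [mul_mul_mul_comm, ha, hb, one_mul]
  have hYne : ∀ {p : Plane}, 0 < a * Z.Y p 0 → Z.Y p 0 ≠ 0 := fun hp h => by simp [h] at hp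
  have hlip : ∀ {V : Plane → Plane} {K : ℝ≥0} {T : Set Plane},
      LipschitzOnWith K (fun q : Plane => V q 1 / V q 0) T →
      (∀ x y, |x| ≤ ε → |y| ≤ η → !₂[x, y] ∈ T) → ∀ x y y', |x| ≤ ε → |y| ≤ η → |y'| ≤ η →
      |slope V x y - slope V x y'| ≤ K * |y - y'| := by
    intro V K T h hT x y y' hx hy hy'
    have := h.dist_le_mul _ (hT x y hx hy) _ (hT x y' hx hy')
    rwa [dist_vec, Real.dist_eq] at this
  have hSX : SlopeField (slope (truncate ε η Z.X)) :=
    slopeField_truncate (C := k) hε.le hη0.le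
      (fun p h0 h1 => have := hall p (h0.trans hερ) (h1.trans hηρ); ⟨this.1.1, this.2.1.ne'⟩)
      (fun x y hx hy => (hbox x y hx (hy.trans hηρ)).2.2.2.2.1.le)
      (hlip hKT fun x y hx hy => (hbox x y hx (hy.trans hηρ)).2.2.2.2.2.2.2.2.1)
  have hSYb : ∀ x y, |x| ≤ ε → |y| ≤ η → k < a * b * slope Z.Y x y ∧
      a * b * slope Z.Y x y < a * b * (Z.Y 0 1 / Z.Y 0 0) + 1 := fun x y hx hy =>
    (hbox x y hx (hy.trans hηρ)).2.2.2.2.2.1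
  have hSY : SlopeField (slope (truncate ε η Z.Y)) :=
    slopeField_truncate (C := a * b * (Z.Y 0 1 / Z.Y 0 0) + 1) hε.le hη0.le
      (fun p h0 h1 => have := hall p (h0.trans hερ) (h1.trans hηρ); ⟨this.1.2, hYne this.2.2.1⟩)
      (fun x y hx hy => by
        have h1 := hSYb x y hx hy
        have h2 : |slope Z.Y x y| = a * b * slope Z.Y x y := by
          rw [← abs_of_pos (hk0.trans h1.1), abs_mul, abs_mul a b, habs,
            (show |a| = 1 by rcases mul_self_eq_one_iff.1 ha with h | h <;> simp [h]), one_mul,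
            one_mul]
        rw [h2]; exact h1.2.le)
      (hlip hKT' fun x y hx hy => (hbox x y hx (hy.trans hηρ)).2.2.2.2.2.2.2.2.2)
  have hb' : ∀ p : Plane, _ := fun p => hbox (clamp ε (p 0)) (clamp η (p 1))
    (abs_clamp_le hε.le _) ((abs_clamp_le hη0.le _).trans hηρ)
  have hz : |(0 : ℝ)| ≤ η := by simpa using hη0.le
  refine ⟨⟨truncate ε η Z.X, truncate ε η Z.Y⟩, k, {p | |p 0| < ε ∧ |p 1| < η}, ⟨?_, ?_, ha, hb,
    fun p => (hb' p).2.1, fun p => (hb' p).2.2.1, fun p => (hb' p).2.2.2.1, ⟨?_, ?_, ?_, ?_, ?_, ?_⟩,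
    ⟨max (‖Z.X 0‖ + 1) (‖Z.Y 0‖ + 1), fun p => ?_⟩, ⟨μ, hμ0, fun p => ?_⟩⟩, ?_, ?_, ?_, ?_⟩
  · exact continuous_truncate hε.le hη0.le fun p h0 h1 =>
      (hall p (h0.trans hερ) (h1.trans hηρ)).1.1
  · exact continuous_truncate hε.le hη0.le fun p h0 h1 =>
      (hall p (h0.trans hερ) (h1.trans hηρ)).1.2
  · exact rightSigned_truncate hε hη0.le hSX hsR hslR hm₁ fun y hy => hfar₁ y (hy.trans hη1)
  · exact leftSigned_truncate hε hη0.le hSX hsL hslL hm₂ fun y hy => hfar₂ y (hy.trans hη2)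
  · exact rightSigned_truncate hε hη0.le hSY hab (fun x hx hxε =>
      hk0.trans (hSYb x 0 (by rwa [abs_of_pos hx]) hz).1) hk0 fun y hy => (hSYb ε y hεε hy).1.le
  · exact leftSigned_truncate hε hη0.le hSY hab (fun x hx hxε =>
      hk0.trans (hSYb (-x) 0 (by rwa [abs_neg, abs_of_pos hx]) hz).1) hk0
      fun y hy => (hSYb (-ε) y hεn hy).1.le
  · exact fun x y => (hbox _ _ (abs_clamp_le hε.le x)
      ((abs_clamp_le hη0.le y).trans hηρ)).2.2.2.2.1
  · exact fun x y => (hSYb _ _ (abs_clamp_le hε.le x) (abs_clamp_le hη0.le y)).1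
  · have := (hb' p).2.2.2.2.2.2.1
    exact ⟨this.1.le.trans (le_max_left _ _), this.2.le.trans (le_max_right _ _)⟩
  · have := (hb' p).2.2.2.2.2.2.2.1
    exact ⟨this.1.le, this.2.le⟩
  · exact (isOpen_lt (ci 0).abs continuous_const).inter (isOpen_lt (ci 1).abs continuous_const)
  · exact ⟨by simpa using hε, by simpa using hη0⟩
  · exact fun p hp => (truncate_eq hp.1.le hp.2.le).symm
  · exact fun p hp => (truncate_eq hp.1.le hp.2.le).symm

end PiecewiseField

/-! ### Invariants of equivalence -/

namespace PiecewiseField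

/-- The curve stays on the switching set, away from the origin. -/
def Slides (I : Set ℝ) (c : ℝ → Plane) : Prop :=
  (∃ s ∈ I, ∃ t ∈ I, s < t) ∧ ∀ u ∈ I, c u ∈ switching ∧ c u ≠ 0

/-- The curve moves through the origin. -/
def Passes (I : Set ℝ) (c : ℝ → Plane) : Prop :=
  ∃ s ∈ I, ∃ t ∈ I, ∃ u ∈ I, s < t ∧ t < u ∧ c t = 0 ∧ c s ≠ 0

/-- The curve meets the switching set at one point, which is not the origin. -/
def Crosses (I : Set ℝ) (c : ℝ → Plane) : Prop :=
  ∃ t ∈ I, (∃ s ∈ I, s ≠ t) ∧ c t ∈ switching ∧ c t ≠ 0 ∧ ∀ s ∈ I, s ≠ t → c s ∉ switching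

/-- There are trajectories with the property `P` in every neighbourhood of the origin. -/
def Has (P : Set ℝ → (ℝ → Plane) → Prop) (Z : PiecewiseField) : Prop :=
  ∀ W ∈ 𝓝 (0 : Plane), ∃ I c, Z.IsTrajectory I c ∧ MapsTo c I W ∧ P I c

/-- The property `P` of curves depends only on the succession of the times at which the curve is on
the switching set and at the origin. -/
def IsInvariant (P : Set ℝ → (ℝ → Plane) → Prop) : Prop :=
  ∀ {I J : Set ℝ} {c d : ℝ → Plane} {τ : ℝ → ℝ}, StrictMonoOn τ J → τ '' J = I →
    (∀ t ∈ J, (d t = 0 ↔ c (τ t) = 0) ∧ (d t ∈ switching ↔ c (τ t) ∈ switching)) → P I c → P J d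

theorem isInvariant_slides : IsInvariant Slides := by
  rintro I J c d τ hτ rfl hd ⟨⟨_, ⟨s, hs, rfl⟩, _, ⟨t, ht, rfl⟩, hst⟩, h⟩
  refine ⟨⟨s, hs, t, ht, (hτ.lt_iff_lt hs ht).1 hst⟩, fun u hu => ?_⟩
  rw [(hd u hu).2, Ne, (hd u hu).1]
  exact h _ (mem_image_of_mem τ hu)

theorem isInvariant_passes : IsInvariant Passes := by
  rintro I J c d τ hτ rfl hd
    ⟨_, ⟨s, hs, rfl⟩, _, ⟨t, ht, rfl⟩, _, ⟨u, hu, rfl⟩, hst, htu, h1, h2⟩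
  exact ⟨s, hs, t, ht, u, hu, (hτ.lt_iff_lt hs ht).1 hst, (hτ.lt_iff_lt ht hu).1 htu,
    (hd t ht).1.2 h1, fun h => h2 ((hd s hs).1.1 h)⟩

theorem isInvariant_crosses : IsInvariant Crosses := by
  rintro I J c d τ hτ rfl hd ⟨_, ⟨t, ht, rfl⟩, ⟨_, ⟨s, hs, rfl⟩, hst⟩, h1, h2, h3⟩
  refine ⟨t, ht, ⟨s, hs, fun h => hst (h ▸ rfl)⟩, (hd t ht).2.2 h1, fun h => h2 ((hd t ht).1.1 h),
    fun u hu hut hsw => ?_⟩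
  exact h3 _ (mem_image_of_mem τ hu) (fun h => hut (hτ.injOn hu ht h)) ((hd u hu).2.1 hsw)

theorem Conjugates.symm {h : OpenPartialHomeomorph Plane Plane} {Z Z' : PiecewiseField}
    (hc : Conjugates h Z Z') : Conjugates h.symm Z' Z where
  zero_mem := by
    have := h.map_source hc.zero_mem
    rwa [hc.map_zero] at this
  map_zero := by
    have := h.left_inv hc.zero_mem
    rwa [hc.map_zero] at this
  carries := hc.carries_symm
  carries_symm := by rw [h.symm_symm]; exact hc.carries

/-- `h` maps the switching set to itself. -/
def PreservesSwitching (h : OpenPartialHomeomorph Plane Plane) : Prop :=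
  ∀ p ∈ h.source, h p ∈ switching ↔ p ∈ switching

theorem PreservesSwitching.symm {h : OpenPartialHomeomorph Plane Plane}
    (hs : PreservesSwitching h) : PreservesSwitching h.symm := fun p hp => by
  rw [← hs _ (h.map_target hp), h.right_inv hp]

theorem Conjugates.has {h : OpenPartialHomeomorph Plane Plane} {Z Z' : PiecewiseField}
    (hc : Conjugates h Z Z') (hs : PreservesSwitching h) {P : Set ℝ → (ℝ → Plane) → Prop}
    (hP : IsInvariant P) (hZ : Has P Z) : Has P Z' := by
  intro W hW
  have h1 : h.source ∩ h ⁻¹' W ∈ 𝓝 (0 : Plane) := by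
    refine inter_mem (h.open_source.mem_nhds hc.zero_mem) ?_
    refine (h.continuousAt hc.zero_mem).preimage_mem_nhds ?_
    rwa [hc.map_zero]
  obtain ⟨I, c, htraj, hI, hPc⟩ := hZ _ h1
  obtain ⟨J, τ, hτ, hτi, htraj'⟩ := hc.carries I c htraj fun t ht => (hI ht).1
  have hmem : ∀ t ∈ J, c (τ t) ∈ h.source ∩ h ⁻¹' W := fun t ht =>
    hI (hτi ▸ mem_image_of_mem τ ht)
  refine ⟨J, _, htraj', fun t ht => (hmem t ht).2, hP hτ hτi (fun t ht => ⟨?_, ?_⟩) hPc⟩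
  · constructor
    · intro h0
      exact h.injOn (hmem t ht).1 hc.zero_mem (h0.trans hc.map_zero.symm)
    · intro h0
      simp only [h0, hc.map_zero]
  · exact hs _ (hmem t ht).1

theorem Conjugates.has_iff {h : OpenPartialHomeomorph Plane Plane} {Z Z' : PiecewiseField}
    (hc : Conjugates h Z Z') (hs : PreservesSwitching h) {P : Set ℝ → (ℝ → Plane) → Prop}
    (hP : IsInvariant P) : Has P Z ↔ Has P Z' :=
  ⟨hc.has hs hP, hc.symm.has hs.symm hP⟩

theorem AgreeOn.has {Z Z' : PiecewiseField} {W : Set Plane} (h : AgreeOn Z Z' W)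
    (hZ : Z.NoTangency W) {P : Set ℝ → (ℝ → Plane) → Prop} (hP : Has P Z) : Has P Z' := by
  intro V hV
  obtain ⟨I, c, htraj, hI, hPc⟩ := hP _ (inter_mem hV (h.isOpen.mem_nhds h.zero_mem))
  exact ⟨I, c, h.isTrajectory hZ (fun t ht => (hI ht).2) htraj, fun t ht => (hI ht).1, hPc⟩

theorem AgreeOn.has_iff {Z Z' : PiecewiseField} {W : Set Plane} (h : AgreeOn Z Z' W)
    (hZ : Z'.NoTangency W) {P : Set ℝ → (ℝ → Plane) → Prop} : Has P Z ↔ Has P Z' :=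
  ⟨h.has (h.symm.noTangency hZ), h.symm.has hZ⟩

theorem neBot_nhdsWithin_diff {I : Set ℝ} (hI : I.OrdConnected) {s t : ℝ} (hs : s ∈ I) (ht : t ∈ I)
    (hst : s ≠ t) : (𝓝[I \ {t}] t).NeBot := by
  rcases hst.lt_or_gt with h | h
  · have : Ioo s t ⊆ I \ {t} := fun u hu =>
      ⟨hI.out hs ht ⟨hu.1.le, hu.2.le⟩, fun he => hu.2.ne he⟩
    refine NeBot.mono ?_ (nhdsWithin_mono t this)
    rw [nhdsWithin_Ioo_eq_nhdsLT h]
    infer_instance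
  · have : Ioo t s ⊆ I \ {t} := fun u hu =>
      ⟨hI.out ht hs ⟨hu.1.le, hu.2.le⟩, fun he => hu.1.ne' he⟩
    refine NeBot.mono ?_ (nhdsWithin_mono t this)
    rw [nhdsWithin_Ioo_eq_nhdsGT h]
    infer_instance

theorem strictIncAt_of_eventuallyEq {I : Set ℝ} {f : ℝ → ℝ} {t : ℝ}
    (h : ∀ s, f s = s) : StrictIncAt I f t :=
  Eventually.of_forall fun s => by rw [h, h]; exact ⟨id, id⟩

/-- Uniform motion along `Σ_i`. -/
noncomputable def axisCurve (b : ℝ) (i : Fin 2) (s : ℝ) : Plane :=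
  EuclideanSpace.single (i + 1) (slideDir b i * s)

theorem axisCurve_self (b : ℝ) (i : Fin 2) (s : ℝ) : axisCurve b i s i = 0 := by
  fin_cases i <;> simp [axisCurve]

theorem axisCurve_other (b : ℝ) (i : Fin 2) (s : ℝ) :
    axisCurve b i s (i + 1) = slideDir b i * s := by
  simp [axisCurve]

theorem continuous_axisCurve (b : ℝ) (i : Fin 2) : Continuous (axisCurve b i) := by
  refine (PiLp.continuous_toLp 2 _).comp (continuous_pi fun j => ?_)
  fin_cases i <;> fin_cases j <;> simp [slideDir] <;> fun_prop

theorem axisCurve_zero (b : ℝ) (i : Fin 2) : axisCurve b i 0 = 0 := by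
  simp [axisCurve]

theorem Tame.slideDir_sq {Z : PiecewiseField} {a b sL sR k : ℝ} (h : Z.Tame a b sL sR k)
    (i : Fin 2) : slideDir b i * slideDir b i = 1 := by
  fin_cases i
  · exact h.sqb
  · exact one_mul 1

theorem Tame.axisCurve_ne_zero {Z : PiecewiseField} {a b sL sR k : ℝ} (h : Z.Tame a b sL sR k)
    (i : Fin 2) {s : ℝ} (hs : s ≠ 0) : axisCurve b i s ≠ 0 := by
  intro h0
  have h1 := axisCurve_other b i s
  rw [h0] at h1
  have h2 := h.slideDir_sq i
  rcases mul_eq_zero.1 h1.symm with h3 | h3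
  · rw [h3, mul_zero] at h2; exact zero_ne_one h2
  · exact hs h3

theorem Tame.exists_sliding_trajectory {Z : PiecewiseField} {a b sL sR k : ℝ}
    (h : Z.Tame a b sL sR k) (i : Fin 2) {I : Set ℝ} (hI : I.OrdConnected)
    (hS : ∀ s ∈ I, s ≠ 0 → axisCurve b i s ∈ Z.slidEsc i)
    (h0 : (0 : ℝ) ∈ I → Z.SlidesThroughOrigin i) :
    ∃ (K : Set ℝ) (τ : ℝ → ℝ), StrictMonoOn τ K ∧ τ '' K = I ∧
      Z.IsTrajectory K (fun t => axisCurve b i (τ t)) := by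
  refine h.exists_isTrajectory hI (continuous_axisCurve b i).continuousOn fun t ht => ?_
  have hm : StrictIncAt I (fun s => slideDir b i * axisCurve b i s (i + 1)) t :=
    strictIncAt_of_eventuallyEq fun s => by
      rw [axisCurve_other, ← mul_assoc, h.slideDir_sq, one_mul]
  by_cases h1 : t = 0
  · subst h1
    refine .origin_slide i (axisCurve_zero b i) (h0 ht) ?_ hm
    refine eventually_nhdsWithin_of_forall fun s hs => ?_
    by_cases h2 : s = 0
    · rw [h2, axisCurve_zero]; exact mem_insert _ _
    · exact Or.inr (hS s hs h2)
  · exact .slide i (hS t ht h1) (Eventually.of_forall fun s => axisCurve_self b i s) hm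

theorem exists_Icc_mapsTo {c : ℝ → Plane} (hc : Continuous c) (h0 : c 0 = 0) {W : Set Plane}
    (hW : W ∈ 𝓝 (0 : Plane)) : ∃ ε > 0, MapsTo c (Icc (-ε) ε) W := by
  have h1 : c ⁻¹' W ∈ 𝓝 (0 : ℝ) := hc.continuousAt.preimage_mem_nhds (by rwa [h0])
  obtain ⟨ε, hε, h⟩ := Metric.nhds_basis_closedBall.mem_iff.1 h1
  rw [Real.closedBall_eq_Icc, zero_sub, zero_add] at h
  exact ⟨ε, hε, h⟩

namespace Tame

variable {Z : PiecewiseField} {a b sL sR k : ℝ}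

theorem has_passes (h : Z.Tame a b sL sR k) (i : Fin 2) (hS : ∀ s ≠ 0, axisCurve b i s ∈ Z.slidEsc i)
    (h0 : Z.SlidesThroughOrigin i) : Has Passes Z := by
  intro W hW
  obtain ⟨ε, hε, hm⟩ := exists_Icc_mapsTo (continuous_axisCurve b i) (axisCurve_zero b i) hW
  obtain ⟨K, τ, hτ, hτi, htraj⟩ := h.exists_sliding_trajectory i (ordConnected_Icc (a := -ε) (b := ε))
    (fun s _ hs => hS s hs) fun _ => h0
  refine ⟨K, _, htraj, fun t ht => hm (hτi ▸ mem_image_of_mem τ ht),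
    isInvariant_passes hτ hτi (fun t _ => ⟨Iff.rfl, Iff.rfl⟩) ?_⟩
  exact ⟨-ε, ⟨le_rfl, by linarith⟩, 0, ⟨by linarith, hε.le⟩, ε, ⟨by linarith, le_rfl⟩,
    by linarith, hε, axisCurve_zero b i, h.axisCurve_ne_zero i (by linarith)⟩

theorem has_slides (h : Z.Tame a b sL sR k) (hs : sL = -b ∨ sR = -b) : Has Slides Z := by
  intro W hW
  obtain ⟨ε, hε, hm⟩ := exists_Icc_mapsTo (continuous_axisCurve b 1) (axisCurve_zero b 1) hW
  have hval : ∀ s, axisCurve b 1 s 0 = s := fun s => (axisCurve_other b 1 s).trans (one_mul s)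
  obtain ⟨u, v, huv, hsub, hz, hS⟩ : ∃ u v : ℝ, u < v ∧ Icc u v ⊆ Icc (-ε) ε ∧
      (0 : ℝ) ∉ Icc u v ∧ ∀ s ∈ Icc u v, axisCurve b 1 s ∈ Z.slidEsc 1 := by
    rcases hs with hs | hs
    · refine ⟨-ε, -ε / 2, by linarith, Icc_subset_Icc le_rfl (by linarith),
        fun h => by linarith [h.2], fun s hsI => ?_⟩
      rw [h.mem_slidEsc_one, hval]
      exact ⟨axisCurve_self b 1 s, Or.inr ⟨by linarith [hsI.2], hs⟩⟩
    · refine ⟨ε / 2, ε, by linarith, Icc_subset_Icc (by linarith) le_rfl,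
        fun h => by linarith [h.1], fun s hsI => ?_⟩
      rw [h.mem_slidEsc_one, hval]
      exact ⟨axisCurve_self b 1 s, Or.inl ⟨by linarith [hsI.1], hs⟩⟩
  obtain ⟨K, τ, hτ, hτi, htraj⟩ := h.exists_sliding_trajectory 1 (ordConnected_Icc (a := u) (b := v))
    (fun s hs _ => hS s hs) fun h => absurd h hz
  refine ⟨K, _, htraj, fun t ht => hm (hsub (hτi ▸ mem_image_of_mem τ ht)),
    isInvariant_slides hτ hτi (fun t _ => ⟨Iff.rfl, Iff.rfl⟩) ?_⟩
  refine ⟨⟨u, ⟨le_rfl, huv.le⟩, v, ⟨huv.le, le_rfl⟩, huv⟩, fun s hs => ⟨?_, ?_⟩⟩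
  · exact mem_axis_switching (axisCurve_self b 1 s)
  · exact h.axisCurve_ne_zero 1 fun h0 => hz (h0 ▸ hs)

theorem not_has_of_forall {P : Set ℝ → (ℝ → Plane) → Prop} (h : ∀ I c, Z.IsTrajectory I c → ¬ P I c) :
    ¬ Has P Z := fun hP => by
  obtain ⟨I, c, hc, -, hPc⟩ := hP _ univ_mem
  exact h I c hc hPc

/-- If the whole switching set is crossing, no trajectory stays on it. -/
theorem not_has_slides (h : Z.Tame 1 b b b k) : ¬ Has Slides Z := by
  refine not_has_of_forall fun I c hc hP => ?_
  obtain ⟨⟨s, hs, t, ht, hst⟩, hall⟩ := hP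
  have hne := neBot_nhdsWithin_diff hc.1 hs ht hst.ne
  have hb := h.b_ne_neg
  obtain ⟨hsw, h0⟩ := hall t ht
  cases h.admissibleAt hc ht with
  | pos h1 => exact ne_of_gt h1 hsw
  | neg h1 => exact ne_of_lt h1 hsw
  | slide i h1 =>
    fin_cases i
    · have := (h.mem_slidEsc_zero.1 h1).2.2; norm_num at this
    · rcases (h.mem_slidEsc_one.1 h1).2 with h2 | h2 <;> exact hb h2.2
  | cross i h1 _ hi =>
    obtain ⟨u, hu, huI⟩ := (hi.and self_mem_nhdsWithin).exists
    exact hu (hall u huI.1).1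
  | origin_pos h1 => exact h0 h1
  | origin_neg h1 => exact h0 h1
  | origin_slide i h1 => exact h0 h1
  | origin_rest h1 => exact h0 (h1 t ht)

theorem exists_near {I : Set ℝ} (hI : I.OrdConnected) {s t u : ℝ} (hs : s ∈ I) (hu : u ∈ I)
    (hst : s < t) (htu : t < u) {Q : ℝ → Prop} (hQ : ∀ᶠ r in 𝓝[I] t, Q r) :
    (∃ r, r < t ∧ Q r) ∧ ∃ r, t < r ∧ Q r := by
  have h1 : I ∈ 𝓝 t := mem_of_superset (Icc_mem_nhds hst htu) (hI.out hs hu)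
  rw [nhdsWithin_eq_nhds.2 h1] at hQ
  exact ⟨((hQ.filter_mono nhdsWithin_le_nhds).and self_mem_nhdsWithin :
      ∀ᶠ r in 𝓝[<] t, Q r ∧ r ∈ Iio t).exists.imp fun r hr => ⟨hr.2, hr.1⟩,
    ((hQ.filter_mono nhdsWithin_le_nhds).and self_mem_nhdsWithin :
      ∀ᶠ r in 𝓝[>] t, Q r ∧ r ∈ Ioi t).exists.imp fun r hr => ⟨hr.2, hr.1⟩⟩

/-- If exactly one half of `Σ₂` is crossing, no trajectory passes through the origin. -/
theorem not_has_passes (h : Z.Tame a b sL sR k) (hs : sL ≠ sR) : ¬ Has Passes Z := by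
  refine not_has_of_forall fun I c hc hP => ?_
  obtain ⟨s, hsI, t, ht, u, hu, hst, htu, h0, hs0⟩ := hP
  cases h.admissibleAt hc ht with
  | pos h1 => exact zero_notMem_regionPos (h0 ▸ h1)
  | neg h1 => exact zero_notMem_regionNeg (h0 ▸ h1)
  | slide i h1 => exact (mem_slidEsc.1 h1).2.1 (by rw [h0]; rfl)
  | cross i h1 h2 => exact h2 h0
  | origin_pos h1 hA =>
    have := h.allCrossing_iff.1 hA; exact hs (this.2.1.trans this.2.2.symm)
  | origin_neg h1 hA =>
    have := h.allCrossing_iff.1 hA; exact hs (this.2.1.trans this.2.2.symm)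
  | origin_rest h1 => exact hs0 (h1 s hsI)
  | origin_slide i h1 hS hi hm =>
    fin_cases i
    · have := h.slidesThroughOrigin_zero_iff.1 hS
      exact hs (this.2.1.trans this.2.2.symm)
    · obtain ⟨⟨r, hr, hr1, hr2⟩, ⟨q, hq, hq1, hq2⟩⟩ :=
        exists_near hc.1 hsI hu hst htu (hi.and hm)
      have hr3 : 1 * c r 0 < 1 * c t 0 := hr2.1 hr
      have hq3 : 1 * c t 0 < 1 * c q 0 := hq2.2 hq
      have e0 : c t 0 = 0 := by rw [h0]; rfl
      rw [one_mul, one_mul, e0] at hr3 hq3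
      have hr4 : sL = -b := by
        rcases hr1 with h5 | h5
        · rw [h5] at hr3; exact absurd hr3 (lt_irrefl _)
        · rcases (h.mem_slidEsc_one.1 h5).2 with h6 | h6
          · exact absurd hr3 (not_lt.2 h6.1.le)
          · exact h6.2
      have hq4 : sR = -b := by
        rcases hq1 with h5 | h5
        · rw [h5] at hq3; exact absurd hq3 (lt_irrefl _)
        · rcases (h.mem_slidEsc_one.1 h5).2 with h6 | h6
          · exact h6.2
          · exact absurd hq3 (not_lt.2 h6.1.le)
      exact hs (hr4.trans hq4.symm)

/-- If every point of `Σ` other than the origin slides, `Σ` is never crossed. -/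
theorem not_has_crosses (h : Z.Tame (-1) b (-b) (-b) k) : ¬ Has Crosses Z := by
  refine not_has_of_forall fun I c hc hP => ?_
  obtain ⟨t, ht, ⟨s, hs, hst⟩, hsw, h0, hall⟩ := hP
  have hne := neBot_nhdsWithin_diff hc.1 hs ht hst
  have hb := h.b_ne_neg
  cases h.admissibleAt hc ht with
  | pos h1 => exact ne_of_gt h1 hsw
  | neg h1 => exact ne_of_lt h1 hsw
  | slide i h1 hi =>
    obtain ⟨u, hu, huI⟩ := ((hi.filter_mono (nhdsWithin_mono t sdiff_subset)).and
      (self_mem_nhdsWithin (s := I \ {t}))).exists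
    exact hall u huI.1 huI.2 (mem_axis_switching hu)
  | cross i h1 =>
    fin_cases i
    · have := (h.mem_crossing_zero.1 h1).2; norm_num at this
    · rcases ((h.mem_crossing_one h0).1 h1).2 with h2 | h2 <;> exact hb h2.2.symm
  | origin_pos h1 => exact h0 h1
  | origin_neg h1 => exact h0 h1
  | origin_slide i h1 => exact h0 h1
  | origin_rest h1 => exact h0 (h1 t ht)

/-- Near a crossing point of `Σ₂` the orbit of `X` through it gives a crossing trajectory. -/
theorem has_crosses (h : Z.Tame a b sL sR k) (hs : sL = b ∨ sR = b) : Has Crosses Z := by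
  intro W hW
  obtain ⟨W', hW'W, hW'o, hW'0⟩ := mem_nhds_iff.1 hW
  obtain ⟨ε, hε, hm⟩ := exists_Icc_mapsTo (continuous_axisCurve b 1) (axisCurve_zero b 1)
    (hW'o.mem_nhds hW'0)
  have hval : ∀ s, axisCurve b 1 s 0 = s := fun s => (axisCurve_other b 1 s).trans (one_mul s)
  obtain ⟨x, hx0, hxε, hcr, hX⟩ : ∃ x : ℝ, x ≠ 0 ∧ x ∈ Icc (-ε) ε ∧
      axisCurve b 1 x ∈ Z.crossing 1 ∧ 0 < b * Z.X (axisCurve b 1 x) 1 := by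
    rcases hs with hs | hs
    · have h0 : axisCurve b 1 (-ε) ≠ 0 := h.axisCurve_ne_zero 1 (by linarith)
      have hlt : axisCurve b 1 (-ε) 0 < 0 := by rw [hval]; linarith
      refine ⟨-ε, by linarith, ⟨le_rfl, by linarith⟩, ?_, ?_⟩
      · rw [h.mem_crossing_one h0]
        exact ⟨axisCurve_self b 1 _, Or.inr ⟨hlt, hs⟩⟩
      · rw [← hs]; exact h.left_pos hlt (axisCurve_self b 1 _)
    · have h0 : axisCurve b 1 ε ≠ 0 := h.axisCurve_ne_zero 1 hε.ne'
      have hlt : 0 < axisCurve b 1 ε 0 := by rw [hval]; exact hε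
      refine ⟨ε, hε.ne', ⟨by linarith, le_rfl⟩, ?_, ?_⟩
      · rw [h.mem_crossing_one h0]
        exact ⟨axisCurve_self b 1 _, Or.inl ⟨hlt, hs⟩⟩
      · rw [← hs]; exact h.right_pos hlt (axisCurve_self b 1 _)
  set p := axisCurve b 1 x with hp
  set y₀ := orbitHeight Z.X p with hy₀
  have hp1 : p 1 = 0 := axisCurve_self b 1 x
  have hp0 : p 0 = x := hval x
  set c : ℝ → Plane := fun s => !₂[s, SlopeField.flow (slope Z.X) s y₀] with hc
  have hcc : Continuous c := continuous_vec continuous_id (h.slopeX.continuous_flow_left y₀)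
  have hcx : c x = p := by
    have : SlopeField.flow (slope Z.X) x y₀ = p 1 := by
      rw [hy₀, orbitHeight, ← hp0, h.slopeX.flow_height]
    rw [hc]
    simp only [this]
    rw [← hp0, eq_vec]
  have hheight : ∀ s, orbitHeight Z.X (c s) = y₀ := fun s => h.slopeX.height_flow s y₀
  have hder : HasDerivAt (fun s => b * c s 1) (b * (Z.X p 1 / Z.X p 0)) x := by
    have h1 := (h.slopeX.hasDerivAt_flow x y₀).const_mul b
    have e : slope Z.X x (SlopeField.flow (slope Z.X) x y₀) = Z.X p 1 / Z.X p 0 := by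
      rw [← slope_apply, hp0]
      congr 1
      rw [← hcx]
      rfl
    rwa [e] at h1
  have hinc : StrictIncAt univ (fun s => b * c s 1) x := .of_hasDerivWithinAt hder.hasDerivWithinAt
    (by rw [← mul_div_assoc]; exact div_pos hX (h.X_zero p))
  have hmemW : c ⁻¹' W' ∈ 𝓝 x := hcc.continuousAt.preimage_mem_nhds (hW'o.mem_nhds (by
    rw [hcx]; exact hm hxε))
  rw [StrictIncAt, nhdsWithin_univ] at hinc
  have hside : ∀ᶠ s in 𝓝 x, 0 < s * x := by
    have hcont : Continuous fun s : ℝ => s * x := by fun_prop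
    exact hcont.continuousAt.eventually (lt_mem_nhds (mul_self_pos.2 hx0))
  obtain ⟨η, hη, hball⟩ := Metric.nhds_basis_closedBall.mem_iff.1
    (inter_mem hmemW (inter_mem hinc hside))
  rw [Real.closedBall_eq_Icc] at hball
  have hcx1 : c x 1 = 0 := by rw [hcx, hp1]
  -- the side on which the orbit lies in the region of `X`
  obtain ⟨u, v, huv, hxuv, hsub, hreg⟩ : ∃ u v : ℝ, u < v ∧ x ∈ Icc u v ∧
      Icc u v ⊆ Icc (x - η) (x + η) ∧ ∀ s ∈ Icc u v, s ≠ x → c s ∈ regionPos := by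
    have key : ∀ s ∈ Icc (x - η) (x + η), 0 < (b * x) * (s - x) → c s ∈ regionPos := by
      intro s hs hpos
      obtain ⟨-, h2, h3⟩ := hball hs
      have h3 : 0 < s * x := h3
      have h2 : (s < x → b * c s 1 < b * c x 1) ∧ (x < s → b * c x 1 < b * c s 1) := h2
      rw [hcx1, mul_zero] at h2
      change 0 < s * c s 1
      have h4 : 0 < (s - x) * (b * c s 1) := by
        rcases lt_trichotomy s x with h | h | h
        · exact mul_pos_of_neg_of_neg (by linarith) (h2.1 h)
        · rw [h, sub_self, mul_zero] at hpos; exact absurd hpos (lt_irrefl _)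
        · exact mul_pos (by linarith) (h2.2 h)
      have h5 : 0 < (b * x * (s - x)) * (s - x) * (b * c s 1) * (s * x) := by
        rw [mul_assoc _ (s - x)]
        exact mul_pos (mul_pos hpos h4) h3
      have h6 : (b * x * (s - x)) * (s - x) * (b * c s 1) * (s * x) =
          (b * b) * (x * (s - x)) ^ 2 * (s * c s 1) := by ring
      rw [h6, h.sqb, one_mul] at h5
      exact pos_of_mul_pos_right h5 (sq_nonneg _)
    have hbx : b * x ≠ 0 := mul_ne_zero (fun hb => by have := h.sqb; simp [hb] at this) hx0
    rcases hbx.lt_or_gt with hneg | hpos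
    · refine ⟨x - η, x, by linarith, ⟨by linarith, le_rfl⟩, Icc_subset_Icc le_rfl (by linarith),
        fun s hs hsx => key s ⟨hs.1, by linarith [hs.2]⟩ ?_⟩
      exact mul_pos_of_neg_of_neg hneg (sub_neg.2 (lt_of_le_of_ne hs.2 hsx))
    · refine ⟨x, x + η, by linarith, ⟨le_rfl, by linarith⟩, Icc_subset_Icc (by linarith) le_rfl,
        fun s hs hsx => key s ⟨by linarith [hs.1], hs.2⟩ ?_⟩
      exact mul_pos hpos (sub_pos.2 (lt_of_le_of_ne hs.1 (Ne.symm hsx)))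
  have hp0' : p ≠ 0 := h.axisCurve_ne_zero 1 hx0
  obtain ⟨K, τ, hτ, hτi, htraj⟩ := h.exists_isTrajectory (ordConnected_Icc (a := u) (b := v))
    hcc.continuousOn fun t ht => by
      by_cases htx : t = x
      · subst htx
        refine .cross 1 (hcx ▸ hcr) (hcx ▸ hp0') ?_
        exact eventually_nhdsWithin_of_forall fun s hs hsw => ne_of_gt (hreg s hs.1 hs.2) hsw
      · exact .pos (hreg t ht htx) (Eventually.of_forall fun s => by rw [hheight, hheight])
          (strictIncAt_of_eventuallyEq fun s => rfl)
  refine ⟨K, _, htraj, fun t ht => hW'W (hball (hsub (hτi ▸ mem_image_of_mem τ ht))).1,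
    isInvariant_crosses hτ hτi (fun t _ => ⟨Iff.rfl, Iff.rfl⟩) ?_⟩
  refine ⟨x, hxuv, ?_, by rw [hcx]; exact mem_axis_switching hp1, by rwa [hcx],
    fun s hs hsx hsw => ne_of_gt (hreg s hs hsx) hsw⟩
  by_cases hux : u = x
  · exact ⟨v, ⟨huv.le, le_rfl⟩, by rw [← hux]; exact huv.ne'⟩
  · exact ⟨u, ⟨le_rfl, huv.le⟩, hux⟩

theorem has_slides_iff (h : Z.Tame 1 b sL sR k) : Has Slides Z ↔ sL = -b ∨ sR = -b := by
  refine ⟨fun hS => ?_, h.has_slides⟩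
  by_contra! hc
  obtain rfl := h.sL_cases.resolve_right hc.1
  obtain rfl := h.sR_cases.resolve_right hc.2
  exact h.not_has_slides hS

theorem has_crosses_iff (h : Z.Tame (-1) b sL sR k) : Has Crosses Z ↔ sL = b ∨ sR = b := by
  refine ⟨fun hS => ?_, h.has_crosses⟩
  by_contra! hc
  obtain rfl := h.sL_cases.resolve_left hc.1
  obtain rfl := h.sR_cases.resolve_left hc.2
  exact h.not_has_crosses hS

theorem has_passes_of_sliding (h : Z.Tame 1 b sL sR k) (hL : sL = -b) (hR : sR = -b) :
    Has Passes Z := by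
  refine h.has_passes 1 (fun s hs => ?_) (h.slidesThroughOrigin_one_iff.2 ⟨rfl, Or.inl hL⟩)
  have hval : axisCurve b 1 s 0 = s := (axisCurve_other b 1 s).trans (one_mul s)
  rw [h.mem_slidEsc_one, hval]
  refine ⟨axisCurve_self b 1 s, ?_⟩
  rcases hs.lt_or_gt with h1 | h1
  · exact Or.inr ⟨h1, hL⟩
  · exact Or.inl ⟨h1, hR⟩

theorem has_passes_of_crossing (h : Z.Tame (-1) b sL sR k) (hL : sL = b) (hR : sR = b) :
    Has Passes Z := by
  refine h.has_passes 0 (fun s hs => ?_) (h.slidesThroughOrigin_zero_iff.2 ⟨rfl, hL, hR⟩)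
  rw [h.mem_slidEsc_zero]
  refine ⟨axisCurve_self b 0 s, fun h1 => ?_, rfl⟩
  exact h.axisCurve_ne_zero 0 hs (plane_eq_zero (axisCurve_self b 0 s) h1)

end Tame

/-- The signs of `X₂` on the two halves of `Σ₂` are invariants of equivalence. If `Σ₁` is crossing
(`a = 1`), nothing slides exactly for the type `(b, b)`; if `Σ₁` slides (`a = -1`), nothing crosses
exactly for `(-b, -b)`. In both cases trajectories move through the origin for the type in which one
of the lines slides and the other one is crossing, and for `sL ≠ sR` they do not. -/
theorem TameAt.signs_eq {Z Z' : PiecewiseField} {a b sL sR sL' sR' : ℝ} (hZ : Z.TameAt a b sL sR)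
    (hZ' : Z'.TameAt a b sL' sR') (hle : sL ≤ sR) (hle' : sL' ≤ sR')
    {h : OpenPartialHomeomorph Plane Plane} (hc : Conjugates h Z Z') (hs : PreservesSwitching h) :
    sL = sL' ∧ sR = sR' := by
  obtain ⟨Y, k, W, hY, hW⟩ := hZ
  obtain ⟨Y', k', W', hY', hW'⟩ := hZ'
  have key : ∀ {P : Set ℝ → (ℝ → Plane) → Prop}, IsInvariant P → (Has P Y ↔ Has P Y') := fun hP =>
    ((hW.has_iff (hY.noTangency W)).symm.trans (hc.has_iff hs hP)).trans
      (hW'.has_iff (hY'.noTangency W'))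
  have hp := key isInvariant_passes
  have hsl := key isInvariant_slides
  have hcr := key isInvariant_crosses
  have hb := hY.b_cases
  have hL := hY.sL_cases
  have hR := hY.sR_cases
  have hL' := hY'.sL_cases
  have hR' := hY'.sR_cases
  have hn := fun h => hY.not_has_passes h
  have hn' := fun h => hY'.not_has_passes h
  rcases hY.a_cases with rfl | rfl
  · rw [hY.has_slides_iff, hY'.has_slides_iff] at hsl
    have hy := fun h1 h2 => hY.has_passes_of_sliding h1 h2
    have hy' := fun h1 h2 => hY'.has_passes_of_sliding h1 h2
    rcases hb with rfl | rfl <;> rcases hL with rfl | rfl <;> rcases hR with rfl | rfl <;>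
      rcases hL' with rfl | rfl <;> rcases hR' with rfl | rfl <;> norm_num at * <;> tauto
  · rw [hY.has_crosses_iff, hY'.has_crosses_iff] at hcr
    have hy := fun h1 h2 => hY.has_passes_of_crossing h1 h2
    have hy' := fun h1 h2 => hY'.has_passes_of_crossing h1 h2
    rcases hb with rfl | rfl <;> rcases hL with rfl | rfl <;> rcases hR with rfl | rfl <;>
      rcases hL' with rfl | rfl <;> rcases hR' with rfl | rfl <;> norm_num at * <;> tauto

end PiecewiseField

/-! ### Symmetries -/

namespace PiecewiseField

/-- `A` permutes the coordinates and changes some of their signs. -/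
structure IsSignedPerm (A : Plane ≃ₗᵢ[ℝ] Plane) (ε : Fin 2 → ℝ) (e : Equiv.Perm (Fin 2)) :
    Prop where
  apply : ∀ p i, A p i = ε i * p (e i)
  sq : ∀ i, ε i * ε i = 1

/-- The sign of a change of the direction of time, as a real number. -/
def timeSign (τ : ℤˣ) : ℝ := ((τ : ℤ) : ℝ)

theorem timeSign_mul_self (τ : ℤˣ) : timeSign τ * timeSign τ = 1 := by
  rcases Int.units_eq_one_or τ with rfl | rfl <;> simp [timeSign]

theorem units_smul_eq (τ : ℤˣ) (v : Plane) : τ • v = timeSign τ • v := by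
  rcases Int.units_eq_one_or τ with rfl | rfl <;> simp [timeSign, Units.smul_def]

theorem perm_add_one (e : Equiv.Perm (Fin 2)) (i : Fin 2) : e (i + 1) = e i + 1 := by
  revert e i; decide

namespace IsSignedPerm

variable {A : Plane ≃ₗᵢ[ℝ] Plane} {ε : Fin 2 → ℝ} {e : Equiv.Perm (Fin 2)}

theorem ne_zero (h : IsSignedPerm A ε e) (i : Fin 2) : ε i ≠ 0 := fun h0 => by
  have := h.sq i
  rw [h0, mul_zero] at this
  exact zero_ne_one this

theorem symm (h : IsSignedPerm A ε e) : IsSignedPerm A.symm (fun i => ε (e.symm i)) e.symm where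
  apply p i := by
    have h1 := h.apply (A.symm p) (e.symm i)
    rw [A.apply_symm_apply, e.apply_symm_apply] at h1
    rw [h1, ← mul_assoc, h.sq, one_mul]
  sq i := h.sq _

theorem mem_axis (h : IsSignedPerm A ε e) {p : Plane} {i : Fin 2} :
    A p ∈ axis i ↔ p ∈ axis (e i) := by
  change A p i = 0 ↔ p (e i) = 0
  rw [h.apply, mul_eq_zero, or_iff_right (h.ne_zero i)]

theorem mul_apply (h : IsSignedPerm A ε e) (p : Plane) :
    A p 0 * A p 1 = (ε 0 * ε 1) * (p 0 * p 1) := by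
  rw [h.apply, h.apply]
  have : p (e 0) * p (e 1) = p 0 * p 1 := by
    have h1 := perm_add_one e 0
    rw [zero_add] at h1
    rw [h1]
    rcases (show e 0 = 0 ∨ e 0 = 1 by omega) with h2 | h2 <;> rw [h2]
    · rfl
    · exact mul_comm _ _
  rw [← this]; ring

theorem det_cases (h : IsSignedPerm A ε e) : ε 0 * ε 1 = 1 ∨ ε 0 * ε 1 = -1 := by
  refine mul_self_eq_one_iff.1 ?_
  rw [mul_mul_mul_comm, h.sq, h.sq, one_mul]

theorem mem_switching (h : IsSignedPerm A ε e) {p : Plane} : A p ∈ switching ↔ p ∈ switching := by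
  change A p 0 * A p 1 = 0 ↔ p 0 * p 1 = 0
  rw [h.mul_apply, mul_eq_zero, or_iff_right (mul_ne_zero (h.ne_zero 0) (h.ne_zero 1))]

theorem image_switching (h : IsSignedPerm A ε e) : A '' switching = switching := by
  ext p
  constructor
  · rintro ⟨q, hq, rfl⟩; exact h.mem_switching.2 hq
  · intro hp
    exact ⟨A.symm p, h.mem_switching.1 (by rwa [A.apply_symm_apply]), A.apply_symm_apply p⟩

theorem mem_regionPos (h : IsSignedPerm A ε e) {p : Plane} :
    A p ∈ regionPos ↔ (if ε 0 * ε 1 = 1 then p ∈ regionPos else p ∈ regionNeg) := by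
  change 0 < A p 0 * A p 1 ↔ _
  rw [h.mul_apply]
  rcases h.det_cases with hd | hd
  · rw [if_pos hd, hd, one_mul]; rfl
  · rw [if_neg (by rw [hd]; norm_num), hd, neg_one_mul, neg_pos]; rfl

theorem mem_regionNeg (h : IsSignedPerm A ε e) {p : Plane} :
    A p ∈ regionNeg ↔ (if ε 0 * ε 1 = 1 then p ∈ regionNeg else p ∈ regionPos) := by
  change A p 0 * A p 1 < 0 ↔ _
  rw [h.mul_apply]
  rcases h.det_cases with hd | hd
  · rw [if_pos hd, hd, one_mul]; rfl
  · rw [if_neg (by rw [hd]; norm_num), hd, neg_one_mul, neg_lt_zero]; rfl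

theorem image_regionPos (h : IsSignedPerm A ε e) :
    A '' regionPos = regionPos ↔ ε 0 * ε 1 = 1 := by
  constructor
  · intro hi
    by_contra hd
    have h1 : (!₂[1, 1] : Plane) ∈ regionPos := by simp [regionPos]
    have h2 : A !₂[1, 1] ∈ regionPos := hi ▸ mem_image_of_mem A h1
    rw [h.mem_regionPos, if_neg hd] at h2
    exact notMem_regionNeg_of_pos h1 h2
  · intro hd
    ext p
    constructor
    · rintro ⟨q, hq, rfl⟩; rw [h.mem_regionPos, if_pos hd]; exact hq
    · intro hp
      refine ⟨A.symm p, ?_, A.apply_symm_apply p⟩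
      have := h.mem_regionPos (p := A.symm p)
      rw [if_pos hd, A.apply_symm_apply] at this
      exact this.1 hp

/-- The field that becomes `X` under the symmetry. -/
noncomputable def fst (ε : Fin 2 → ℝ) (Z : PiecewiseField) : Plane → Plane :=
  if ε 0 * ε 1 = 1 then Z.X else Z.Y

/-- The field that becomes `Y` under the symmetry. -/
noncomputable def snd (ε : Fin 2 → ℝ) (Z : PiecewiseField) : Plane → Plane :=
  if ε 0 * ε 1 = 1 then Z.Y else Z.X

theorem transform_X (h : IsSignedPerm A ε e) (τ : ℤˣ) (Z : PiecewiseField) (p : Plane) :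
    (Z.transform A τ).X p = timeSign τ • A (fst ε Z (A.symm p)) := by
  simp only [transform, units_smul_eq, h.image_regionPos, fst]

theorem transform_Y (h : IsSignedPerm A ε e) (τ : ℤˣ) (Z : PiecewiseField) (p : Plane) :
    (Z.transform A τ).Y p = timeSign τ • A (snd ε Z (A.symm p)) := by
  simp only [transform, units_smul_eq, h.image_regionPos, snd]

theorem transform_X_apply (h : IsSignedPerm A ε e) (τ : ℤˣ) (Z : PiecewiseField) (p : Plane)
    (i : Fin 2) : (Z.transform A τ).X (A p) i = timeSign τ * ε i * fst ε Z p (e i) := by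
  rw [h.transform_X, A.symm_apply_apply, PiLp.smul_apply, smul_eq_mul, h.apply, mul_assoc]

theorem transform_Y_apply (h : IsSignedPerm A ε e) (τ : ℤˣ) (Z : PiecewiseField) (p : Plane)
    (i : Fin 2) : (Z.transform A τ).Y (A p) i = timeSign τ * ε i * snd ε Z p (e i) := by
  rw [h.transform_Y, A.symm_apply_apply, PiLp.smul_apply, smul_eq_mul, h.apply, mul_assoc]

theorem sign_sq (h : IsSignedPerm A ε e) (τ : ℤˣ) (i : Fin 2) :
    (timeSign τ * ε i) * (timeSign τ * ε i) = 1 := by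
  rw [mul_mul_mul_comm, timeSign_mul_self, h.sq, one_mul]

theorem mul_transform (h : IsSignedPerm A ε e) (τ : ℤˣ) (Z : PiecewiseField) (p : Plane)
    (i : Fin 2) : (Z.transform A τ).X (A p) i * (Z.transform A τ).Y (A p) i =
      Z.X p (e i) * Z.Y p (e i) := by
  rw [h.transform_X_apply, h.transform_Y_apply, mul_mul_mul_comm, h.sign_sq, one_mul, fst, snd]
  split_ifs
  · rfl
  · exact mul_comm _ _

/-- Transforming back recovers the field. -/
theorem transform_symm_transform (h : IsSignedPerm A ε e) (τ : ℤˣ) (Z : PiecewiseField) :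
    (Z.transform A τ).transform A.symm τ = Z := by
  have hd : ε (e.symm 0) * ε (e.symm 1) = ε 0 * ε 1 := by
    have h1 := perm_add_one e.symm 0
    rw [zero_add] at h1
    rw [h1]
    rcases (show e.symm 0 = 0 ∨ e.symm 0 = 1 by omega) with h2 | h2 <;> rw [h2]
    · rfl
    · exact mul_comm _ _
  have key : ∀ v : Plane, timeSign τ • A.symm (timeSign τ • A v) = v := fun v => by
    rw [map_smul, A.symm_apply_apply, smul_smul, timeSign_mul_self, one_smul]
  have hX : ((Z.transform A τ).transform A.symm τ).X = Z.X := by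
    funext p
    rw [h.symm.transform_X, fst, LinearIsometryEquiv.symm_symm, hd]
    split_ifs with hd1
    · rw [h.transform_X, A.symm_apply_apply, key, fst, if_pos hd1]
    · rw [h.transform_Y, A.symm_apply_apply, key, snd, if_neg hd1]
  have hY : ((Z.transform A τ).transform A.symm τ).Y = Z.Y := by
    funext p
    rw [h.symm.transform_Y, snd, LinearIsometryEquiv.symm_symm, hd]
    split_ifs with hd1
    · rw [h.transform_Y, A.symm_apply_apply, key, snd, if_pos hd1]
    · rw [h.transform_X, A.symm_apply_apply, key, fst, if_neg hd1]
  cases Z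
  exact congrArg₂ PiecewiseField.mk hX hY

theorem mem_slidEsc (h : IsSignedPerm A ε e) (τ : ℤˣ) (Z : PiecewiseField) {p : Plane}
    {i : Fin 2} : A p ∈ (Z.transform A τ).slidEsc i ↔ p ∈ Z.slidEsc (e i) := by
  rw [PiecewiseField.mem_slidEsc, PiecewiseField.mem_slidEsc, h.mul_transform, h.apply, h.apply,
    perm_add_one, mul_eq_zero, or_iff_right (h.ne_zero i), mul_ne_zero_iff,
    and_iff_right (h.ne_zero (i + 1))]

theorem mem_crossing (h : IsSignedPerm A ε e) (τ : ℤˣ) (Z : PiecewiseField) {p : Plane}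
    {i : Fin 2} : A p ∈ (Z.transform A τ).crossing i ↔ p ∈ Z.crossing (e i) := by
  change A p ∈ axis i ∧ _ ↔ p ∈ axis (e i) ∧ _
  rw [h.mem_axis, h.mul_transform]

theorem slidingField_transform (h : IsSignedPerm A ε e) (τ : ℤˣ) (Z : PiecewiseField) (p : Plane)
    (i : Fin 2) :
    (Z.transform A τ).slidingField i (A p) = timeSign τ • A (Z.slidingField (e i) p) := by
  set μ := timeSign τ * ε i with hμ
  have hμ0 : μ ≠ 0 := fun h0 => by
    have := h.sign_sq τ i
    rw [← hμ, h0, mul_zero] at this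
    exact zero_ne_one this
  have key : ∀ V W : Plane, (μ * W (e i) - μ * V (e i))⁻¹ • ((μ * W (e i)) • timeSign τ • A V -
      (μ * V (e i)) • timeSign τ • A W) =
      timeSign τ • A ((W (e i) - V (e i))⁻¹ • (W (e i) • V - V (e i) • W)) := by
    intro V W
    rw [map_smul, map_sub, map_smul, map_smul, ← mul_sub, mul_inv]
    simp only [smul_sub, smul_smul]
    congr 2 <;> field_simp
  rw [slidingField, h.transform_X_apply, h.transform_Y_apply, h.transform_X, h.transform_Y,
    A.symm_apply_apply, ← hμ, key, slidingField, fst, snd]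
  split_ifs with hd
  · rfl
  · congr 2
    rw [← neg_sub (Z.Y p (e i)), ← neg_sub (Z.Y p (e i) • Z.X p), inv_neg, neg_smul_neg]

theorem mem_closure (A : Plane ≃ₗᵢ[ℝ] Plane) {S T : Set Plane} (hST : ∀ p, A p ∈ S ↔ p ∈ T)
    {p : Plane} : A p ∈ closure S ↔ p ∈ closure T := by
  have e : T = A ⁻¹' S := by ext p; exact (hST p).symm
  have := A.toHomeomorph.preimage_closure S
  have h2 : A ⁻¹' closure S = closure (A ⁻¹' S) := this
  rw [e, ← h2]; rfl

theorem allCrossing_iff (h : IsSignedPerm A ε e) (τ : ℤˣ) (Z : PiecewiseField) :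
    (Z.transform A τ).AllCrossing ↔ Z.AllCrossing := by
  have hcr : ∀ p, (A p ∈ (Z.transform A τ).crossing 0 ∪ (Z.transform A τ).crossing 1) ↔
      p ∈ Z.crossing 0 ∪ Z.crossing 1 := by
    intro p
    rw [mem_union, mem_union, h.mem_crossing, h.mem_crossing]
    have h1 := perm_add_one e 0
    rw [zero_add] at h1
    rw [h1]
    rcases (show e 0 = 0 ∨ e 0 = 1 by omega) with h2 | h2 <;> rw [h2]
    · rfl
    · exact or_comm
  have hm : Filter.map A (𝓝 0) = 𝓝 0 := by
    have := A.toHomeomorph.map_nhds_eq 0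
    rwa [show A.toHomeomorph 0 = 0 from map_zero A] at this
  rw [AllCrossing, ← hm, eventually_map, AllCrossing]
  refine eventually_congr (Eventually.of_forall fun p => ?_)
  rw [h.mem_switching, mem_closure A hcr]

theorem slidesThroughOrigin_iff (h : IsSignedPerm A ε e) (τ : ℤˣ) (Z : PiecewiseField)
    (i : Fin 2) : (Z.transform A τ).SlidesThroughOrigin i ↔ Z.SlidesThroughOrigin (e i) := by
  have hs : ∀ j, (0 ∈ closure ((Z.transform A τ).slidEsc j) ↔ 0 ∈ closure (Z.slidEsc (e j))) := by
    intro j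
    have := mem_closure A (fun p => h.mem_slidEsc τ Z (p := p) (i := j)) (p := 0)
    rwa [map_zero] at this
  have hc : ∀ j, (0 ∈ closure ((Z.transform A τ).crossing j) ↔ 0 ∈ closure (Z.crossing (e j))) := by
    intro j
    have := mem_closure A (fun p => h.mem_crossing τ Z (p := p) (i := j)) (p := 0)
    rwa [map_zero] at this
  have hX := h.transform_X_apply τ Z 0 i
  have hY := h.transform_Y_apply τ Z 0 i
  rw [map_zero] at hX hY
  have hne : timeSign τ * ε i ≠ 0 := fun h0 => by
    have := h.sign_sq τ i
    rw [h0, mul_zero] at this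
    exact zero_ne_one this
  rw [SlidesThroughOrigin, SlidesThroughOrigin, hs, hs, hc, hX, hY, perm_add_one, fst, snd, Ne,
    mul_right_inj' hne]
  split_ifs
  · rfl
  · rw [eq_comm]

theorem noTangency (h : IsSignedPerm A ε e) (τ : ℤˣ) {Z : PiecewiseField} {W : Set Plane}
    (hZ : Z.NoTangency W) : (Z.transform A τ).NoTangency (A.symm ⁻¹' W) := by
  intro p hp h0 i hi
  obtain ⟨q, rfl⟩ := A.surjective p
  rw [mem_preimage, A.symm_apply_apply] at hp
  rw [h.mul_transform]
  exact hZ q hp (fun hq => h0 (by rw [hq, map_zero])) _ (h.mem_axis.1 hi)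

/-- The symmetry maps trajectories to trajectories. -/
theorem isTrajectory (h : IsSignedPerm A ε e) (τ : ℤˣ) {Z : PiecewiseField} {W : Set Plane}
    (hZ : Z.NoTangency W) {I : Set ℝ} {c : ℝ → Plane} (hI : MapsTo c I W)
    (hc : Z.IsTrajectory I c) : (Z.transform A τ).IsTrajectory ((fun s => timeSign τ * s) ⁻¹' I)
      (fun s => A (c (timeSign τ * s))) := by
  set σ := timeSign τ with hσ
  have hσ2 : σ * σ = 1 := timeSign_mul_self τ
  set J := (fun s => σ * s) ⁻¹' I with hJ
  have hg : Continuous fun s : ℝ => σ * s := by fun_prop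
  have hmaps : MapsTo (fun s => σ * s) J I := fun s hs => hs
  have hA0 : ∀ p, A p = 0 ↔ p = 0 := fun p => map_eq_zero_iff A A.injective
  refine ⟨?_, (A.continuous.comp_continuousOn hc.2.1).comp hg.continuousOn hmaps, fun t ht => ?_⟩
  · have h1 := hc.1
    rw [← isPreconnected_iff_ordConnected] at h1 ⊢
    have e2 : J = (fun s => σ * s) '' I := by
      ext s
      constructor
      · intro hs; exact ⟨σ * s, hs, (by rw [← mul_assoc, hσ2, one_mul] : σ * (σ * s) = s)⟩
      · rintro ⟨r, hr, rfl⟩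
        change σ * (σ * r) ∈ I
        rwa [← mul_assoc, hσ2, one_mul]
    rw [e2]
    exact h1.image _ hg.continuousOn
  have htend : Tendsto (fun s => σ * s) (𝓝[J] t) (𝓝[I] (σ * t)) :=
    hg.continuousWithinAt.tendsto_nhdsWithin hmaps
  have hpunct : Tendsto (fun s => σ * s) (𝓝[J \ {t}] t) (𝓝[I \ {σ * t}] (σ * t)) := by
    refine hg.continuousWithinAt.tendsto_nhdsWithin fun s hs => ⟨hs.1, fun he => hs.2 ?_⟩
    have h3 : σ * (σ * s) = σ * (σ * t) := congrArg (σ * ·) he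
    rwa [← mul_assoc, ← mul_assoc, hσ2, one_mul, one_mul] at h3
  have hder : ∀ {s v}, HasDerivWithinAt c v I (σ * s) →
      HasDerivWithinAt (fun s => A (c (σ * s))) (σ • A v) J s := by
    intro s v hd
    have h1 : HasDerivWithinAt (fun s : ℝ => σ * s) σ J s := by
      simpa using (hasDerivWithinAt_id s J).const_mul σ
    have h2 := hd.scomp s h1 hmaps
    have h3 := (A.toContinuousLinearEquiv.toContinuousLinearMap.hasFDerivAt).comp_hasDerivWithinAt s h2
    refine h3.congr_deriv ?_
    exact map_smul A σ v
  -- the fields change roles if the regions do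
  have hXY : ∀ p, (ε 0 * ε 1 = 1 → (Z.transform A τ).X (A p) = σ • A (Z.X p) ∧
      (Z.transform A τ).Y (A p) = σ • A (Z.Y p)) ∧ (¬ ε 0 * ε 1 = 1 →
      (Z.transform A τ).X (A p) = σ • A (Z.Y p) ∧
      (Z.transform A τ).Y (A p) = σ • A (Z.X p)) := by
    intro p
    rw [h.transform_X, h.transform_Y, A.symm_apply_apply, fst, snd]
    exact ⟨fun hd => by rw [if_pos hd, if_pos hd]; exact ⟨rfl, rfl⟩,
      fun hd => by rw [if_neg hd, if_neg hd]; exact ⟨rfl, rfl⟩⟩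
  rcases hc.2.2 (σ * t) ht with ⟨h0, h1⟩ | h1 | ⟨h0, h1⟩
  · refine Or.inl ⟨fun h2 => h0 ((hA0 _).1 h2), ?_⟩
    rw [h.mem_regionPos, h.mem_regionNeg]
    rcases h1 with ⟨h1, h2⟩ | ⟨h1, h2⟩ | ⟨i, h1, h2, h3⟩ | ⟨i, h1, h2⟩
    · by_cases hd : ε 0 * ε 1 = 1
      · rw [if_pos hd, if_pos hd]
        refine Or.inl ⟨h1, ?_⟩
        rw [((hXY _).1 hd).1]; exact hder h2
      · rw [if_neg hd, if_neg hd]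
        refine Or.inr (Or.inl ⟨h1, ?_⟩)
        rw [((hXY _).2 hd).2]; exact hder h2
    · by_cases hd : ε 0 * ε 1 = 1
      · rw [if_pos hd, if_pos hd]
        refine Or.inr (Or.inl ⟨h1, ?_⟩)
        rw [((hXY _).1 hd).2]; exact hder h2
      · rw [if_neg hd, if_neg hd]
        refine Or.inl ⟨h1, ?_⟩
        rw [((hXY _).2 hd).1]; exact hder h2
    · refine Or.inr (Or.inr (Or.inl ⟨e.symm i, ?_, ?_, ?_⟩))
      · rwa [h.mem_slidEsc, e.apply_symm_apply]
      · filter_upwards [htend.eventually h2] with s hs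
        rwa [h.mem_axis, e.apply_symm_apply]
      · rw [h.slidingField_transform, e.apply_symm_apply]; exact hder h3
    · refine Or.inr (Or.inr (Or.inr ⟨e.symm i, ?_, ?_⟩))
      · rwa [h.mem_crossing, e.apply_symm_apply]
      · filter_upwards [hpunct.eventually h2] with s hs
        rwa [h.mem_switching]
  · exact absurd h1 (hZ.not_tangencyLaw (hI ht))
  · refine Or.inr (Or.inr ⟨(hA0 _).2 h0, ?_⟩)
    rw [h.allCrossing_iff]
    have hins : ∀ {S T : Set Plane} {p : Plane}, (A p ∈ S ↔ p ∈ T) → p ∈ insert 0 T →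
        A p ∈ insert 0 S := fun hST hp => hp.imp (fun h => (hA0 _).2 h) hST.2
    rcases h1 with ⟨hAll, h1⟩ | ⟨hAll, i, hs, h1, h2⟩ | ⟨hAll, hs, h1⟩
    · refine Or.inl ⟨hAll, ?_⟩
      have hev : ∀ {S T : Set Plane} {V V' : Plane → Plane}, (∀ p, A p ∈ S ↔ p ∈ T) →
          (∀ p, V' (A p) = σ • A (V p)) →
          (∀ᶠ s in 𝓝[I] (σ * t), c s ∈ insert 0 T ∧ HasDerivWithinAt c (V (c s)) I s) →
          ∀ᶠ s in 𝓝[J] t, A (c (σ * s)) ∈ insert 0 S ∧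
            HasDerivWithinAt (fun s => A (c (σ * s))) (V' (A (c (σ * s)))) J s := by
        intro S T V V' hST hV hh
        filter_upwards [htend.eventually hh] with s hs
        refine ⟨hins (hST _) hs.1, ?_⟩
        rw [hV]; exact hder hs.2
      by_cases hd : ε 0 * ε 1 = 1
      · refine h1.imp (hev (fun p => ?_) fun p => ((hXY p).1 hd).1)
          (hev (fun p => ?_) fun p => ((hXY p).1 hd).2)
        · rw [h.mem_regionPos, if_pos hd]
        · rw [h.mem_regionNeg, if_pos hd]
      · refine (h1.imp (hev (fun p => ?_) fun p => ((hXY p).2 hd).2)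
          (hev (fun p => ?_) fun p => ((hXY p).2 hd).1)).symm
        · rw [h.mem_regionNeg, if_neg hd]
        · rw [h.mem_regionPos, if_neg hd]
    · refine Or.inr (Or.inl ⟨hAll, e.symm i, ?_, ?_, ?_⟩)
      · rwa [h.slidesThroughOrigin_iff, e.apply_symm_apply]
      · filter_upwards [htend.eventually h1] with s hs'
        exact hins (by rw [h.mem_slidEsc, e.apply_symm_apply]) hs'
      · have h3 := h.slidingField_transform τ Z 0 (e.symm i)
        rw [map_zero, e.apply_symm_apply] at h3
        rw [h3]; exact hder h2
    · refine Or.inr (Or.inr ⟨hAll, fun i hi => ?_, fun s hs' => (hA0 _).2 (h1 _ hs')⟩)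
      exact hs _ ((h.slidesThroughOrigin_iff τ Z i).1 hi)

end IsSignedPerm

end PiecewiseField

namespace PiecewiseField

/-- `h` in the coordinates changed by `A`. -/
noncomputable def conjugate (A : Plane ≃ₗᵢ[ℝ] Plane) (h : OpenPartialHomeomorph Plane Plane) :
    OpenPartialHomeomorph Plane Plane :=
  (A.symm.toHomeomorph.transOpenPartialHomeomorph h).transHomeomorph A.toHomeomorph

theorem conjugate_apply (A : Plane ≃ₗᵢ[ℝ] Plane) (h : OpenPartialHomeomorph Plane Plane)
    (p : Plane) : conjugate A h p = A (h (A.symm p)) := rfl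

theorem conjugate_source (A : Plane ≃ₗᵢ[ℝ] Plane) (h : OpenPartialHomeomorph Plane Plane) :
    (conjugate A h).source = A.symm ⁻¹' h.source := rfl

namespace IsSignedPerm

variable {A : Plane ≃ₗᵢ[ℝ] Plane} {ε : Fin 2 → ℝ} {e : Equiv.Perm (Fin 2)}

/-- If time is reversed, the change of time `ρ` becomes `s ↦ -ρ (-s)`, which is increasing again. -/
theorem carries (hA : IsSignedPerm A ε e) (τ : ℤˣ) {f : Plane → Plane} {S T : Set Plane}
    {Z Z' : PiecewiseField} (hf : MapsTo f S T) (hZ : Z.NoTangency S) (hZ' : Z'.NoTangency T)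
    (hc : ∀ (I : Set ℝ) (c : ℝ → Plane), Z.IsTrajectory I c → MapsTo c I S →
      ∃ (J : Set ℝ) (ρ : ℝ → ℝ), StrictMonoOn ρ J ∧ ρ '' J = I ∧
        Z'.IsTrajectory J (fun t => f (c (ρ t))))
    (I : Set ℝ) (c : ℝ → Plane) (htraj : (Z.transform A τ).IsTrajectory I c)
    (hI : MapsTo c I (A.symm ⁻¹' S)) :
    ∃ (J : Set ℝ) (ρ : ℝ → ℝ), StrictMonoOn ρ J ∧ ρ '' J = I ∧
      (Z'.transform A τ).IsTrajectory J (fun t => A (f (A.symm (c (ρ t))))) := by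
  have h1 := hA.symm.isTrajectory τ (hA.noTangency τ hZ) hI htraj
  rw [hA.transform_symm_transform] at h1
  set σ := timeSign τ with hσ
  have hσ2 : σ * σ = 1 := timeSign_mul_self τ
  have hσσ : ∀ s, σ * (σ * s) = s := fun s => by rw [← mul_assoc, hσ2, one_mul]
  obtain ⟨J, ρ, hρ, hρi, h2⟩ := hc _ _ h1 fun s hs => hI hs
  have hmem : ∀ t ∈ J, σ * ρ t ∈ I := fun t ht => by
    have : ρ t ∈ (fun s => σ * s) ⁻¹' I := hρi ▸ mem_image_of_mem ρ ht
    exact this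
  have h3 := hA.isTrajectory τ hZ' (fun t ht => hf (hI (hmem t ht))) h2
  refine ⟨_, fun s => σ * ρ (σ * s), ?_, ?_, h3⟩
  · intro s hs t ht hst
    rcases mul_self_eq_one_iff.1 hσ2 with h | h
    · simp only [h, one_mul]
      refine hρ ?_ ?_ hst
      · simpa [← hσ, h] using hs
      · simpa [← hσ, h] using ht
    · simp only [h, neg_one_mul, neg_lt_neg_iff]
      refine hρ ?_ ?_ (neg_lt_neg hst)
      · simpa [← hσ, h] using ht
      · simpa [← hσ, h] using hs
  · ext s
    constructor
    · rintro ⟨t, ht, rfl⟩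
      exact hmem _ ht
    · intro hs
      have : σ * s ∈ (fun s => σ * s) ⁻¹' I := by
        change σ * (σ * s) ∈ I
        rwa [hσσ]
      rw [← hρi] at this
      obtain ⟨t, ht, hts⟩ := this
      refine ⟨σ * t, ?_, ?_⟩
      · change σ * (σ * t) ∈ J
        rwa [hσσ]
      · simp only [hσσ, hts]

theorem conjugates (hA : IsSignedPerm A ε e) (τ : ℤˣ) {h : OpenPartialHomeomorph Plane Plane}
    {Z Z' : PiecewiseField} (hc : Conjugates h Z Z') (hZ : Z.NoTangency h.source)
    (hZ' : Z'.NoTangency h.target) :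
    Conjugates (conjugate A h) (Z.transform A τ) (Z'.transform A τ) where
  zero_mem := by
    rw [conjugate_source, mem_preimage, map_zero]
    exact hc.zero_mem
  map_zero := by rw [conjugate_apply, _root_.map_zero, hc.map_zero, _root_.map_zero]
  carries := hA.carries τ h.mapsTo hZ hZ' hc.carries
  carries_symm := hA.carries τ h.mapsTo_symm hZ' hZ hc.carries_symm

theorem preservesSigns (hA : IsSignedPerm A ε e) {h : OpenPartialHomeomorph Plane Plane}
    (hs : PreservesSigns h) : PreservesSigns (conjugate A h) := by
  intro p hp i
  obtain ⟨q, rfl⟩ := A.surjective p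
  rw [conjugate_source, mem_preimage, A.symm_apply_apply] at hp
  rw [conjugate_apply, A.symm_apply_apply, hA.apply, hA.apply, sign_mul, sign_mul, hs q hp]

theorem preservesSwitching (hA : IsSignedPerm A ε e) {h : OpenPartialHomeomorph Plane Plane}
    (hs : PreservesSwitching h) : PreservesSwitching (conjugate A h) := by
  intro p hp
  obtain ⟨q, rfl⟩ := A.surjective p
  rw [conjugate_source, mem_preimage, A.symm_apply_apply] at hp
  rw [conjugate_apply, A.symm_apply_apply, hA.mem_switching, hA.mem_switching, hs q hp]

end IsSignedPerm

/-- An equivalence may be restricted to smaller neighbourhoods of the origin. -/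
theorem Conjugates.restrict {h : OpenPartialHomeomorph Plane Plane} {Z Z' : PiecewiseField}
    (hc : Conjugates h Z Z') (hs : PreservesSwitching h) {W W' : Set Plane} (hW : W ∈ 𝓝 0)
    (hW' : W' ∈ 𝓝 0) : ∃ g : OpenPartialHomeomorph Plane Plane, Conjugates g Z Z' ∧
      PreservesSwitching g ∧ g.source ⊆ W ∧ g.target ⊆ W' := by
  have h1 : W ∩ h ⁻¹' W' ∈ 𝓝 (0 : Plane) := by
    refine inter_mem hW ((h.continuousAt hc.zero_mem).preimage_mem_nhds ?_)
    rwa [hc.map_zero]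
  obtain ⟨V, hV, hVo, hV0⟩ := mem_nhds_iff.1 h1
  have hsrc : (h.restrOpen V hVo).source = h.source ∩ V := rfl
  have htgt : ∀ p ∈ (h.restrOpen V hVo).target, p ∈ h.target ∧ h.symm p ∈ V := by
    intro p hp
    have hp' : (h.restrOpen V hVo).symm p ∈ h.source ∩ V :=
      (h.restrOpen V hVo).map_target hp
    have e : h (h.symm p) = p := (h.restrOpen V hVo).right_inv hp
    exact ⟨e ▸ h.map_source hp'.1, hp'.2⟩
  refine ⟨h.restrOpen V hVo, ⟨⟨hc.zero_mem, hV0⟩, hc.map_zero, ?_, ?_⟩, ?_, ?_, ?_⟩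
  · exact fun I c htraj hI => hc.carries I c htraj fun t ht => (hI ht).1
  · exact fun I c htraj hI => hc.carries_symm I c htraj fun t ht => (htgt _ (hI ht)).1
  · exact fun p hp => hs p hp.1
  · exact fun p hp => (hV hp.2).1
  · intro p hp
    have h2 := (hV (htgt p hp).2).2
    rwa [mem_preimage, h.right_inv (htgt p hp).1] at h2

theorem TameAt.exists_noTangency {Z : PiecewiseField} {a b sL sR : ℝ} (hZ : Z.TameAt a b sL sR) :
    ∃ W ∈ 𝓝 (0 : Plane), Z.NoTangency W := by
  obtain ⟨Y, k, W, hY, hW⟩ := hZ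
  exact ⟨W, hW.isOpen.mem_nhds hW.zero_mem, hW.symm.noTangency (hY.noTangency W)⟩

namespace IsSignedPerm

variable {A : Plane ≃ₗᵢ[ℝ] Plane} {ε : Fin 2 → ℝ} {e : Equiv.Perm (Fin 2)}

theorem exists_noTangency (hA : IsSignedPerm A ε e) {τ : ℤˣ} {Z : PiecewiseField}
    {a b sL sR : ℝ} (hZ : (Z.transform A τ).TameAt a b sL sR) :
    ∃ W ∈ 𝓝 (0 : Plane), Z.NoTangency W := by
  obtain ⟨W, hW, hT⟩ := hZ.exists_noTangency
  have h1 := hA.symm.noTangency τ hT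
  rw [hA.transform_symm_transform, LinearIsometryEquiv.symm_symm] at h1
  refine ⟨_, ?_, h1⟩
  exact A.continuous.continuousAt.preimage_mem_nhds (by rwa [map_zero])

/-- Fields which a symmetry turns into fields of the same type are equivalent. -/
theorem locallyEquivalent (hA : IsSignedPerm A ε e) {τ : ℤˣ} {Z N : PiecewiseField}
    {a b sL sR : ℝ} (hZ : (Z.transform A τ).TameAt a b sL sR) (hN : N.TameAt a b sL sR) :
    LocallyEquivalent Z (N.transform A.symm τ) := by
  obtain ⟨h, hc, hs, hT, hT'⟩ := hZ.exists_conjugates hN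
  have h1 := hA.symm.conjugates τ hc hT hT'
  rw [hA.transform_symm_transform] at h1
  exact h1.locallyEquivalent (hA.symm.preservesSigns hs)

/-- Equivalent fields have the same signs of `X₂` after the same symmetry. -/
theorem signs_eq (hA : IsSignedPerm A ε e) {τ : ℤˣ} {Z Z' : PiecewiseField}
    {a b sL sR sL' sR' : ℝ} (hZ : (Z.transform A τ).TameAt a b sL sR)
    (hZ' : (Z'.transform A τ).TameAt a b sL' sR') (hle : sL ≤ sR) (hle' : sL' ≤ sR')
    (heq : LocallyEquivalent Z Z') : sL = sL' ∧ sR = sR' := by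
  obtain ⟨h, h0, h00, -, hs, hc, hc'⟩ := heq
  obtain ⟨W, hW, hT⟩ := hA.exists_noTangency hZ
  obtain ⟨W', hW', hT'⟩ := hA.exists_noTangency hZ'
  obtain ⟨g, hg, hgs, hgW, hgW'⟩ := (Conjugates.mk h0 h00 hc hc').restrict hs hW hW'
  exact hZ.signs_eq hZ' hle hle' (hA.conjugates τ hg (hT.mono hgW) (hT'.mono hgW'))
    (hA.preservesSwitching hgs)

end IsSignedPerm

end PiecewiseField

/-! ### The type of a field near a standard fold -/

namespace PiecewiseField

/-- The sign of `X₂` on the left half of `Σ₂`, if `X₂` has the value `φ` at the origin and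
increases along `Σ₂`. -/
noncomputable def leftSign (φ : ℝ) : ℝ := if 0 < φ then 1 else -1

/-- The sign of `X₂` on the right half of `Σ₂`, if `X₂` has the value `φ` at the origin and
increases along `Σ₂`. -/
noncomputable def rightSign (φ : ℝ) : ℝ := if φ < 0 then -1 else 1

theorem leftSign_le_rightSign (φ : ℝ) : leftSign φ ≤ rightSign φ := by
  unfold leftSign rightSign
  split_ifs <;> linarith

theorem leftSign_congr {φ ψ : ℝ} (h : SignType.sign φ = SignType.sign ψ) :
    leftSign φ = leftSign ψ := by
  simp only [leftSign, ← sign_eq_one_iff, h]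

theorem rightSign_congr {φ ψ : ℝ} (h : SignType.sign φ = SignType.sign ψ) :
    rightSign φ = rightSign ψ := by
  simp only [rightSign, ← sign_eq_neg_one_iff, h]

/-- The two signs determine the sign of the value at the origin. -/
theorem sign_eq_of_signs_eq {φ ψ : ℝ} (hL : leftSign φ = leftSign ψ)
    (hR : rightSign φ = rightSign ψ) : SignType.sign φ = SignType.sign ψ := by
  unfold leftSign at hL
  unfold rightSign at hR
  rcases lt_trichotomy φ 0 with h | h | h <;> rcases lt_trichotomy ψ 0 with h' | h' | h' <;>
    simp [h, h', not_lt.2 h.le, not_lt.2 h'.le] at hL hR ⊢ <;> linarith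

/-- The type of a field whose component `X₂` increases along `Σ₂` depends on the sign of `X₂` at the
origin only. -/
theorem tameAt_of_partial_pos {Z : PiecewiseField} {a b : ℝ} (hX : ContDiffAt ℝ 1 Z.X 0)
    (hY : ContDiffAt ℝ 1 Z.Y 0) (ha : a * a = 1) (hb : b * b = 1) (hX0 : 0 < Z.X 0 0)
    (hX1 : 0 < partialAtZero Z.X 1 0) (hY0 : 0 < a * Z.Y 0 0) (hY1 : 0 < b * Z.Y 0 1)
    (hsteep : |Z.X 0 1| * |Z.Y 0 0| < Z.X 0 0 * |Z.Y 0 1|) :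
    Z.TameAt a b (leftSign (Z.X 0 1)) (rightSign (Z.X 0 1)) := by
  have hv : ∀ x : ℝ, (!₂[x, 0] : Plane) = x • EuclideanSpace.single 0 1 := by
    intro x
    ext i
    fin_cases i <;> simp
  have hder : HasDerivAt (fun x : ℝ => Z.X !₂[x, 0] 1) (partialAtZero Z.X 1 0) 0 := by
    simp only [hv]
    have h1 : HasDerivAt (fun x : ℝ => x • (EuclideanSpace.single 0 1 : Plane))
        (EuclideanSpace.single 0 1) 0 := by
      simpa using (hasDerivAt_id (0 : ℝ)).smul_const (EuclideanSpace.single 0 1 : Plane)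
    have h2 : HasFDerivAt Z.X (fderiv ℝ Z.X 0) ((0 : ℝ) • (EuclideanSpace.single 0 1 : Plane)) := by
      rw [zero_smul]; exact (hX.differentiableAt (by norm_num)).hasFDerivAt
    exact (hasDerivWithinAt_coord (h2.comp_hasDerivAt 0 h1).hasDerivWithinAt 1).hasDerivAt univ_mem
  have h00 : Z.X !₂[0, 0] 1 = Z.X 0 1 := by rw [Tame.vec_zero]
  have hc : ContinuousAt (fun x : ℝ => Z.X !₂[x, 0] 1) 0 := hder.continuousAt
  have hneg : Tendsto (fun x : ℝ => -x) (𝓝[>] 0) (𝓝 0) := by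
    have : Continuous fun x : ℝ => -x := continuous_neg
    simpa using (this.continuousWithinAt (s := Ioi 0) (x := 0)).tendsto
  have hR : ∀ᶠ x : ℝ in 𝓝[>] 0, 0 < rightSign (Z.X 0 1) * Z.X !₂[x, 0] 1 ∧
      0 < leftSign (Z.X 0 1) * Z.X !₂[-x, 0] 1 := by
    unfold leftSign rightSign
    rcases lt_trichotomy (Z.X 0 1) 0 with h | h | h
    · have h1 : ∀ᶠ x : ℝ in 𝓝 0, Z.X !₂[x, 0] 1 < 0 := hc.eventually (gt_mem_nhds (h00.trans_lt h))
      filter_upwards [h1.filter_mono nhdsWithin_le_nhds, hneg.eventually h1] with x h2 h3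
      rw [if_pos h, if_neg (not_lt.2 h.le)]
      constructor <;> linarith
    · have h1 : StrictIncAt univ (fun x : ℝ => Z.X !₂[x, 0] 1) 0 :=
        .of_hasDerivWithinAt hder.hasDerivWithinAt hX1
      rw [StrictIncAt, nhdsWithin_univ, h00, h] at h1
      filter_upwards [h1.filter_mono nhdsWithin_le_nhds, hneg.eventually h1, self_mem_nhdsWithin]
        with x h2 h3 hx
      have h4 := h2.2 hx
      have h5 := h3.1 (neg_lt_zero.2 hx)
      rw [if_neg (by rw [h]; exact lt_irrefl _), if_neg (by rw [h]; exact lt_irrefl _)]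
      constructor <;> linarith
    · have h1 : ∀ᶠ x : ℝ in 𝓝 0, 0 < Z.X !₂[x, 0] 1 := hc.eventually (lt_mem_nhds (h.trans_eq h00.symm))
      filter_upwards [h1.filter_mono nhdsWithin_le_nhds, hneg.eventually h1] with x h2 h3
      rw [if_neg (not_lt.2 h.le), if_pos h]
      constructor <;> linarith
  refine tameAt_of_signs hX hY ha hb hX0 hY0 hY1 hsteep ?_ ?_ (hR.mono fun x h => h.1)
    (hR.mono fun x h => h.2)
  · unfold leftSign; split_ifs <;> norm_num
  · unfold rightSign; split_ifs <;> norm_num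

theorem contDiff_vec {u v : Plane → ℝ} (hu : ContDiff ℝ 1 u) (hv : ContDiff ℝ 1 v) :
    ContDiff ℝ 1 fun p => (!₂[u p, v p] : Plane) := by
  rw [contDiff_euclidean]
  intro i
  fin_cases i
  · exact hu
  · exact hv

theorem normalForm_tameAt {a b α : ℝ} (ha : a * a = 1) (hb : b * b = 1) (hα : |α| < 1) :
    (normalForm a b α).TameAt a b (leftSign (-α)) (rightSign (-α)) := by
  have hco : ∀ i, ContDiff ℝ 1 fun p : Plane => p i := fun i =>
    (EuclideanSpace.proj i : Plane →L[ℝ] ℝ).contDiff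
  have hX : ContDiff ℝ 1 (normalForm a b α).X :=
    contDiff_vec contDiff_const ((hco 0).sub contDiff_const)
  have hY : ContDiff ℝ 1 (normalForm a b α).Y := contDiff_const
  have e0 : (normalForm a b α).X 0 0 = 1 := rfl
  have e1 : (normalForm a b α).X 0 1 = -α := by
    change (0 : ℝ) - α = -α
    ring
  have e2 : (normalForm a b α).Y 0 0 = a := rfl
  have e3 : (normalForm a b α).Y 0 1 = b := rfl
  have habs : ∀ {s : ℝ}, s * s = 1 → |s| = 1 := fun hs => by
    rcases mul_self_eq_one_iff.1 hs with h | h <;> simp [h]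
  have hp : partialAtZero (normalForm a b α).X 1 0 = 1 := by
    have h1 := (hX.differentiable (by norm_num) 0).hasFDerivAt
    have h2 : HasFDerivAt (fun p : Plane => (normalForm a b α).X p 1)
        ((EuclideanSpace.proj 1 : Plane →L[ℝ] ℝ).comp (fderiv ℝ (normalForm a b α).X 0)) 0 :=
      (EuclideanSpace.proj 1 : Plane →L[ℝ] ℝ).hasFDerivAt.comp 0 h1
    have h3 : HasFDerivAt (fun p : Plane => (normalForm a b α).X p 1)
        (EuclideanSpace.proj 0 : Plane →L[ℝ] ℝ) 0 :=
      ((EuclideanSpace.proj 0 : Plane →L[ℝ] ℝ).hasFDerivAt).sub_const α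
    have h4 := congrArg (fun L : Plane →L[ℝ] ℝ => L (EuclideanSpace.single 0 1)) (h2.unique h3)
    simpa [partialAtZero] using h4
  have := tameAt_of_partial_pos (Z := normalForm a b α) (a := a) (b := b) hX.contDiffAt
    hY.contDiffAt ha hb (by rw [e0]; exact one_pos) (by rw [hp]; exact one_pos)
    (by rw [e2, ha]; exact one_pos) (by rw [e3, hb]; exact one_pos)
    (by rw [e0, e1, e2, e3, habs ha, habs hb, abs_neg]; linarith)
  rwa [e1] at this

/-! ### Folds and symmetries -/

/-- The isometry which permutes the coordinates by `e` and changes their signs by `ε`. -/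
noncomputable def signedPerm (ε : Fin 2 → ℝ) (e : Equiv.Perm (Fin 2)) (hε : ∀ i, ε i * ε i = 1) :
    Plane ≃ₗᵢ[ℝ] Plane where
  toFun p := WithLp.toLp 2 fun i => ε i * p (e i)
  invFun p := WithLp.toLp 2 fun i => ε (e.symm i) * p (e.symm i)
  map_add' p q := by ext i; simp [mul_add]
  map_smul' l p := by ext i; simp [mul_left_comm]
  left_inv p := by
    ext i
    simp [← mul_assoc, hε]
  right_inv p := by
    ext i
    simp [← mul_assoc, hε]
  norm_map' p := by
    have h1 : ∀ i, |ε i| = 1 := fun i => by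
      rcases mul_self_eq_one_iff.1 (hε i) with h | h <;> simp [h]
    rw [EuclideanSpace.norm_eq, EuclideanSpace.norm_eq, ← Equiv.sum_comp e fun i => ‖p i‖ ^ 2]
    simp [h1]

theorem isSignedPerm_signedPerm (ε : Fin 2 → ℝ) (e : Equiv.Perm (Fin 2))
    (hε : ∀ i, ε i * ε i = 1) : IsSignedPerm (signedPerm ε e hε) ε e := ⟨fun _ _ => rfl, hε⟩

namespace IsSignedPerm

variable {A : Plane ≃ₗᵢ[ℝ] Plane} {ε : Fin 2 → ℝ} {e : Equiv.Perm (Fin 2)}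

theorem symm_single (h : IsSignedPerm A ε e) (j : Fin 2) :
    A.symm (EuclideanSpace.single j 1) = ε j • EuclideanSpace.single (e j) 1 := by
  rw [LinearIsometryEquiv.symm_apply_eq]
  ext i
  rw [h.apply]
  by_cases hij : i = j
  · subst hij; simp [h.sq]
  · simp [hij]

theorem contDiffAt_transform (h : IsSignedPerm A ε e) (τ : ℤˣ) {Z : PiecewiseField}
    (hX : ContDiffAt ℝ 1 Z.X 0) (hY : ContDiffAt ℝ 1 Z.Y 0) :
    ContDiffAt ℝ 1 (Z.transform A τ).X 0 ∧ ContDiffAt ℝ 1 (Z.transform A τ).Y 0 := by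
  have key : ∀ {V : Plane → Plane}, ContDiffAt ℝ 1 V 0 →
      ContDiffAt ℝ 1 (fun p => timeSign τ • A (V (A.symm p))) 0 := by
    intro V hV
    have h1 : ContDiffAt ℝ 1 (fun p => V (A.symm p)) 0 := by
      refine ContDiffAt.comp (g := V) (f := A.symm) 0 ?_ A.symm.contDiff.contDiffAt
      rwa [map_zero]
    exact (A.contDiff.contDiffAt.comp 0 h1).const_smul _
  constructor
  · rw [show (Z.transform A τ).X = _ from funext (h.transform_X τ Z)]
    refine key ?_
    unfold fst; split_ifs <;> assumption
  · rw [show (Z.transform A τ).Y = _ from funext (h.transform_Y τ Z)]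
    refine key ?_
    unfold snd; split_ifs <;> assumption

theorem partialAtZero_transform (h : IsSignedPerm A ε e) (τ : ℤˣ) {Z : PiecewiseField}
    (hd : DifferentiableAt ℝ (fst ε Z) 0) (i j : Fin 2) :
    partialAtZero (Z.transform A τ).X i j =
      timeSign τ * ε i * ε j * partialAtZero (fst ε Z) (e i) (e j) := by
  have h1 : HasFDerivAt (fst ε Z) (fderiv ℝ (fst ε Z) 0) (A.symm 0) := by
    rw [map_zero]; exact hd.hasFDerivAt
  have h2 : HasFDerivAt (Z.transform A τ).X (timeSign τ • (A.toContinuousLinearEquiv :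
      Plane →L[ℝ] Plane).comp ((fderiv ℝ (fst ε Z) 0).comp
      (A.symm.toContinuousLinearEquiv : Plane →L[ℝ] Plane))) 0 := by
    rw [show (Z.transform A τ).X = _ from funext (h.transform_X τ Z)]
    exact ((A.toContinuousLinearEquiv : Plane →L[ℝ] Plane).hasFDerivAt.comp 0
      (h1.comp 0 (A.symm.toContinuousLinearEquiv : Plane →L[ℝ] Plane).hasFDerivAt)).const_smul
      (timeSign τ)
  rw [partialAtZero, h2.fderiv]
  have h3 : A (fderiv ℝ (fst ε Z) 0 (A.symm (EuclideanSpace.single j 1))) i =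
      ε i * ε j * partialAtZero (fst ε Z) (e i) (e j) := by
    rw [h.symm_single, map_smul, h.apply, PiLp.smul_apply, smul_eq_mul, partialAtZero]
    ring
  change timeSign τ * A (fderiv ℝ (fst ε Z) 0 (A.symm (EuclideanSpace.single j 1))) i = _
  rw [h3]; ring

theorem transform_X_zero (h : IsSignedPerm A ε e) (τ : ℤˣ) (Z : PiecewiseField) (i : Fin 2) :
    (Z.transform A τ).X 0 i = timeSign τ * ε i * fst ε Z 0 (e i) := by
  have := h.transform_X_apply τ Z 0 i
  rwa [map_zero] at this

theorem transform_Y_zero (h : IsSignedPerm A ε e) (τ : ℤˣ) (Z : PiecewiseField) (i : Fin 2) :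
    (Z.transform A τ).Y 0 i = timeSign τ * ε i * snd ε Z 0 (e i) := by
  have := h.transform_Y_apply τ Z 0 i
  rwa [map_zero] at this

theorem sign_ne_zero (h : IsSignedPerm A ε e) (τ : ℤˣ) (i : Fin 2) : timeSign τ * ε i ≠ 0 :=
  fun h0 => by
    have := h.sign_sq τ i
    rw [h0, mul_zero] at this
    exact zero_ne_one this

/-- A symmetry turns folds into folds. -/
theorem hasRegularFold (h : IsSignedPerm A ε e) (τ : ℤˣ) {Z : PiecewiseField}
    (hd : DifferentiableAt ℝ (fst ε Z) 0) (hZ : (Z.transform A τ).HasStandardFold) :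
    Z.HasRegularFold := by
  obtain ⟨⟨h1, h2⟩, h3, -, -⟩ := hZ
  have hf : IsFold (fst ε Z) (e 1) := by
    rw [h.transform_X_zero] at h1
    rw [h.transform_X_zero, h.partialAtZero_transform τ hd] at h2
    refine ⟨(mul_eq_zero.1 h1).resolve_left (h.sign_ne_zero τ 1), ?_⟩
    rw [← perm_add_one]
    exact mul_ne_zero (right_ne_zero_of_mul (left_ne_zero_of_mul h2))
      (right_ne_zero_of_mul (right_ne_zero_of_mul h2))
  have hs : ∀ l, snd ε Z 0 l ≠ 0 := by
    intro l
    have := h3 (e.symm l)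
    rw [h.transform_Y_zero, e.apply_symm_apply] at this
    exact right_ne_zero_of_mul this
  unfold fst at hf
  unfold snd at hs
  by_cases hD : ε 0 * ε 1 = 1
  · rw [if_pos hD] at hf hs
    exact Or.inl ⟨_, hf, hs⟩
  · rw [if_neg hD] at hf hs
    exact Or.inr ⟨_, hf, hs⟩

end IsSignedPerm

theorem exists_timeSign_eq {s : ℝ} (hs : s * s = 1) : ∃ τ, timeSign τ = s := by
  rcases mul_self_eq_one_iff.1 hs with rfl | rfl
  · exact ⟨1, by simp [timeSign]⟩
  · exact ⟨-1, by simp [timeSign]⟩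

theorem exists_sign {u : ℝ} (hu : u ≠ 0) : ∃ s : ℝ, s * s = 1 ∧ 0 < s * u := by
  rcases hu.lt_or_gt with h | h
  · exact ⟨-1, by norm_num, by linarith⟩
  · exact ⟨1, by norm_num, by linarith⟩

/-- Every regular-fold becomes a standard one under a symmetry. -/
theorem HasRegularFold.exists_transform {Z : PiecewiseField} (hZ : Z.HasRegularFold)
    (hX : DifferentiableAt ℝ Z.X 0) (hY : DifferentiableAt ℝ Z.Y 0) :
    ∃ (A : Plane ≃ₗᵢ[ℝ] Plane) (ε : Fin 2 → ℝ) (e : Equiv.Perm (Fin 2)) (τ : ℤˣ),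
      IsSignedPerm A ε e ∧ (Z.transform A τ).HasStandardFold := by
  -- `D = 1` if the fold is one of `X`, and `D = -1` if it is one of `Y`
  obtain ⟨D, V, W, i, hD, hV, hf, hW, hVd⟩ : ∃ (D : ℝ) (V W : Plane → Plane) (i : Fin 2),
      D * D = 1 ∧ (∀ ε : Fin 2 → ℝ, ε 0 * ε 1 = D → IsSignedPerm.fst ε Z = V ∧
        IsSignedPerm.snd ε Z = W) ∧ IsFold V i ∧ (∀ l, W 0 l ≠ 0) ∧ DifferentiableAt ℝ V 0 := by
    rcases hZ with ⟨i, h1, h2⟩ | ⟨i, h1, h2⟩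
    · exact ⟨1, Z.X, Z.Y, i, by norm_num, fun ε hε => ⟨if_pos hε, if_pos hε⟩, h1, h2, hX⟩
    · refine ⟨-1, Z.Y, Z.X, i, by norm_num, fun ε hε => ?_, h1, h2, hY⟩
      have : ¬ ε 0 * ε 1 = 1 := by rw [hε]; norm_num
      exact ⟨if_neg this, if_neg this⟩
  obtain ⟨e, he1⟩ : ∃ e : Equiv.Perm (Fin 2), e 1 = i := ⟨Equiv.swap 1 i, Equiv.swap_apply_left 1 i⟩
  have he0 : e 0 = i + 1 := by rw [← he1, ← perm_add_one]; rfl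
  obtain ⟨su, hsu, hsu'⟩ := exists_sign (left_ne_zero_of_mul hf.2)
  obtain ⟨sw, hsw, hsw'⟩ := exists_sign (right_ne_zero_of_mul hf.2)
  obtain ⟨τ, hτ⟩ := exists_timeSign_eq (s := sw * D) (by rw [mul_mul_mul_comm, hsw, hD, one_mul])
  -- `ε₀ ε₁ = D` puts the folded field into the region of `X`; `τ ε₀ = su` makes `X₁(0)` positive
  -- and `τ ε₀ ε₁ = sw` makes `∂X₂/∂x₁(0)` positive
  set ε : Fin 2 → ℝ := ![sw * D * su, D * (sw * D * su)] with hε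
  have e0 : ε 0 = sw * D * su := rfl
  have e1 : ε 1 = D * (sw * D * su) := rfl
  have hsq0 : ε 0 * ε 0 = 1 := by
    rw [e0]; linear_combination (D * D * (su * su)) * hsw + (su * su) * hD + hsu
  have hdet : ε 0 * ε 1 = D := by
    rw [e1, ← e0]; linear_combination D * hsq0
  have hsq : ∀ l, ε l * ε l = 1 := by
    intro l
    fin_cases l
    · exact hsq0
    · change ε 1 * ε 1 = 1
      rw [e1, ← e0]; linear_combination (D * D) * hsq0 + hD
  have hA := isSignedPerm_signedPerm ε e hsq
  obtain ⟨hfst, hsnd⟩ := hV ε hdet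
  have hfst0 : ∀ l, (Z.transform (signedPerm ε e hsq) τ).X 0 l =
      timeSign τ * ε l * V 0 (e l) := fun l => by rw [hA.transform_X_zero, hfst]
  have hpos0 : 0 < (Z.transform (signedPerm ε e hsq) τ).X 0 0 := by
    rw [hfst0, he0, hτ, e0]
    have : sw * D * (sw * D * su) * V 0 (i + 1) = su * V 0 (i + 1) := by
      linear_combination (D * D * su * V 0 (i + 1)) * hsw + (su * V 0 (i + 1)) * hD
    rwa [this]
  have hpos1 : 0 < partialAtZero (Z.transform (signedPerm ε e hsq) τ).X 1 0 := by
    rw [hA.partialAtZero_transform τ (by rw [hfst]; exact hVd), hfst, he0, he1, hτ, mul_assoc _ (ε 1),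
      mul_comm (ε 1), hdet, mul_assoc sw, hD, mul_one]
    exact hsw'
  refine ⟨_, ε, e, τ, hA, ⟨?_, ?_⟩, fun l => ?_, hpos0, hpos1⟩
  · rw [hfst0, he1, hf.1, mul_zero]
  · exact mul_ne_zero hpos0.ne' hpos1.ne'
  · rw [hA.transform_Y_zero, hsnd]
    exact mul_ne_zero (hA.sign_ne_zero τ l) (hW _)

end PiecewiseField

/-! ### Functionals on the space of fields -/

namespace CrField

variable {r : ℕ} {U : Opens Plane}

theorem toFun_add (V W : CrField r U) : (V + W).toFun = V.toFun + W.toFun := rfl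

theorem toFun_smul (l : ℝ) (V : CrField r U) : (l • V).toFun = l • V.toFun := rfl

theorem contDiffAt (hr : 1 ≤ r) (h0 : (0 : Plane) ∈ U) (V : CrField r U) :
    ContDiffAt ℝ 1 V.toFun 0 :=
  (V.2.1.contDiffAt (U.isOpen.mem_nhds h0)).of_le (by exact_mod_cast hr)

theorem norm_iteratedFDerivWithin_le (V : CrField r U) {k : ℕ} (hk : k ≤ r) {p : Plane}
    (hp : p ∈ U) : ‖iteratedFDerivWithin ℝ k V.toFun U p‖ ≤ ‖V‖ := by
  have h1 : ‖V‖ = ‖jet V‖ := rfl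
  have h2 := (jet V ⟨k, Nat.lt_succ_of_le hk⟩).norm_coe_le_norm ⟨p, hp⟩
  rw [h1]
  exact h2.trans (norm_le_pi_norm (jet V) ⟨k, Nat.lt_succ_of_le hk⟩)

/-- The value of a field at the origin. -/
noncomputable def evalZero (h0 : (0 : Plane) ∈ U) : CrField r U →L[ℝ] Plane :=
  LinearMap.mkContinuous ⟨⟨fun V => V.toFun 0, fun V W => by rw [toFun_add]; rfl⟩,
    fun l V => rfl⟩ 1 fun V => by
      rw [one_mul]
      have := V.norm_iteratedFDerivWithin_le (Nat.zero_le r) h0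
      rwa [norm_iteratedFDerivWithin_zero] at this

/-- The partial derivative `∂V_i/∂x_j` at the origin. -/
noncomputable def partialZero (hr : 1 ≤ r) (h0 : (0 : Plane) ∈ U) (i j : Fin 2) :
    CrField r U →L[ℝ] ℝ :=
  LinearMap.mkContinuous ⟨⟨fun V => PiecewiseField.partialAtZero V.toFun i j, fun V W => by
      rw [toFun_add, PiecewiseField.partialAtZero, fderiv_add
        ((contDiffAt hr h0 V).differentiableAt (by norm_num))
        ((contDiffAt hr h0 W).differentiableAt (by norm_num))]
      rfl⟩,
    fun l V => by
      simp only [RingHom.id_apply]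
      rw [toFun_smul, PiecewiseField.partialAtZero,
        fderiv_const_smul ((contDiffAt hr h0 V).differentiableAt (by norm_num))]
      rfl⟩ 1 fun V => by
      have h1 := V.norm_iteratedFDerivWithin_le hr h0
      rw [norm_iteratedFDerivWithin_one _ (U.isOpen.uniqueDiffWithinAt h0),
        fderivWithin_of_isOpen U.isOpen h0] at h1
      rw [one_mul]
      refine le_trans ?_ h1
      refine (PiLp.norm_apply_le _ i).trans ((ContinuousLinearMap.le_opNorm _ _).trans ?_)
      simp

open scoped Classical in
/-- The constant field. -/
noncomputable def const (r : ℕ) (U : Opens Plane) (v : Plane) : CrField r U :=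
  ⟨fun p => if p ∈ U then v else 0, by
    have he : EqOn (fun p => if p ∈ U then v else 0) (fun _ => v) (U : Set Plane) :=
      fun p hp => if_pos hp
    refine ⟨contDiffOn_const.congr he, fun p hp => if_neg hp, fun k _ => ?_⟩
    have h1 : ∃ w, ∀ p : U, iteratedFDerivWithin ℝ k (fun p => if p ∈ U then v else 0) U p = w := by
      rcases Nat.eq_zero_or_pos k with rfl | hk
      · refine ⟨(continuousMultilinearCurryFin0 ℝ Plane Plane).symm v, fun p => ?_⟩
        rw [iteratedFDerivWithin_congr he p.2]
        rfl
      · refine ⟨0, fun p => ?_⟩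
        rw [iteratedFDerivWithin_congr he p.2, iteratedFDerivWithin_const_of_ne hk.ne']
        rfl
    obtain ⟨w, hw⟩ := h1
    refine ⟨?_, ‖w‖, fun p hp => (congrArg norm (hw ⟨p, hp⟩)).le⟩
    simp only [hw]
    exact uniformContinuous_const⟩

theorem const_apply (r : ℕ) {U : Opens Plane} (v : Plane) {p : Plane} (hp : p ∈ U) :
    (const r U v).toFun p = v := if_pos hp

end CrField

namespace Omega

variable {r : ℕ} {U : Opens Plane}

/-- The component of `Z` that becomes `X` under a symmetry with signs `ε`. -/
noncomputable def fst (ε : Fin 2 → ℝ) : Omega r U →L[ℝ] CrField r U :=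
  if ε 0 * ε 1 = 1 then ContinuousLinearMap.fst ℝ _ _ else ContinuousLinearMap.snd ℝ _ _

/-- The component of `Z` that becomes `Y` under a symmetry with signs `ε`. -/
noncomputable def snd (ε : Fin 2 → ℝ) : Omega r U →L[ℝ] CrField r U :=
  if ε 0 * ε 1 = 1 then ContinuousLinearMap.snd ℝ _ _ else ContinuousLinearMap.fst ℝ _ _

theorem fst_toField (ε : Fin 2 → ℝ) (Z : Omega r U) :
    PiecewiseField.IsSignedPerm.fst ε Z.toField = (fst ε Z).toFun := by
  unfold PiecewiseField.IsSignedPerm.fst fst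
  split_ifs <;> rfl

theorem snd_toField (ε : Fin 2 → ℝ) (Z : Omega r U) :
    PiecewiseField.IsSignedPerm.snd ε Z.toField = (snd ε Z).toFun := by
  unfold PiecewiseField.IsSignedPerm.snd snd
  split_ifs <;> rfl

/-- The component `X₂` at the origin of the transformed field. -/
noncomputable def foldValue (h0 : (0 : Plane) ∈ U) (ε : Fin 2 → ℝ) (e : Equiv.Perm (Fin 2))
    (τ : ℤˣ) : Omega r U →L[ℝ] ℝ :=
  (PiecewiseField.timeSign τ * ε 1) •
    ((EuclideanSpace.proj (e 1) : Plane →L[ℝ] ℝ).comp ((CrField.evalZero h0).comp (fst ε)))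

open PiecewiseField

section Symmetry

variable {A : Plane ≃ₗᵢ[ℝ] Plane} {ε : Fin 2 → ℝ} {e : Equiv.Perm (Fin 2)} {τ : ℤˣ}

theorem foldValue_eq (hA : IsSignedPerm A ε e) (h0 : (0 : Plane) ∈ U) (Z : Omega r U) :
    foldValue h0 ε e τ Z = (Z.toField.transform A τ).X 0 1 := by
  rw [hA.transform_X_zero, fst_toField]
  rfl

/-- Near a field with a standard fold the type depends on the value of `X₂` at the origin only. -/
theorem eventually_tameAt (hr : 1 ≤ r) (h0 : (0 : Plane) ∈ U) (hA : IsSignedPerm A ε e)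
    {Z : Omega r U} (hZ : (Z.toField.transform A τ).HasStandardFold) :
    ∀ᶠ W in 𝓝 Z, (W.toField.transform A τ).TameAt
        (Real.sign ((Z.toField.transform A τ).Y 0 0)) (Real.sign ((Z.toField.transform A τ).Y 0 1))
        (leftSign (foldValue h0 ε e τ W)) (rightSign (foldValue h0 ε e τ W)) ∧
      (foldValue h0 ε e τ W = 0 → W.toField.HasRegularFold) := by
  have hcX : ∀ i, Continuous fun W : Omega r U => (W.toField.transform A τ).X 0 i := by
    intro i
    have e1 : (fun W : Omega r U => (W.toField.transform A τ).X 0 i) = fun W =>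
        timeSign τ * ε i * (EuclideanSpace.proj (e i) : Plane →L[ℝ] ℝ)
          (CrField.evalZero h0 (fst ε W)) := by
      funext W
      rw [hA.transform_X_zero, fst_toField]
      rfl
    rw [e1]
    fun_prop
  have hcY : ∀ i, Continuous fun W : Omega r U => (W.toField.transform A τ).Y 0 i := by
    intro i
    have e1 : (fun W : Omega r U => (W.toField.transform A τ).Y 0 i) = fun W =>
        timeSign τ * ε i * (EuclideanSpace.proj (e i) : Plane →L[ℝ] ℝ)
          (CrField.evalZero h0 (snd ε W)) := by
      funext W
      rw [hA.transform_Y_zero, snd_toField]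
      rfl
    rw [e1]
    fun_prop
  have hdiff : ∀ W : Omega r U, DifferentiableAt ℝ (IsSignedPerm.fst ε W.toField) 0 := fun W => by
    rw [fst_toField]
    exact (CrField.contDiffAt hr h0 _).differentiableAt (by norm_num)
  have hcP : Continuous fun W : Omega r U => partialAtZero (W.toField.transform A τ).X 1 0 := by
    have e1 : (fun W : Omega r U => partialAtZero (W.toField.transform A τ).X 1 0) = fun W =>
        timeSign τ * ε 1 * ε 0 * CrField.partialZero hr h0 (e 1) (e 0) (fst ε W) := by
      funext W
      rw [hA.partialAtZero_transform τ (hdiff W), fst_toField]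
      rfl
    rw [e1]
    fun_prop
  obtain ⟨⟨h1, -⟩, h3, h4, h5⟩ := hZ
  have hsign : ∀ {u : ℝ}, u ≠ 0 → Real.sign u * Real.sign u = 1 ∧ 0 < Real.sign u * u := by
    intro u hu
    rcases hu.lt_or_gt with h | h
    · rw [Real.sign_of_neg h]; exact ⟨by norm_num, by linarith⟩
    · rw [Real.sign_of_pos h]; exact ⟨by norm_num, by linarith⟩
  have hs0 := hsign (h3 0)
  have hs1 := hsign (h3 1)
  have hst : ∀ᶠ W : Omega r U in 𝓝 Z, |(W.toField.transform A τ).X 0 1| *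
      |(W.toField.transform A τ).Y 0 0| < (W.toField.transform A τ).X 0 0 *
      |(W.toField.transform A τ).Y 0 1| := by
    refine ((hcX 1).abs.mul (hcY 0).abs).continuousAt.eventually_lt
      ((hcX 0).mul (hcY 1).abs).continuousAt ?_
    change |(Z.toField.transform A τ).X 0 1| * |(Z.toField.transform A τ).Y 0 0| <
      (Z.toField.transform A τ).X 0 0 * |(Z.toField.transform A τ).Y 0 1|
    rw [h1, abs_zero, zero_mul]
    exact mul_pos h4 (abs_pos.2 (h3 1))
  filter_upwards [(hcX 0).continuousAt.eventually (lt_mem_nhds h4),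
    hcP.continuousAt.eventually (lt_mem_nhds h5),
    (continuous_const.mul (hcY 0)).continuousAt.eventually (lt_mem_nhds hs0.2),
    (continuous_const.mul (hcY 1)).continuousAt.eventually (lt_mem_nhds hs1.2), hst]
    with W w1 w2 w3 w4 w5
  obtain ⟨c1, c2⟩ := hA.contDiffAt_transform τ (Z := W.toField) (CrField.contDiffAt hr h0 W.1)
    (CrField.contDiffAt hr h0 W.2)
  refine ⟨?_, fun hz => ?_⟩
  · rw [foldValue_eq hA h0 W]
    exact tameAt_of_partial_pos c1 c2 hs0.1 hs1.1 w1 w2 w3 w4 w5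
  · rw [foldValue_eq hA h0 W] at hz
    refine hA.hasRegularFold τ (hdiff W) ⟨⟨hz, mul_ne_zero w1.ne' w2.ne'⟩, ?_, w1, w2⟩
    intro l
    fin_cases l
    · exact right_ne_zero_of_mul w3.ne'
    · exact right_ne_zero_of_mul w4.ne'

end Symmetry

end Omega

/-! ### Sign changes -/

/-- Near `0`, the function has the sign of its argument, or the opposite one. -/
def ChangesSign (ψ : ℝ → ℝ) : Prop :=
  ∃ s : ℝ, s * s = 1 ∧ ∀ᶠ x in 𝓝 0, SignType.sign (ψ x) = SignType.sign (s * x)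

theorem ChangesSign.of_hasDerivAt {ψ : ℝ → ℝ} {d : ℝ} (h0 : ψ 0 = 0) (h : HasDerivAt ψ d 0)
    (hd : d ≠ 0) : ChangesSign ψ := by
  obtain ⟨s, hs, hsd⟩ := PiecewiseField.exists_sign hd
  have h1 : StrictIncAt univ (fun x => s * ψ x) 0 :=
    .of_hasDerivWithinAt (h.const_mul s).hasDerivWithinAt hsd
  rw [StrictIncAt, nhdsWithin_univ, h0, mul_zero] at h1
  refine ⟨s, hs, h1.mono fun x hx => ?_⟩
  have h2 : SignType.sign (s * ψ x) = SignType.sign x := by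
    rcases lt_trichotomy x 0 with h | h | h
    · rw [sign_neg h, sign_neg (hx.1 h)]
    · rw [h, h0, mul_zero]
    · rw [sign_pos h, sign_pos (hx.2 h)]
  rw [sign_mul, ← h2, sign_mul, ← mul_assoc, ← sign_mul, hs, sign_one, one_mul]

/-- A function which pulls back along a continuous `μ` to one with the sign of its argument
changes its sign. -/
theorem ChangesSign.of_comp {ψ μ : ℝ → ℝ} (hμ : ∀ᶠ t in 𝓝 0, ContinuousAt μ t) (hμ0 : μ 0 = 0)
    (h : ∀ᶠ t in 𝓝 0, SignType.sign (ψ (μ t)) = SignType.sign t) : ChangesSign ψ := by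
  obtain ⟨ρ', hρ', hball⟩ := Metric.eventually_nhds_iff.1 (hμ.and h)
  obtain ⟨ρ, hρ, hρρ⟩ := exists_between hρ'
  have hI : ∀ t ∈ Icc (-ρ) ρ, ContinuousAt μ t ∧ SignType.sign (ψ (μ t)) = SignType.sign t := by
    intro t ht
    refine hball ?_
    rw [Real.dist_eq, sub_zero]
    exact (abs_le.2 ht).trans_lt hρρ
  have hne : ∀ t ∈ Icc (-ρ) ρ, t ≠ 0 → μ t ≠ 0 := by
    intro t ht ht0 h0
    have h1 := (hI t ht).2
    have h2 := (hI 0 ⟨by linarith, hρ.le⟩).2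
    rw [hμ0, sign_zero] at h2
    rw [h0, h2] at h1
    exact ht0 (sign_eq_zero_iff.1 h1.symm)
  have hρm : ρ ∈ Icc (-ρ) ρ := ⟨by linarith, le_rfl⟩
  have hρm' : -ρ ∈ Icc (-ρ) ρ := ⟨le_rfl, by linarith⟩
  obtain ⟨s, hs, hsp⟩ := PiecewiseField.exists_sign (hne ρ hρm hρ.ne')
  have hsy : ∀ {x y : ℝ}, s * x = s * y → x = y := by
    intro x y hxy
    have := congrArg (s * ·) hxy
    simpa only [← mul_assoc, hs, one_mul] using this
  have hcont : ∀ {S : Set ℝ}, S ⊆ Icc (-ρ) ρ → ContinuousOn (fun t => s * μ t) S := fun hS t ht =>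
    (continuousAt_const.mul (hI t (hS ht)).1).continuousWithinAt
  have hs0 : s * μ 0 = 0 := by rw [hμ0, mul_zero]
  have hpos : ∀ x, 0 < x → x ≤ s * μ ρ → ∃ t ∈ Icc (-ρ) ρ, 0 < t ∧ s * μ t = x := by
    intro x hx hx'
    obtain ⟨t, ht, hte⟩ := intermediate_value_Icc hρ.le
      (hcont (Icc_subset_Icc (by linarith) le_rfl)) ⟨hs0.trans_le hx.le, hx'⟩
    refine ⟨t, ⟨by linarith [ht.1], ht.2⟩, ht.1.lt_of_ne ?_, hte⟩
    rintro rfl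
    change s * μ 0 = x at hte
    linarith
  -- the curve `μ` crosses `0`: on one side only, it would meet a value at times of both signs
  have hsn : s * μ (-ρ) < 0 := by
    by_contra hcon
    have hne' : s * μ (-ρ) ≠ 0 := fun h0 =>
      hne _ hρm' (by linarith) (hsy (h0.trans (mul_zero s).symm))
    have hgt : 0 < s * μ (-ρ) := (not_lt.1 hcon).lt_of_ne hne'.symm
    obtain ⟨x, hx, hxm⟩ := exists_between (lt_min hsp hgt)
    obtain ⟨t, ht, ht0, hte⟩ := hpos x hx (hxm.le.trans (min_le_left _ _))
    obtain ⟨t', ht', hte'⟩ := intermediate_value_Icc' (by linarith : -ρ ≤ 0)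
      (hcont (Icc_subset_Icc le_rfl hρ.le)) ⟨hs0.trans_le hx.le, hxm.le.trans (min_le_right _ _)⟩
    have h1 := (hI t ht).2
    have h2 := (hI t' ⟨ht'.1, ht'.2.trans hρ.le⟩).2
    rw [hsy (hte.trans hte'.symm), h2, sign_pos ht0, sign_eq_one_iff] at h1
    exact absurd ht'.2 (not_le.2 h1)
  have hneg : ∀ x, x < 0 → s * μ (-ρ) ≤ x → ∃ t ∈ Icc (-ρ) ρ, t < 0 ∧ s * μ t = x := by
    intro x hx hx'
    obtain ⟨t, ht, hte⟩ := intermediate_value_Icc (by linarith : -ρ ≤ 0)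
      (hcont (Icc_subset_Icc le_rfl hρ.le)) ⟨hx', hx.le.trans_eq hs0.symm⟩
    refine ⟨t, ⟨ht.1, by linarith [ht.2]⟩, ht.2.lt_of_ne ?_, hte⟩
    rintro rfl
    change s * μ 0 = x at hte
    linarith
  have hsx : ContinuousAt (fun y : ℝ => s * y) 0 := by fun_prop
  have hsx0 : s * (0 : ℝ) = 0 := mul_zero s
  refine ⟨s, hs, ?_⟩
  filter_upwards [hsx.eventually (lt_mem_nhds (hsn.trans_eq hsx0.symm)),
    hsx.eventually (gt_mem_nhds (hsx0.trans_lt hsp))] with y hy1 hy2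
  rcases lt_trichotomy (s * y) 0 with h1 | h1 | h1
  · obtain ⟨t, ht, ht0, hte⟩ := hneg _ h1 hy1.le
    rw [← hsy hte, (hI t ht).2, sign_neg ht0, hte, sign_neg h1]
  · have hy : y = 0 := hsy (h1.trans hsx0.symm)
    have h2 := (hI 0 ⟨by linarith, hρ.le⟩).2
    rw [hμ0] at h2
    rw [hy, h2, hsx0]
  · obtain ⟨t, ht, ht0, hte⟩ := hpos _ h1 hy2.le
    rw [← hsy hte, (hI t ht).2, sign_pos ht0, hte, sign_pos h1]

/-! ### Unfoldings -/

namespace Omega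

open PiecewiseField

variable {r : ℕ} {U : Opens Plane}

theorem IsUnfolding.contDiffAt {m : ℕ} {k : WithTop ℕ∞} {Z : Omega r U}
    {γ : (Fin m → ℝ) → Omega r U} (h : IsUnfolding k Z γ) : ContDiffAt ℝ k γ 0 := by
  obtain ⟨δ₀, hδ, hc⟩ := h.2
  refine hc.contDiffAt ?_
  have : ∀ᶠ δ : Fin m → ℝ in 𝓝 0, ∀ i, |δ i| < δ₀ := by
    refine eventually_all.2 fun i => ?_
    have h1 : ContinuousAt (fun δ : Fin m → ℝ => |δ i|) 0 :=
      (continuous_apply i).abs.continuousAt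
    exact h1.eventually (gt_mem_nhds (by simpa using hδ))
  exact this

/-- A field whose first component, as seen by the symmetry, is the constant field that raises
`foldValue` at unit rate. -/
noncomputable def raise (r : ℕ) (U : Opens Plane) (ε : Fin 2 → ℝ) (e : Equiv.Perm (Fin 2))
    (τ : ℤˣ) : Omega r U :=
  let V := CrField.const r U ((timeSign τ * ε 1) • EuclideanSpace.single (e 1) 1)
  if ε 0 * ε 1 = 1 then (V, 0) else (0, V)

section Symmetry

variable {A : Plane ≃ₗᵢ[ℝ] Plane} {ε : Fin 2 → ℝ} {e : Equiv.Perm (Fin 2)} {τ : ℤˣ}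

theorem foldValue_raise (hA : IsSignedPerm A ε e) (h0 : (0 : Plane) ∈ U) :
    foldValue h0 ε e τ (raise r U ε e τ) = 1 := by
  have h1 : fst ε (raise r U ε e τ) =
      CrField.const r U ((timeSign τ * ε 1) • EuclideanSpace.single (e 1) 1) := by
    unfold fst raise
    split_ifs <;> rfl
  change timeSign τ * ε 1 * (fst ε (raise r U ε e τ)).toFun 0 (e 1) = 1
  rw [h1, CrField.const_apply r _ h0]
  simpa using hA.sign_sq τ 1

/-- A transverse unfolding crosses the set of folds with nonzero speed. -/
theorem IsTransverseToFolds.changesSign (hr : 1 ≤ r) (h0 : (0 : Plane) ∈ U)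
    (hA : IsSignedPerm A ε e) {γ : (Fin 1 → ℝ) → Omega r U}
    (hγ : DifferentiableAt ℝ γ 0) (hZ : ((γ 0).toField.transform A τ).HasStandardFold)
    (hv : IsTransverseToFolds γ) :
    ChangesSign fun t => foldValue h0 ε e τ (γ fun _ => t) := by
  obtain ⟨v, hv⟩ := hv
  set L : Omega r U →L[ℝ] ℝ := foldValue h0 ε e τ with hL
  have hL0 : L (γ 0) = 0 := by
    rw [hL, foldValue_eq hA h0]
    exact hZ.1.1
  have hLv : L (fderiv ℝ γ 0 v) ≠ 0 := by
    intro hz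
    refine hv ?_
    have h1 : Tendsto (fun t : ℝ => γ 0 + t • fderiv ℝ γ 0 v) (𝓝[>] 0) (𝓝 (γ 0)) := by
      have h2 : Continuous fun t : ℝ => γ 0 + t • fderiv ℝ γ 0 v := by fun_prop
      simpa using (h2.continuousWithinAt (s := Ioi 0) (x := 0)).tendsto
    refine mem_tangentConeAt_of_add_smul_mem (l := 𝓝[>] (0 : ℝ)) (c := id)
      (tendsto_id.mono_right (nhdsWithin_mono _ fun t ht => ne_of_gt ht)) ?_
    filter_upwards [h1.eventually (eventually_tameAt hr h0 hA hZ)] with t ht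
    refine ht.2 ?_
    change L (γ 0 + t • fderiv ℝ γ 0 v) = 0
    rw [map_add, map_smul, hz, hL0, smul_zero, add_zero]
  have hv1 : v = v 0 • fun _ => (1 : ℝ) := by
    ext i
    rw [Subsingleton.elim i 0]
    simp
  have hd : HasDerivAt (fun t : ℝ => fun _ : Fin 1 => t) (fun _ => (1 : ℝ)) 0 :=
    hasDerivAt_pi.2 fun _ => hasDerivAt_id 0
  have hγd : HasFDerivAt γ (fderiv ℝ γ 0) (fun _ : Fin 1 => (0 : ℝ)) := hγ.hasFDerivAt
  refine ChangesSign.of_hasDerivAt hL0 (L.hasFDerivAt.comp_hasDerivAt 0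
    (hγd.comp_hasDerivAt (0 : ℝ) hd)) fun hz => hLv ?_
  rw [hv1, map_smul, map_smul, hz, smul_zero]

/-- A versal unfolding induces one in which `foldValue` is the parameter. -/
theorem IsVersal.changesSign (hr : 1 ≤ r) (h0 : (0 : Plane) ∈ U) {k : WithTop ℕ∞}
    (hA : IsSignedPerm A ε e) {Z : Omega r U} {γ : (Fin 1 → ℝ) → Omega r U}
    (hγ : ContinuousAt γ 0) (hZ : (Z.toField.transform A τ).HasStandardFold)
    (hv : IsVersal k Z γ) :
    ChangesSign fun t => foldValue h0 ε e τ (γ fun _ => t) := by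
  set L : Omega r U →L[ℝ] ℝ := foldValue h0 ε e τ with hL
  have hL0 : L Z = 0 := by
    rw [hL, foldValue_eq hA h0]
    exact hZ.1.1
  have hγ0 : γ 0 = Z := hv.1.1
  -- the unfolding of `Z` by a constant field
  set β : (Fin 1 → ℝ) → Omega r U := fun t => Z + t 0 • raise r U ε e τ with hβ
  have hβs : ContDiff ℝ k β := by
    have h1 : ContDiff ℝ k fun t : Fin 1 → ℝ => t 0 := contDiff_apply ℝ ℝ 0
    exact contDiff_const.add (h1.smul contDiff_const)
  have hβ0 : β 0 = Z := by simp [hβ]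
  have hLβ : ∀ t, L (β t) = t 0 := fun t => by
    rw [hβ, map_add, map_smul, hL0, hL, foldValue_raise hA h0, smul_eq_mul, mul_one, zero_add]
  obtain ⟨N, μ, hN, hμ, hμ0, heq⟩ := hv.2 1 β le_rfl ⟨hβ0, 1, one_pos, hβs.contDiffOn⟩
  have hι : Continuous fun t : ℝ => fun _ : Fin 1 => t := by fun_prop
  have hμc : ∀ᶠ α in 𝓝 (0 : Fin 1 → ℝ), ContinuousAt μ α := by
    filter_upwards [eventually_mem_nhds_iff.2 hN] with α hα
    exact hμ.continuousAt hα
  have hev := eventually_tameAt (τ := τ) hr h0 hA hZ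
  have e1 : ∀ᶠ α in 𝓝 (0 : Fin 1 → ℝ), SignType.sign (L (γ (μ α))) = SignType.sign (α 0) := by
    have t1 : Tendsto β (𝓝 0) (𝓝 Z) := by
      have := hβs.continuous.tendsto 0
      rwa [hβ0] at this
    have t2 : Tendsto (fun α => γ (μ α)) (𝓝 0) (𝓝 Z) := by
      have h1 : Tendsto μ (𝓝 0) (𝓝 0) := by
        have := hμc.self_of_nhds.tendsto
        rwa [hμ0] at this
      have h2 := hγ.tendsto
      rw [hγ0] at h2
      exact h2.comp h1
    filter_upwards [t1.eventually hev, t2.eventually hev, hN] with α h1 h2 h3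
    have h4 := hA.signs_eq h1.1 h2.1 (leftSign_le_rightSign _) (leftSign_le_rightSign _) (heq α h3)
    have h5 := sign_eq_of_signs_eq h4.1 h4.2
    rw [← hL, hLβ] at h5
    exact h5.symm
  have hvec : ∀ w : Fin 1 → ℝ, (fun _ => w 0) = w := fun w => by
    ext i
    rw [Subsingleton.elim i 0]
  refine ChangesSign.of_comp (μ := fun t => μ (fun _ => t) 0) ?_ (congrFun hμ0 0) ?_
  · filter_upwards [(hι.tendsto 0).eventually hμc] with t ht
    have h1 : ContinuousAt (fun t : ℝ => μ fun _ => t) t :=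
      ContinuousAt.comp (f := fun t : ℝ => fun _ : Fin 1 => t) ht hι.continuousAt
    exact (continuous_apply 0).continuousAt.comp h1
  · filter_upwards [(hι.tendsto 0).eventually e1] with t ht
    rw [hvec]
    exact ht

/-- An unfolding along which `foldValue` changes its sign is equivalent to the normal form: the
parameters correspond by `α = δ` or `α = -δ`, because the value of `X₂` at the origin is `-α` in the
normal form. -/
theorem weaklyEquivalent (hr : 1 ≤ r) (h0 : (0 : Plane) ∈ U) (hA : IsSignedPerm A ε e)
    {Z : Omega r U} {γ : (Fin 1 → ℝ) → Omega r U} (hγ : ContinuousAt γ 0) (hγ0 : γ 0 = Z)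
    (hZ : (Z.toField.transform A τ).HasStandardFold)
    (hs : ChangesSign fun t => foldValue h0 ε e τ (γ fun _ => t)) :
    WeaklyEquivalent (fun δ => (γ δ).toField)
      (fun α => (normalForm (Real.sign ((Z.toField.transform A τ).Y 0 0))
        (Real.sign ((Z.toField.transform A τ).Y 0 1)) (α 0)).transform A.symm τ) := by
  obtain ⟨s, hs, hsign⟩ := hs
  have hs0 : -s ≠ 0 := fun h => by
    rw [neg_eq_zero] at h
    rw [h, mul_zero] at hs
    exact zero_ne_one hs
  have hvec : ∀ w : Fin 1 → ℝ, (fun _ => w 0) = w := fun w => by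
    ext i
    rw [Subsingleton.elim i 0]
  have hss : ∀ l, Real.sign ((Z.toField.transform A τ).Y 0 l) *
      Real.sign ((Z.toField.transform A τ).Y 0 l) = 1 := by
    intro l
    rcases Real.sign_apply_eq_of_ne_zero _ (hZ.2.1 l) with h | h <;> rw [h] <;> norm_num
  have hcoord : Tendsto (fun δ : Fin 1 → ℝ => δ 0) (𝓝 0) (𝓝 0) :=
    (continuous_apply (0 : Fin 1)).tendsto 0
  have htend : Tendsto γ (𝓝 0) (𝓝 Z) := hγ0 ▸ hγ.tendsto
  have hsmall : ∀ᶠ x : ℝ in 𝓝 0, |x| < 1 :=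
    continuous_abs.continuousAt.eventually (gt_mem_nhds (by simp))
  obtain ⟨O, hO, hOo, h0O⟩ := eventually_nhds_iff.1 ((htend.eventually
    (eventually_tameAt (τ := τ) hr h0 hA hZ)).and
    ((hcoord.eventually hsign).and (hcoord.eventually hsmall)))
  refine ⟨(Homeomorph.smulOfNeZero (-s) hs0).toOpenPartialHomeomorph.restrOpen O hOo,
    ⟨mem_univ _, h0O⟩, smul_zero _, fun δ hδ => ?_⟩
  obtain ⟨h1, h2, h3⟩ := hO δ hδ.2
  change LocallyEquivalent (γ δ).toField
    ((normalForm _ _ (-s * δ 0)).transform A.symm τ)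
  have habs : |s| = 1 := by
    rcases mul_self_eq_one_iff.1 hs with h | h <;> simp [h]
  have h4 := normalForm_tameAt (hss 0) (hss 1) (α := -s * δ 0)
    (by rw [abs_mul, abs_neg, habs, one_mul]; exact h3)
  -- both values of `X₂` at the origin have the sign of `s δ`
  have h5 : SignType.sign (-(-s * δ 0)) = SignType.sign (foldValue h0 ε e τ (γ δ)) := by
    rw [neg_mul, neg_neg, ← h2]
    change SignType.sign (foldValue h0 ε e τ (γ fun _ => δ 0)) = _
    rw [hvec]
  rw [leftSign_congr h5, rightSign_congr h5] at h4
  exact hA.locallyEquivalent h1.1 h4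

end Symmetry

end Omega

theorem PiecewiseField.isSignedPerm_refl :
    PiecewiseField.IsSignedPerm (LinearIsometryEquiv.refl ℝ Plane) (fun _ => 1) (Equiv.refl _) :=
  ⟨fun _ _ => (one_mul _).symm, fun _ => one_mul 1⟩

theorem PiecewiseField.transform_refl (Z : PiecewiseField) :
    Z.transform (LinearIsometryEquiv.refl ℝ Plane) 1 = Z := by
  have h : (LinearIsometryEquiv.refl ℝ Plane) '' regionPos = regionPos := image_id _
  simp only [transform, if_pos h, one_smul]
  rfl

theorem mainTheorem10 (r : ℕ) (hr : 1 ≤ r) (U : TopologicalSpace.Opens Plane)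
    (hU : Bornology.IsBounded (U : Set Plane)) (h0 : (0 : Plane) ∈ U)
    (k : WithTop ℕ∞) (hk : 1 ≤ k) (Z : Omega r U) (γ : (Fin 1 → ℝ) → Omega r U)
    (hγ : Omega.IsUnfolding k Z γ)
    (hv : Omega.IsVersal k Z γ ∨ Omega.IsTransverseToFolds γ) :
    (Z.toField.HasStandardFold →
      PiecewiseField.WeaklyEquivalent (fun δ => (γ δ).toField)
        (fun α => PiecewiseField.normalForm
          (Real.sign (Z.toField.Y 0 0)) (Real.sign (Z.toField.Y 0 1)) (α 0))) ∧
    (Z.toField.HasRegularFold →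
      ∃ (A : Plane ≃ₗᵢ[ℝ] Plane) (τ : ℤˣ),
        A '' PiecewiseField.switching = PiecewiseField.switching ∧
        (Z.toField.transform A τ).HasStandardFold ∧
        PiecewiseField.WeaklyEquivalent (fun δ => (γ δ).toField)
          (fun α => (PiecewiseField.normalForm
            (Real.sign ((Z.toField.transform A τ).Y 0 0))
            (Real.sign ((Z.toField.transform A τ).Y 0 1)) (α 0)).transform A.symm τ)) := by
  have hd : DifferentiableAt ℝ γ 0 := hγ.contDiffAt.differentiableAt (by
    rintro rfl
    simp at hk)
  have key : ∀ {A : Plane ≃ₗᵢ[ℝ] Plane} {ε : Fin 2 → ℝ} {e : Equiv.Perm (Fin 2)} {τ : ℤˣ},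
      PiecewiseField.IsSignedPerm A ε e → (Z.toField.transform A τ).HasStandardFold →
      PiecewiseField.WeaklyEquivalent (fun δ => (γ δ).toField)
          (fun α => (PiecewiseField.normalForm
            (Real.sign ((Z.toField.transform A τ).Y 0 0))
            (Real.sign ((Z.toField.transform A τ).Y 0 1)) (α 0)).transform A.symm τ) := by
    intro A ε e τ hA hZ
    refine Omega.weaklyEquivalent hr h0 hA hd.continuousAt hγ.1 hZ ?_
    rcases hv with hv | hv
    · exact hv.changesSign hr h0 hA hd.continuousAt hZ
    · exact hv.changesSign hr h0 hA hd (by rw [hγ.1]; exact hZ)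
  constructor
  · intro hZ
    have := key (τ := 1) PiecewiseField.isSignedPerm_refl (by
      rw [PiecewiseField.transform_refl]; exact hZ)
    have hsymm : (LinearIsometryEquiv.refl ℝ Plane).symm = LinearIsometryEquiv.refl ℝ Plane := rfl
    simpa only [PiecewiseField.transform_refl, hsymm] using this
  · intro hZ
    obtain ⟨A, ε, e, τ, hA, hf⟩ := hZ.exists_transform
      ((CrField.contDiffAt hr h0 Z.1).differentiableAt (by norm_num))
      ((CrField.contDiffAt hr h0 Z.2).differentiableAt (by norm_num))
    exact ⟨A, τ, hA.image_switching, hf, key hA hf⟩
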